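/- For $s\in\mathbb{R}$ let $h^s$ be the space of sequences $a=(a(k))_{k\in\mathbb{Z}}$ in $\mathbb{C}$ with $\|a\|_{h^s}^2=\sum_{k\in\mathbb{Z}}(1+|k|)^{2s}|a(k)|^2<\infty$; let $h^s_+$ and $h^s_-$ be the subspaces of sequences vanishing at all odd, respectively all even, integers, and let $h^s_{+,0}=\{a\in h^s_+ : a(0)=0\}$. For $m\in\mathbb{N}=\{1,2,\dots\}$, $\alpha\in[0,1]$ and $v\in h_+^{-m\alpha}$ let $T_\alpha(v)=A^m+B(v)$ be the unbounded operator in $h_-^{-m\alpha}$ with domain $h_-^{m(2-\alpha)}$ given by $$(A^mu)(k)=k^{2m}\pi^{2m}u(k),\qquad (B(v)u)(k)=\sum_{j\in\mathbb{Z}}v(k-j)u(j).$$ **Theorem.** Let $m\in\mathbb{N}$, $\alpha\in[0,1)$, $\varepsilon>0$ and $R\in\mathbb{R}$. There is a constant $C=C(m,\alpha,\varepsilon,R)$ such that for every $v\in h_{+,0}^{-m\alpha}$ with $\|v\|_{h^{-m\alpha}}\le R$ the following holds. The eigenvalues of $T_\alpha(v)$, repeated according to their algebraic multiplicities, can be listed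 as a sequence $(\lambda_k)_{k\ge1}$ in lexicographic order ($\operatorname{Re}\lambda_k<\operatorname{Re}\lambda_{k+1}$, or $\operatorname{Re}\lambda_k=\operatorname{Re}\lambda_{k+1}$ and $\operatorname{Im}\lambda_k\le\operatorname{Im}\lambda_{k+1}$), and for the means $\tau_n=(\lambda_{2n}+\lambda_{2n-1})/2$ there is a sequence $r\in h^{m(1-2\alpha-\varepsilon)}$ with $\|r\|_{h^{m(1-2\alpha-\varepsilon)}}\le C$ and $$\tau_n=(2n-1)^{2m}\pi^{2m}+r(n)\qquad\text{for all } n\ge1 .$$ -/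

import Mathlib

noncomputable section

namespace SemiPeriodic

/-- The bracket `⟨k⟩ = 1 + |k|`. -/
def bracket (k : ℤ) : ℝ := 1 + |(k : ℝ)|

theorem one_le_bracket (k : ℤ) : 1 ≤ bracket k := by
  unfold bracket; linarith [abs_nonneg (k : ℝ)]

theorem bracket_pos (k : ℤ) : 0 < bracket k := lt_of_lt_of_le one_pos (one_le_bracket k)

/-- The weighted sequence space `h^s`: all `a : ℤ → ℂ` with `∑ ⟨k⟩^{2s} |a k|² < ∞`. -/
def hSpace (s : ℝ) : Submodule ℂ (ℤ → ℂ) where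
  carrier := {a | Summable fun k : ℤ => bracket k ^ (2 * s) * ‖a k‖ ^ 2}
  zero_mem' := by simp
  add_mem' := by
    intro a b ha hb
    refine Summable.of_nonneg_of_le (fun k => ?_) (fun k => ?_)
      ((ha.mul_left 2).add (hb.mul_left 2))
    · have := Real.rpow_nonneg (bracket_pos k).le (2 * s)
      positivity
    · have h1 : ‖a k + b k‖ ^ 2 ≤ 2 * ‖a k‖ ^ 2 + 2 * ‖b k‖ ^ 2 := by
        have h := norm_add_le (a k) (b k)
        have h0 := norm_nonneg (a k + b k)
        nlinarith [sq_nonneg (‖a k‖ - ‖b k‖)]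
      have h2 := mul_le_mul_of_nonneg_left h1 (Real.rpow_nonneg (bracket_pos k).le (2 * s))
      simp only [Pi.add_apply]
      linarith
  smul_mem' := by
    intro c a ha
    refine (Summable.mul_left (‖c‖ ^ 2) ha).congr (fun k => ?_)
    simp only [Pi.smul_apply, smul_eq_mul, norm_mul]
    ring

/-- The norm of `h^s`. -/
def hNorm (s : ℝ) (a : ℤ → ℂ) : ℝ :=
  Real.sqrt (∑' k : ℤ, bracket k ^ (2 * s) * ‖a k‖ ^ 2)

/-- `h_+^s`: the sequences of `h^s` that vanish at all odd integers. -/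
def hPlus (s : ℝ) : Submodule ℂ (ℤ → ℂ) where
  carrier := {a | a ∈ hSpace s ∧ ∀ k : ℤ, a (2 * k + 1) = 0}
  zero_mem' := ⟨(hSpace s).zero_mem, fun _ => rfl⟩
  add_mem' := fun ha hb => ⟨(hSpace s).add_mem ha.1 hb.1, fun k => by simp [ha.2 k, hb.2 k]⟩
  smul_mem' := fun c _ ha => ⟨(hSpace s).smul_mem c ha.1, fun k => by simp [ha.2 k]⟩

/-- `h_-^s`: the sequences of `h^s` that vanish at all even integers. -/
def hMinus (s : ℝ) : Submodule ℂ (ℤ → ℂ) where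
  carrier := {a | a ∈ hSpace s ∧ ∀ k : ℤ, a (2 * k) = 0}
  zero_mem' := ⟨(hSpace s).zero_mem, fun _ => rfl⟩
  add_mem' := fun ha hb => ⟨(hSpace s).add_mem ha.1 hb.1, fun k => by simp [ha.2 k, hb.2 k]⟩
  smul_mem' := fun c _ ha => ⟨(hSpace s).smul_mem c ha.1, fun k => by simp [ha.2 k]⟩

/-- `h_{+,0}^s`: the sequences of `h_+^s` that vanish at `0`. -/
def hPlusZero (s : ℝ) : Submodule ℂ (ℤ → ℂ) where
  carrier := {a | a ∈ hPlus s ∧ a 0 = 0}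
  zero_mem' := ⟨(hPlus s).zero_mem, rfl⟩
  add_mem' := fun ha hb => ⟨(hPlus s).add_mem ha.1 hb.1, by simp [ha.2, hb.2]⟩
  smul_mem' := fun c _ ha => ⟨(hPlus s).smul_mem c ha.1, by simp [ha.2]⟩

/-- The convolution `(a * b)(k) = ∑_j a(k - j) b(j)`. -/
def conv (a b : ℤ → ℂ) (k : ℤ) : ℂ := ∑' j : ℤ, a (k - j) * b j

/-! ### Convolution maps `h^{-mα} × h^{m(2-α)}` into `h^{-mα}` -/

theorem cauchy_schwarz {f g : ℤ → ℝ} (hf0 : ∀ k, 0 ≤ f k) (hg0 : ∀ k, 0 ≤ g k)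
    (hf : Summable fun k => f k ^ 2) (hg : Summable fun k => g k ^ 2) :
    (Summable fun k => f k * g k) ∧
      (∑' k, f k * g k) ^ 2 ≤ (∑' k, f k ^ 2) * ∑' k, g k ^ 2 := by
  have hs : Summable fun k => f k * g k := by
    refine Summable.of_nonneg_of_le (fun k => mul_nonneg (hf0 k) (hg0 k)) (fun k => ?_) (hf.add hg)
    nlinarith [sq_nonneg (f k - g k), hf0 k, hg0 k, sq_nonneg (f k), sq_nonneg (g k)]
  refine ⟨hs, le_of_tendsto_of_tendsto' (Filter.Tendsto.pow hs.hasSum 2)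
    (Filter.Tendsto.mul hf.hasSum hg.hasSum)
    (fun s => Finset.sum_mul_sq_le_sq_mul_sq s f g)⟩

theorem bracket_sub_le_mul (k j : ℤ) : bracket (k - j) ≤ bracket k * bracket j := by
  unfold bracket
  push_cast
  have h := abs_sub (k : ℝ) (j : ℝ)
  nlinarith [abs_nonneg (k : ℝ), abs_nonneg (j : ℝ), mul_nonneg (abs_nonneg (k : ℝ)) (abs_nonneg (j : ℝ))]

theorem bracket_sub_le_add (k j : ℤ) : bracket (k - j) ≤ bracket k + bracket j := by
  unfold bracket
  push_cast
  linarith [abs_sub (k : ℝ) (j : ℝ)]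

theorem summable_bracket {s : ℝ} (hs : 1 < s) : Summable fun k : ℤ => bracket k ^ (-s) := by
  have h := (Real.summable_abs_int_rpow hs)
  refine Summable.of_norm_bounded_eventually (g := fun k : ℤ => |(k : ℝ)| ^ (-s)) h ?_
  have h0 : ({0} : Set ℤ)ᶜ ∈ Filter.cofinite := (Set.finite_singleton 0).compl_mem_cofinite
  filter_upwards [h0] with k hk
  have hk' : (0 : ℝ) < |(k : ℝ)| := by
    simpa using hk
  rw [Real.norm_of_nonneg (Real.rpow_nonneg (bracket_pos k).le _)]
  refine Real.rpow_le_rpow_of_nonpos hk' ?_ (by linarith)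
  unfold bracket; linarith

theorem summable_rpow_mul_iff {s : ℝ} {a : ℤ → ℂ} :
    a ∈ hSpace s ↔ Summable fun k : ℤ => (bracket k ^ s * ‖a k‖) ^ 2 := by
  change Summable _ ↔ _
  refine summable_congr (fun k => ?_)
  rw [mul_pow, ← Real.rpow_natCast (bracket k ^ s), ← Real.rpow_mul (bracket_pos k).le]
  congr 2
  push_cast
  ring

theorem summable_conv {a b : ℝ} (ha : 0 ≤ a) (hab : a ≤ b) {v u : ℤ → ℂ}
    (hv : v ∈ hSpace (-a)) (hu : u ∈ hSpace b) (k : ℤ) :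
    Summable fun j : ℤ => ‖v (k - j)‖ * ‖u j‖ := by
  have hx := (Equiv.subLeft k).summable_iff.mpr (summable_rpow_mul_iff.mp hv)
  have hy := summable_rpow_mul_iff.mp hu
  have h := (cauchy_schwarz
    (f := fun j => bracket (k - j) ^ (-a) * ‖v (k - j)‖) (g := fun j => bracket j ^ b * ‖u j‖)
    (fun j => mul_nonneg (Real.rpow_nonneg (bracket_pos _).le _) (norm_nonneg _))
    (fun j => mul_nonneg (Real.rpow_nonneg (bracket_pos _).le _) (norm_nonneg _)) hx hy).1
  refine Summable.of_nonneg_of_le (fun j => by positivity) (fun j => ?_)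
    (h.mul_left (bracket k ^ a))
  have h1 : 1 ≤ bracket k ^ a * bracket (k - j) ^ (-a) * bracket j ^ b := by
    have e1 : bracket (k - j) ^ a ≤ bracket k ^ a * bracket j ^ a := by
      rw [← Real.mul_rpow (bracket_pos _).le (bracket_pos _).le]
      exact Real.rpow_le_rpow (bracket_pos _).le (bracket_sub_le_mul k j) ha
    have e2 : bracket j ^ a ≤ bracket j ^ b :=
      Real.rpow_le_rpow_of_exponent_le (one_le_bracket j) hab
    have e3 : 0 < bracket (k - j) ^ a := Real.rpow_pos_of_pos (bracket_pos _) _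
    have e4 : 0 < bracket k ^ a := Real.rpow_pos_of_pos (bracket_pos _) _
    rw [Real.rpow_neg (bracket_pos _).le, mul_right_comm, ← div_eq_mul_inv, one_le_div e3]
    exact e1.trans (mul_le_mul_of_nonneg_left e2 e4.le)
  calc ‖v (k - j)‖ * ‖u j‖ = 1 * (‖v (k - j)‖ * ‖u j‖) := (one_mul _).symm
    _ ≤ (bracket k ^ a * bracket (k - j) ^ (-a) * bracket j ^ b) * (‖v (k - j)‖ * ‖u j‖) :=
        mul_le_mul_of_nonneg_right h1 (by positivity)
    _ = _ := by ring

theorem weight_bound {a b : ℝ} (ha : 0 ≤ a) (hle : a ≤ b) (hab : 2 ≤ a + b) :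
    ∃ P Q : ℤ → ℝ, (∀ k, 0 ≤ P k) ∧ (∀ k, 0 ≤ Q k) ∧ (Summable fun k => P k ^ 2) ∧
      (Summable fun k => Q k ^ 2) ∧
      ∀ k j : ℤ, bracket k ^ (-a) * bracket (k - j) ^ a * bracket j ^ (-b) ≤ P k + Q j := by
  have sq : ∀ (c : ℝ) (k : ℤ), (bracket k ^ (-c)) ^ 2 = bracket k ^ (-(2 * c)) := by
    intro c k
    rw [← Real.rpow_natCast (bracket k ^ (-c)), ← Real.rpow_mul (bracket_pos k).le]
    congr 1
    push_cast
    ring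
  have pos : ∀ (c : ℝ) (k : ℤ), 0 < bracket k ^ c := fun c k =>
    Real.rpow_pos_of_pos (bracket_pos k) c
  by_cases h : a ≤ 1 / 2
  · refine ⟨fun _ => 0, fun j => bracket j ^ (-(1 : ℝ)), fun _ => le_rfl, fun j => (pos _ j).le,
      by simp, ?_, ?_⟩
    · simp only [sq]
      exact summable_bracket (by norm_num)
    · intro k j
      have e1 : bracket (k - j) ^ a ≤ bracket k ^ a * bracket j ^ a := by
        rw [← Real.mul_rpow (bracket_pos _).le (bracket_pos _).le]
        exact Real.rpow_le_rpow (bracket_pos _).le (bracket_sub_le_mul k j) ha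
      have e2 : bracket k ^ (-a) * bracket k ^ a = 1 := by
        rw [← Real.rpow_add (bracket_pos k)]; simp
      calc bracket k ^ (-a) * bracket (k - j) ^ a * bracket j ^ (-b)
          ≤ bracket k ^ (-a) * (bracket k ^ a * bracket j ^ a) * bracket j ^ (-b) := by
            have := (pos (-a) k).le
            have := (pos (-b) j).le
            gcongr
        _ = bracket j ^ a * bracket j ^ (-b) := by rw [← mul_assoc, e2, one_mul]
        _ = bracket j ^ (a - b) := by rw [← Real.rpow_add (bracket_pos j)]; ring_nf
        _ ≤ bracket j ^ (-(1 : ℝ)) :=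
            Real.rpow_le_rpow_of_exponent_le (one_le_bracket j) (by linarith)
        _ = 0 + bracket j ^ (-(1 : ℝ)) := (zero_add _).symm
  · push Not at h
    refine ⟨fun k => 2 ^ a * bracket k ^ (-a), fun j => 2 ^ a * bracket j ^ (-b),
      fun k => mul_nonneg (by positivity) (pos _ k).le,
      fun k => mul_nonneg (by positivity) (pos _ k).le, ?_, ?_, ?_⟩
    · simp only [mul_pow, sq]
      exact (summable_bracket (by linarith)).mul_left _
    · simp only [mul_pow, sq]
      exact (summable_bracket (by linarith)).mul_left _
    · intro k j
      rcases le_total (bracket k) (bracket j) with hkj | hkj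
      · have e1 : bracket (k - j) ^ a ≤ 2 ^ a * bracket j ^ a := by
          rw [← Real.mul_rpow (by norm_num) (bracket_pos _).le]
          exact Real.rpow_le_rpow (bracket_pos _).le
            (by linarith [bracket_sub_le_add k j]) ha
        have e2 : bracket j ^ a * bracket j ^ (-b) ≤ 1 := by
          rw [← Real.rpow_add (bracket_pos j)]
          exact Real.rpow_le_one_of_one_le_of_nonpos (one_le_bracket j) (by linarith)
        have p1 := (pos (-a) k).le
        have p2 := (pos (-b) j).le
        have p3 : (0 : ℝ) ≤ 2 ^ a := by positivity
        calc bracket k ^ (-a) * bracket (k - j) ^ a * bracket j ^ (-b)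
            ≤ bracket k ^ (-a) * (2 ^ a * bracket j ^ a) * bracket j ^ (-b) := by gcongr
          _ = 2 ^ a * bracket k ^ (-a) * (bracket j ^ a * bracket j ^ (-b)) := by ring
          _ ≤ 2 ^ a * bracket k ^ (-a) * 1 := by gcongr
          _ ≤ 2 ^ a * bracket k ^ (-a) + 2 ^ a * bracket j ^ (-b) := by
              nlinarith [mul_nonneg p3 p2]
      · have e1 : bracket (k - j) ^ a ≤ 2 ^ a * bracket k ^ a := by
          rw [← Real.mul_rpow (by norm_num) (bracket_pos _).le]
          exact Real.rpow_le_rpow (bracket_pos _).le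
            (by linarith [bracket_sub_le_add k j]) ha
        have e2 : bracket k ^ (-a) * bracket k ^ a = 1 := by
          rw [← Real.rpow_add (bracket_pos k)]; simp
        have p1 := (pos (-a) k).le
        have p2 := (pos (-b) j).le
        have p3 : (0 : ℝ) ≤ 2 ^ a := by positivity
        calc bracket k ^ (-a) * bracket (k - j) ^ a * bracket j ^ (-b)
            ≤ bracket k ^ (-a) * (2 ^ a * bracket k ^ a) * bracket j ^ (-b) := by gcongr
          _ = 2 ^ a * (bracket k ^ (-a) * bracket k ^ a) * bracket j ^ (-b) := by ring
          _ = 2 ^ a * bracket j ^ (-b) := by rw [e2, mul_one]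
          _ ≤ 2 ^ a * bracket k ^ (-a) + 2 ^ a * bracket j ^ (-b) := by
              nlinarith [mul_nonneg p3 p1]

theorem conv_mem {a b : ℝ} (ha : 0 ≤ a) (hle : a ≤ b) (hab : 2 ≤ a + b) {v u : ℤ → ℂ}
    (hv : v ∈ hSpace (-a)) (hu : u ∈ hSpace b) : conv v u ∈ hSpace (-a) := by
  obtain ⟨P, Q, hP0, hQ0, hP, hQ, hPQ⟩ := weight_bound ha hle hab
  have pos : ∀ (c : ℝ) (k : ℤ), 0 < bracket k ^ c := fun c k =>
    Real.rpow_pos_of_pos (bracket_pos k) c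
  obtain ⟨X, hXdef⟩ : ∃ X : ℤ → ℝ, X = fun l => bracket l ^ (-a) * ‖v l‖ := ⟨_, rfl⟩
  obtain ⟨Y, hYdef⟩ : ∃ Y : ℤ → ℝ, Y = fun j => bracket j ^ b * ‖u j‖ := ⟨_, rfl⟩
  have hX0 : ∀ l, 0 ≤ X l := fun l => by
    rw [hXdef]; exact mul_nonneg (pos _ l).le (norm_nonneg _)
  have hY0 : ∀ j, 0 ≤ Y j := fun j => by
    rw [hYdef]; exact mul_nonneg (pos _ j).le (norm_nonneg _)
  have hX : Summable fun l => X l ^ 2 := by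
    rw [hXdef]; exact summable_rpow_mul_iff.mp hv
  have hY : Summable fun j => Y j ^ 2 := by
    rw [hYdef]; exact summable_rpow_mul_iff.mp hu
  have hXk : ∀ k, Summable fun j => X (k - j) ^ 2 := fun k =>
    (Equiv.subLeft k).summable_iff.mpr hX
  have hXY : Summable fun p : ℤ × ℤ => X (p.1 - p.2) ^ 2 * Y p.2 ^ 2 := by
    have h := hX.mul_of_nonneg hY (fun _ => sq_nonneg _) (fun _ => sq_nonneg _)
    let e : ℤ × ℤ ≃ ℤ × ℤ :=
      { toFun := fun p => (p.1 - p.2, p.2)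
        invFun := fun p => (p.1 + p.2, p.2)
        left_inv := fun p => by simp
        right_inv := fun p => by simp }
    exact (e.summable_iff (f := fun q : ℤ × ℤ => X q.1 ^ 2 * Y q.2 ^ 2)).mpr h
  have hXYk : ∀ k, Summable fun j => (X (k - j) * Y j) ^ 2 := fun k => by
    simpa only [mul_pow] using hXY.prod_factor k
  rw [summable_rpow_mul_iff]
  refine Summable.of_nonneg_of_le (fun k => sq_nonneg _) (fun k => ?_)
    (((hP.mul_right ((∑' l, X l ^ 2) * ∑' j, Y j ^ 2)).mul_left 2).add
      ((hXY.prod.mul_left (∑' j, Q j ^ 2)).mul_left 2))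
  have hs := summable_conv ha hle hv hu k
  obtain ⟨s1, c1⟩ := cauchy_schwarz (f := fun j => X (k - j)) (g := Y) (fun j => hX0 _) hY0
    (hXk k) hY
  obtain ⟨s2, c2⟩ := cauchy_schwarz (f := Q) (g := fun j => X (k - j) * Y j) hQ0
    (fun j => mul_nonneg (hX0 _) (hY0 _)) hQ (hXYk k)
  have e1 : ∑' j, X (k - j) ^ 2 = ∑' l, X l ^ 2 :=
    (Equiv.subLeft k).tsum_eq (fun l => X l ^ 2)
  rw [e1] at c1
  have key : bracket k ^ (-a) * ‖conv v u k‖ ≤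
      P k * (∑' j, X (k - j) * Y j) + ∑' j, Q j * (X (k - j) * Y j) := by
    have h1 : ‖conv v u k‖ ≤ ∑' j, ‖v (k - j)‖ * ‖u j‖ := by
      unfold conv
      have h := norm_tsum_le_tsum_norm (f := fun j => v (k - j) * u j) (by simpa using hs)
      simpa using h
    calc bracket k ^ (-a) * ‖conv v u k‖
        ≤ bracket k ^ (-a) * ∑' j, ‖v (k - j)‖ * ‖u j‖ :=
          mul_le_mul_of_nonneg_left h1 (pos _ k).le
      _ = ∑' j, bracket k ^ (-a) * (‖v (k - j)‖ * ‖u j‖) := by rw [tsum_mul_left]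
      _ ≤ ∑' j, (P k * (X (k - j) * Y j) + Q j * (X (k - j) * Y j)) := by
          refine Summable.tsum_le_tsum (fun j => ?_) (hs.mul_left _) ((s1.mul_left _).add s2)
          have w := mul_le_mul_of_nonneg_right (hPQ k j) (mul_nonneg (hX0 (k - j)) (hY0 j))
          have i1 : bracket (k - j) ^ a * bracket (k - j) ^ (-a) = 1 := by
            rw [← Real.rpow_add (bracket_pos _)]; simp
          have i2 : bracket j ^ (-b) * bracket j ^ b = 1 := by
            rw [← Real.rpow_add (bracket_pos _)]; simp
          calc bracket k ^ (-a) * (‖v (k - j)‖ * ‖u j‖)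
              = bracket k ^ (-a) * (bracket (k - j) ^ a * bracket (k - j) ^ (-a)) *
                (bracket j ^ (-b) * bracket j ^ b) * (‖v (k - j)‖ * ‖u j‖) := by
                rw [i1, i2]; ring
            _ = bracket k ^ (-a) * bracket (k - j) ^ a * bracket j ^ (-b) *
                (X (k - j) * Y j) := by simp only [hXdef, hYdef]; ring
            _ ≤ _ := w.trans (by rw [add_mul])
      _ = _ := by rw [(s1.mul_left (P k)).tsum_add s2, tsum_mul_left]
  have n0 : 0 ≤ bracket k ^ (-a) * ‖conv v u k‖ := mul_nonneg (pos _ k).le (norm_nonneg _)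
  have key2 := pow_le_pow_left₀ n0 key 2
  have c1' := mul_le_mul_of_nonneg_left c1 (sq_nonneg (P k))
  simp only [mul_pow] at c2
  set A := ∑' j, X (k - j) * Y j
  set B := ∑' j, Q j * (X (k - j) * Y j)
  nlinarith [sq_nonneg (P k * A - B)]

/-! ### The operator and its eigenvalues -/

/-- Entrywise action of `A^m`: multiplication by `k^{2m} π^{2m}`. -/
def diag (m : ℕ) (u : ℤ → ℂ) (k : ℤ) : ℂ := (k : ℂ) ^ (2 * m) * (Real.pi : ℂ) ^ (2 * m) * u k

theorem diag_mem (m : ℕ) (s : ℝ) {u : ℤ → ℂ} (hu : u ∈ hSpace (s + 2 * m)) :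
    diag m u ∈ hSpace s := by
  rw [summable_rpow_mul_iff] at hu ⊢
  refine Summable.of_nonneg_of_le (fun k => sq_nonneg _) (fun k => ?_)
    (hu.mul_left ((Real.pi ^ (2 * m)) ^ 2))
  rw [← mul_pow]
  have p : 0 < bracket k ^ s := Real.rpow_pos_of_pos (bracket_pos k) s
  refine pow_le_pow_left₀ (mul_nonneg p.le (norm_nonneg _)) ?_ 2
  have e : bracket k ^ (s + 2 * m) = bracket k ^ s * bracket k ^ (2 * m) := by
    rw [Real.rpow_add (bracket_pos k)]
    congr 1
    rw [← Real.rpow_natCast]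
    push_cast
    rfl
  have h : |(k : ℝ)| ^ (2 * m) ≤ bracket k ^ (2 * m) :=
    pow_le_pow_left₀ (abs_nonneg _) (by unfold bracket; linarith) _
  have n : ‖diag m u k‖ = |(k : ℝ)| ^ (2 * m) * Real.pi ^ (2 * m) * ‖u k‖ := by
    simp [diag, abs_of_pos Real.pi_pos]
  rw [n, e]
  have hp := Real.pi_pos
  calc bracket k ^ s * (|(k : ℝ)| ^ (2 * m) * Real.pi ^ (2 * m) * ‖u k‖)
      ≤ bracket k ^ s * (bracket k ^ (2 * m) * Real.pi ^ (2 * m) * ‖u k‖) := by gcongr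
    _ = _ := by ring

/-- `T_α(v) u = A^m u + v * u` lies in `h_-^{-mα}` for `u ∈ h_-^{m(2-α)}`. -/
theorem diag_add_conv_mem {m : ℕ} (hm : 1 ≤ m) {α : ℝ} (hα : α ∈ Set.Icc (0 : ℝ) 1)
    {v : ℤ → ℂ} (hv : v ∈ hPlus (-(m * α))) {u : ℤ → ℂ} (hu : u ∈ hMinus (m * (2 - α))) :
    diag m u + conv v u ∈ hMinus (-(m * α)) := by
  have hm' : (1 : ℝ) ≤ m := by exact_mod_cast hm
  have h1 : (m : ℝ) * α ≤ m := by nlinarith [hα.2]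
  refine ⟨(hSpace _).add_mem (diag_mem m _ ?_) (conv_mem ?_ ?_ ?_ hv.1 hu.1), fun k => ?_⟩
  · have e : -((m : ℝ) * α) + 2 * m = m * (2 - α) := by ring
    rw [e]; exact hu.1
  · exact mul_nonneg (by linarith) hα.1
  · linarith
  · linarith
  · have z : ∀ j, v (2 * k - j) * u j = 0 := by
      intro j
      rcases Int.even_or_odd' j with ⟨i, hi | hi⟩
      · rw [hi, hu.2 i, mul_zero]
      · have : 2 * k - j = 2 * (k - i - 1) + 1 := by rw [hi]; ring
        rw [this, hv.2, zero_mul]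
    simp [diag, conv, hu.2 k, z]

theorem conv_add {a b : ℝ} (ha : 0 ≤ a) (hle : a ≤ b) {v u w : ℤ → ℂ}
    (hv : v ∈ hSpace (-a)) (hu : u ∈ hSpace b) (hw : w ∈ hSpace b) :
    conv v (u + w) = conv v u + conv v w := by
  funext k
  have s : ∀ {x : ℤ → ℂ}, x ∈ hSpace b → Summable fun j => v (k - j) * x j := fun hx =>
    Summable.of_norm (by simpa using summable_conv ha hle hv hx k)
  simp only [conv, Pi.add_apply, mul_add]
  exact (s hu).tsum_add (s hw)

theorem conv_smul (c : ℂ) (v u : ℤ → ℂ) : conv v (c • u) = c • conv v u := by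
  funext k
  simp only [conv, Pi.smul_apply, smul_eq_mul]
  rw [← tsum_mul_left]
  exact tsum_congr fun j => by ring

/-- The unbounded operator `T_α(v) = A^m + B(v)` in `h_-^{-mα}` with domain `h_-^{m(2-α)}`, where
`A^m` is the diagonal operator with entries `k^{2m} π^{2m}` (`k` odd) and `B(v) u = v * u`. -/
def operatorT (m : ℕ) (hm : 1 ≤ m) (α : ℝ) (hα : α ∈ Set.Icc (0 : ℝ) 1)
    (v : ℤ → ℂ) (hv : v ∈ hPlus (-(m * α))) :
    hMinus (-(m * α)) →ₗ.[ℂ] hMinus (-(m * α)) where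
  domain := (hMinus (m * (2 - α))).comap (hMinus (-(m * α))).subtype
  toFun :=
    { toFun := fun u => ⟨diag m u.1.1 + conv v u.1.1, diag_add_conv_mem hm hα hv u.2⟩
      map_add' := by
        intro u w
        have hm' : (1 : ℝ) ≤ m := by exact_mod_cast hm
        have h1 : (m : ℝ) * α ≤ m := by nlinarith [hα.2]
        have h := conv_add (mul_nonneg (by linarith) hα.1) (by linarith) hv.1 u.2.1 w.2.1
        apply Subtype.ext
        funext k
        have hk := congrFun h k
        simp only [Pi.add_apply, Submodule.subtype_apply] at hk
        simp only [Submodule.coe_add, Pi.add_apply, diag, hk]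
        ring
      map_smul' := by
        intro c u
        apply Subtype.ext
        funext k
        have hk := congrFun (conv_smul c v u.1.1) k
        simp only [Pi.smul_apply, smul_eq_mul] at hk
        simp only [Submodule.coe_smul, Pi.add_apply, Pi.smul_apply, smul_eq_mul, diag, hk,
          RingHom.id_apply]
        ring }

section Multiplicity

variable {E : Type*} [AddCommGroup E] [Module ℂ E]

/-- `rootKer T μ p = ker (T - μ)^p`, with the natural domain of the power: `f` belongs to
`ker (T - μ)^{p+1}` iff `f ∈ Dom T` and `(T - μ) f ∈ ker (T - μ)^p`. -/
def rootKer (T : E →ₗ.[ℂ] E) (μ : ℂ) : ℕ → Submodule ℂ E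
  | 0 => ⊥
  | p + 1 => ((rootKer T μ p).comap (T.toFun - μ • T.domain.subtype)).map T.domain.subtype

/-- The algebraic multiplicity of `μ` for `T`: the dimension of the space of root vectors
`⋃_p ker (T - μ)^p` (it is `0` iff `μ` is not an eigenvalue). -/
def algMultiplicity (T : E →ₗ.[ℂ] E) (μ : ℂ) : ℕ∞ :=
  Cardinal.toENat (Module.rank ℂ ↥(⨆ p : ℕ, rootKer T μ p))

/-- Lexicographic order on `ℂ`. -/
def LexLE (z w : ℂ) : Prop := z.re < w.re ∨ (z.re = w.re ∧ z.im ≤ w.im)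

/-- `lam 1, lam 2, …` lists all eigenvalues of `T`, each repeated according to its algebraic
multiplicity, in lexicographic order (the value `lam 0` is irrelevant). -/
structure IsEigenvalueSequence (T : E →ₗ.[ℂ] E) (lam : ℕ → ℂ) : Prop where
  lex_le : ∀ j k : ℕ, 1 ≤ j → j ≤ k → LexLE (lam j) (lam k)
  count : ∀ μ : ℂ, {k : ℕ | 1 ≤ k ∧ lam k = μ}.encard = algMultiplicity T μ

end Multiplicity

/-- The mean `τ_n = (λ_{2n} + λ_{2n-1}) / 2`. -/
def tau (lam : ℕ → ℂ) (n : ℕ) : ℂ := (lam (2 * n) + lam (2 * n - 1)) / 2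

end SemiPeriodic

end

noncomputable section

namespace SemiPeriodic

/-! ### Hilbert–Schmidt calculus for infinite matrices -/

section HilbertSchmidt

variable {ι I J K : Type*}

/-! On sequences supported at the odd integers the operator is the diagonal matrix a_k = (kπ)^{2m}
plus the matrix with entries v(k - j). Put s = mα, so that 0 ≤ s < m. For a center p the weights ω_k
= `wt m p k`, of size max(1, ||k| - p|) (|k| + p)^{2m-1}, lie below the spectral gaps at the p-th
level. The perturbation is measured by the Hilbert–Schmidt norm of β_{kj} = v(k - j) / √(ω_k ω_j).
By `exists_hs_bound`, ‖β‖² ≤ C p^{-(4m-2)} (p^{2s} (X_p + p^{-3/4} ‖v‖²) + ‖v‖²), with ‖v‖ the norm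
of h^{-s} and X_p = `localMass s v p` the mass of v near ±2p. Hence ‖β‖ ≤ 1/8 for p ≥ 2N, with N
depending only on m, α and R.

Smallness of β block triangularizes the matrix. If a finite index set P is separated from its
complement, a Riccati equation, solved by contraction (`exists_riccati`), yields an invariant
subspace that is a graph over P (`BlockData.intertwine`). Where the complementary block has no
spectrum, the eigenvalues, with algebraic multiplicity, are those of a finite matrix M
(`Represents.algMultiplicity_eq`). This is applied to P = {|k| < 2N} and to P = {p, -p} for odd p >
2N. The vertical lines through the levels of the even integers separate the blocks
(`exists_spectralBlocks`), so for n > N the numbers λ_{2n-1}, λ_{2n} are the eigenvalues of the 2×2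
matrix M at p = 2n - 1.

Their mean is half the trace of M. The large entries v(±2p) are off the diagonal and drop out, and
v(0) = 0 removes the first order, so the trace deviates from 2 (pπ)^{2m} by at most 4 ω_p ‖β‖².
Since ω_p ≤ p^{2m-1}, this is O(p^{2s-m} (X_p + p^{-θ})) with θ > 1/2 as soon as m - 1 + 2s > 1/2.
The numbers X_p are square summable (`summable_localMass_sq`), so the remainder lies in h^{m(1-2α)},
which is contained in the space of the theorem.

The exception is m = 1, s ≤ 1/4, where the term ‖v‖² in the bound of ‖β‖² is too large. There the
second order term is computed: it is ∑ v(l) v(-l) / (l (l - 2p) π²), and in the partial fractions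
the part with 1/l cancels because v(l) v(-l) is even (`norm_secondOrder_le`). The third order
remainder O(ω_p ‖β‖³) is small enough. -/

theorem cauchy_schwarz_family {f g : ι → ℝ} (hf0 : ∀ k, 0 ≤ f k) (hg0 : ∀ k, 0 ≤ g k)
    (hf : Summable fun k => f k ^ 2) (hg : Summable fun k => g k ^ 2) :
    (Summable fun k => f k * g k) ∧
      (∑' k, f k * g k) ^ 2 ≤ (∑' k, f k ^ 2) * ∑' k, g k ^ 2 := by
  have hs : Summable fun k => f k * g k := by
    refine Summable.of_nonneg_of_le (fun k => mul_nonneg (hf0 k) (hg0 k)) (fun k => ?_) (hf.add hg)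
    nlinarith [sq_nonneg (f k - g k), hf0 k, hg0 k, sq_nonneg (f k), sq_nonneg (g k)]
  refine ⟨hs, le_of_tendsto_of_tendsto' (Filter.Tendsto.pow hs.hasSum 2)
    (Filter.Tendsto.mul hf.hasSum hg.hasSum)
    (fun s => Finset.sum_mul_sq_le_sq_mul_sq s f g)⟩

/-- Square summable complex families. -/
abbrev L2 (ι : Type*) := lp (fun _ : ι => ℂ) 2

theorem memL2_iff {f : ι → ℂ} : Memℓp f 2 ↔ Summable fun i => ‖f i‖ ^ 2 := by
  rw [memℓp_gen_iff (by norm_num)]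
  simp

theorem L2.summable (x : L2 ι) : Summable fun i => ‖x i‖ ^ 2 := memL2_iff.mp x.2

theorem L2.norm_sq (x : L2 ι) : ‖x‖ ^ 2 = ∑' i, ‖x i‖ ^ 2 := by
  have h := lp.norm_rpow_eq_tsum (p := 2) (by norm_num) x
  simpa using h

theorem L2.norm_le_of_le {C : ℝ} (hC : 0 ≤ C) (x : L2 ι) (h : ∑' i, ‖x i‖ ^ 2 ≤ C ^ 2) :
    ‖x‖ ≤ C := by
  rw [← L2.norm_sq] at h
  exact le_of_sq_le_sq h hC

/-- Entrywise multiplication by a bounded family. -/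
def mulBdd (ψ : ι → ℂ) (hψ : ∀ i, ‖ψ i‖ ≤ 1) (x : L2 ι) : L2 ι :=
  ⟨fun i => ψ i * x i, memL2_iff.mpr (Summable.of_nonneg_of_le (fun _ => sq_nonneg _)
    (fun i => by
      rw [norm_mul, mul_pow]
      exact mul_le_of_le_one_left (sq_nonneg _) (pow_le_one₀ (norm_nonneg _) (hψ i)))
    (L2.summable x))⟩

@[simp]
theorem mulBdd_apply (ψ : ι → ℂ) (hψ : ∀ i, ‖ψ i‖ ≤ 1) (x : L2 ι) (i : ι) :
    mulBdd ψ hψ x i = ψ i * x i := rfl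

theorem norm_mulBdd_le (ψ : ι → ℂ) (hψ : ∀ i, ‖ψ i‖ ≤ 1) (x : L2 ι) :
    ‖mulBdd ψ hψ x‖ ≤ ‖x‖ := by
  refine L2.norm_le_of_le (norm_nonneg _) _ ?_
  rw [L2.norm_sq]
  refine (L2.summable (mulBdd ψ hψ x)).tsum_le_tsum (fun i => ?_) (L2.summable x)
  rw [mulBdd_apply, norm_mul, mul_pow]
  exact mul_le_of_le_one_left (sq_nonneg _) (pow_le_one₀ (norm_nonneg _) (hψ i))

theorem mulBdd_sub (ψ : ι → ℂ) (hψ : ∀ i, ‖ψ i‖ ≤ 1) (x y : L2 ι) :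
    mulBdd ψ hψ (x - y) = mulBdd ψ hψ x - mulBdd ψ hψ y := by
  ext i
  simp [mul_sub]

theorem L2.summable_mul_norm (x : L2 (I × J)) (y : L2 (J × K)) (i : I) (k : K) :
    Summable fun j => ‖x (i, j)‖ * ‖y (j, k)‖ :=
  (cauchy_schwarz_family (fun _ => norm_nonneg _) (fun _ => norm_nonneg _)
    ((L2.summable x).comp_injective (i := fun j => (i, j)) fun _ _ h => (Prod.ext_iff.mp h).2)
    ((L2.summable y).comp_injective (i := fun j => (j, k)) fun _ _ h => (Prod.ext_iff.mp h).1)).1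

theorem L2.summable_mul (x : L2 (I × J)) (y : L2 (J × K)) (i : I) (k : K) :
    Summable fun j => x (i, j) * y (j, k) :=
  Summable.of_norm (by simpa using L2.summable_mul_norm x y i k)

theorem L2.norm_tsum_mul_sq_le (x : L2 (I × J)) (y : L2 (J × K)) (i : I) (k : K) :
    ‖∑' j, x (i, j) * y (j, k)‖ ^ 2 ≤
      (∑' j, ‖x (i, j)‖ ^ 2) * ∑' j, ‖y (j, k)‖ ^ 2 := by
  have h := (cauchy_schwarz_family (f := fun j => ‖x (i, j)‖) (g := fun j => ‖y (j, k)‖)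
    (fun _ => norm_nonneg _) (fun _ => norm_nonneg _)
    ((L2.summable x).comp_injective (i := fun j => (i, j)) fun _ _ h => (Prod.ext_iff.mp h).2)
    ((L2.summable y).comp_injective (i := fun j => (j, k)) fun _ _ h => (Prod.ext_iff.mp h).1)).2
  refine le_trans (pow_le_pow_left₀ (norm_nonneg _) ?_ 2) h
  have := norm_tsum_le_tsum_norm (f := fun j => x (i, j) * y (j, k))
    (by simpa using L2.summable_mul_norm x y i k)
  simpa using this

theorem L2.summable_swap (y : L2 (J × K)) : Summable fun p : K × J => ‖y (p.2, p.1)‖ ^ 2 :=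
  (Equiv.prodComm K J).summable_iff.mpr (L2.summable y)

theorem L2.hasSum_bound (x : L2 (I × J)) (y : L2 (J × K)) :
    HasSum (fun p : I × K => (∑' j, ‖x (p.1, j)‖ ^ 2) * ∑' j, ‖y (j, p.2)‖ ^ 2)
      (‖x‖ ^ 2 * ‖y‖ ^ 2) := by
  have hx : HasSum (fun i => ∑' j, ‖x (i, j)‖ ^ 2) (‖x‖ ^ 2) := by
    rw [L2.norm_sq, (L2.summable x).tsum_prod]
    exact (L2.summable x).prod.hasSum
  have hy : HasSum (fun k => ∑' j, ‖y (j, k)‖ ^ 2) (‖y‖ ^ 2) := by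
    rw [L2.norm_sq, ← (Equiv.prodComm K J).tsum_eq (fun p => ‖y p‖ ^ 2)]
    have h := (L2.summable_swap y)
    have h2 := h.prod.hasSum
    rw [← h.tsum_prod] at h2
    exact h2
  exact hx.mul hy (hx.summable.mul_of_nonneg hy.summable
    (fun _ => tsum_nonneg fun _ => sq_nonneg _) (fun _ => tsum_nonneg fun _ => sq_nonneg _))

/-- The product of two Hilbert–Schmidt matrices. -/
def hsMul (x : L2 (I × J)) (y : L2 (J × K)) : L2 (I × K) :=
  ⟨fun p => ∑' j, x (p.1, j) * y (j, p.2), memL2_iff.mpr (Summable.of_nonneg_of_le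
    (fun _ => sq_nonneg _) (fun p => L2.norm_tsum_mul_sq_le x y p.1 p.2)
    (L2.hasSum_bound x y).summable)⟩

theorem hsMul_apply (x : L2 (I × J)) (y : L2 (J × K)) (i : I) (k : K) :
    hsMul x y (i, k) = ∑' j, x (i, j) * y (j, k) := rfl

theorem norm_hsMul_le (x : L2 (I × J)) (y : L2 (J × K)) : ‖hsMul x y‖ ≤ ‖x‖ * ‖y‖ := by
  refine L2.norm_le_of_le (by positivity) _ ?_
  rw [mul_pow, ← (L2.hasSum_bound x y).tsum_eq]
  exact (L2.summable (hsMul x y)).tsum_le_tsum (fun p => L2.norm_tsum_mul_sq_le x y p.1 p.2)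
    (L2.hasSum_bound x y).summable

theorem hsMul_sub_left (x x' : L2 (I × J)) (y : L2 (J × K)) :
    hsMul (x - x') y = hsMul x y - hsMul x' y := by
  ext ⟨i, k⟩
  simp only [hsMul_apply, lp.coeFn_sub, Pi.sub_apply, sub_mul]
  exact (L2.summable_mul x y i k).tsum_sub (L2.summable_mul x' y i k)

theorem hsMul_sub_right (x : L2 (I × J)) (y y' : L2 (J × K)) :
    hsMul x (y - y') = hsMul x y - hsMul x y' := by
  ext ⟨i, k⟩
  simp only [hsMul_apply, lp.coeFn_sub, Pi.sub_apply, mul_sub]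
  exact (L2.summable_mul x y i k).tsum_sub (L2.summable_mul x y' i k)

/-- Solvability of the quadratic (Riccati) equation
`X = -(β + β (ψX) - (φX) β - (φX) (β (ψX)))` for a Hilbert–Schmidt matrix `β` of small norm. -/
theorem exists_riccati (φ ψ : I × I → ℂ) (hφ : ∀ i, ‖φ i‖ ≤ 1) (hψ : ∀ i, ‖ψ i‖ ≤ 1)
    (β : L2 (I × I)) {q : ℝ} (hβ : ‖β‖ ≤ q) (hq : q ≤ 1 / 8) :
    ∃ X : L2 (I × I), ‖X‖ ≤ 2 * q ∧ ‖X + β‖ ≤ 5 * q ^ 2 ∧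
      X = -(β + (hsMul β (mulBdd ψ hψ X) - hsMul (mulBdd φ hφ X) β
        - hsMul (mulBdd φ hφ X) (hsMul β (mulBdd ψ hψ X)))) := by
  have hq0 : 0 ≤ q := (norm_nonneg _).trans hβ
  set G : L2 (I × I) → L2 (I × I) := fun X => hsMul β (mulBdd ψ hψ X) - hsMul (mulBdd φ hφ X) β
        - hsMul (mulBdd φ hφ X) (hsMul β (mulBdd ψ hψ X)) with hG
  have mul_le : ∀ (x y : L2 (I × I)) (a b : ℝ), ‖x‖ ≤ a → ‖y‖ ≤ b → ‖hsMul x y‖ ≤ a * b :=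
    fun x y a b hx hy => (norm_hsMul_le x y).trans
      (mul_le_mul hx hy (norm_nonneg _) ((norm_nonneg _).trans hx))
  have hGle : ∀ X, ‖X‖ ≤ 2 * q → ‖G X‖ ≤ 5 * q ^ 2 := by
    intro X hX
    have p1 := (norm_mulBdd_le φ hφ X).trans hX
    have p2 := (norm_mulBdd_le ψ hψ X).trans hX
    have h1 := mul_le _ _ _ _ hβ p2
    have h2 := mul_le _ _ _ _ p1 hβ
    have h3 := mul_le _ _ _ _ p1 h1
    have h4 : ‖G X‖ ≤ _ + _ + _ := (norm_sub_le _ _).trans (add_le_add_left (norm_sub_le _ _) _)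
    nlinarith [mul_le_mul_of_nonneg_right hq (sq_nonneg q)]
  -- The four terms of the difference give the Lipschitz constant 2q + 4q², at most 5/16 for q ≤
  -- 1/8.
  have hGlip : ∀ X Y, ‖X‖ ≤ 2 * q → ‖Y‖ ≤ 2 * q → ‖G X - G Y‖ ≤ 1 / 2 * ‖X - Y‖ := by
    intro X Y hX hY
    set d := ‖X - Y‖
    have d0 : 0 ≤ d := norm_nonneg _
    have e : G X - G Y = hsMul β (mulBdd ψ hψ (X - Y)) - hsMul (mulBdd φ hφ (X - Y)) β
        - (hsMul (mulBdd φ hφ (X - Y)) (hsMul β (mulBdd ψ hψ X))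
          + hsMul (mulBdd φ hφ Y) (hsMul β (mulBdd ψ hψ (X - Y)))) := by
      simp only [hG, mulBdd_sub, hsMul_sub_left, hsMul_sub_right]
      abel
    have p1 := (norm_mulBdd_le φ hφ Y).trans hY
    have p2 := (norm_mulBdd_le ψ hψ X).trans hX
    have p3 : ‖mulBdd φ hφ (X - Y)‖ ≤ d := norm_mulBdd_le φ hφ (X - Y)
    have p4 : ‖mulBdd ψ hψ (X - Y)‖ ≤ d := norm_mulBdd_le ψ hψ (X - Y)
    have h1 := mul_le _ _ _ _ hβ p4
    have h2 := mul_le _ _ _ _ p3 hβ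
    have h3 := mul_le _ _ _ _ p3 (mul_le _ _ _ _ hβ p2)
    have h4 := mul_le _ _ _ _ p1 h1
    have h5 := norm_sub_le (hsMul β (mulBdd ψ hψ (X - Y)) - hsMul (mulBdd φ hφ (X - Y)) β)
      (hsMul (mulBdd φ hφ (X - Y)) (hsMul β (mulBdd ψ hψ X))
          + hsMul (mulBdd φ hφ Y) (hsMul β (mulBdd ψ hψ (X - Y))))
    have h6 := norm_sub_le (hsMul β (mulBdd ψ hψ (X - Y))) (hsMul (mulBdd φ hφ (X - Y)) β)
    have h7 := norm_add_le (hsMul (mulBdd φ hφ (X - Y)) (hsMul β (mulBdd ψ hψ X)))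
      (hsMul (mulBdd φ hφ Y) (hsMul β (mulBdd ψ hψ (X - Y))))
    rw [e]
    have h8 : q * d ≤ 1 / 8 * d := mul_le_mul_of_nonneg_right hq d0
    have h9 : q * (q * d) ≤ 1 / 8 * (1 / 8 * d) :=
      mul_le_mul hq h8 (by positivity) (by norm_num)
    nlinarith
  set F : L2 (I × I) → L2 (I × I) := fun X => -(β + G X) with hF
  -- The ball is preserved because q + 5q² ≤ 2q for q ≤ 1/8.
  have hmaps : Set.MapsTo F (Metric.closedBall 0 (2 * q)) (Metric.closedBall 0 (2 * q)) := by
    intro X hX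
    rw [mem_closedBall_zero_iff] at hX ⊢
    rw [hF]
    simp only [norm_neg]
    have := norm_add_le β (G X)
    have := hGle X hX
    nlinarith
  have hcon : ContractingWith (1 / 2) (hmaps.restrict F _ _) := by
    refine ⟨by rw [← NNReal.coe_lt_coe]; norm_num, LipschitzWith.of_dist_le_mul ?_⟩
    rintro ⟨X, hX⟩ ⟨Y, hY⟩
    rw [mem_closedBall_zero_iff] at hX hY
    rw [Subtype.dist_eq, Subtype.dist_eq, dist_eq_norm, dist_eq_norm]
    simp only [Set.MapsTo.val_restrict_apply, hF]
    have e : -(β + G X) - -(β + G Y) = -(G X - G Y) := by abel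
    rw [e, norm_neg]
    simpa using hGlip X Y hX hY
  obtain ⟨X, hX, hfix, -⟩ := hcon.exists_fixedPoint' (x := 0)
    (Metric.isClosed_closedBall.isComplete) hmaps
    (by simpa using (by linarith : (0 : ℝ) ≤ 2 * q)) (edist_ne_top _ _)
  rw [mem_closedBall_zero_iff] at hX
  refine ⟨X, hX, ?_, hfix.symm⟩
  have : X + β = -G X := by
    conv_lhs => rw [← hfix.eq]
    simp [hF]
  rw [this, norm_neg]
  exact hGle X hX

end HilbertSchmidt

/-! ### Block triangularization of a diagonal matrix with a small perturbation -/

/-- A diagonal matrix with real entries `a`, a perturbation with entries `√(ω k) √(ω j) β (k, j)`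
where `β` is a small Hilbert–Schmidt matrix, and a finite set `P` of indices which is separated
from its complement with respect to the weights `ω`. -/
structure BlockData (I : Type*) where
  a : I → ℝ
  ω : I → ℝ
  P : Finset I
  β : L2 (I × I)
  ω_pos : ∀ k, 0 < ω k
  gap_left : ∀ k ∉ P, ∀ j ∈ P, ω k ≤ |a k - a j|
  gap_right : ∀ k ∉ P, ∀ j ∈ P, ω j ≤ |a k - a j|
  norm_β_le : ‖β‖ ≤ 1 / 8

namespace BlockData

variable {I : Type*} (D : BlockData I)

/-- The entries of the perturbation. -/
def b (k j : I) : ℂ := √(D.ω k) * √(D.ω j) * D.β (k, j)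

theorem sqrt_ne (k : I) : ((√(D.ω k) : ℝ) : ℂ) ≠ 0 := by
  exact_mod_cast (Real.sqrt_pos.mpr (D.ω_pos k)).ne'

theorem sqrt_mul_self (k : I) : ((√(D.ω k) : ℝ) : ℂ) * √(D.ω k) = (D.ω k : ℂ) := by
  exact_mod_cast Real.mul_self_sqrt (D.ω_pos k).le

theorem sub_ne {k j : I} (hk : k ∉ D.P) (hj : j ∈ D.P) : (D.a k : ℂ) - D.a j ≠ 0 := by
  have h := (D.ω_pos k).trans_le (D.gap_left k hk j hj)
  exact_mod_cast abs_pos.mp h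

/-- The weighted column vector `√ω y`. -/
def weighted (y : I → ℂ) (hy : Summable fun k => D.ω k * ‖y k‖ ^ 2) : L2 (I × Unit) :=
  ⟨fun p => √(D.ω p.1) * y p.1, memL2_iff.mpr (by
    have h := (Equiv.prodPUnit I).summable_iff.mpr hy
    refine h.congr fun p => ?_
    rw [norm_mul, mul_pow, Complex.norm_real, Real.norm_eq_abs, sq_abs,
      Real.sq_sqrt (D.ω_pos _).le]
    rfl)⟩

theorem weighted_apply (y : I → ℂ) (hy : Summable fun k => D.ω k * ‖y k‖ ^ 2) (k : I) (l : Unit) :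
    D.weighted y hy (k, l) = √(D.ω k) * y k := rfl

theorem summable_b_mul (y : I → ℂ) (hy : Summable fun k => D.ω k * ‖y k‖ ^ 2) (k : I) :
    Summable fun i => D.b k i * y i := by
  refine ((L2.summable_mul D.β (D.weighted y hy) k ()).mul_left (√(D.ω k) : ℂ)).congr fun i => ?_
  rw [weighted_apply]
  unfold b
  ring

theorem tsum_b_mul (y : I → ℂ) (hy : Summable fun k => D.ω k * ‖y k‖ ^ 2) (k : I) :
    ∑' i, D.b k i * y i = √(D.ω k) * hsMul D.β (D.weighted y hy) (k, ()) := by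
  rw [hsMul_apply, ← tsum_mul_left]
  refine tsum_congr fun i => ?_
  rw [weighted_apply]
  unfold b
  ring

variable [DecidableEq I]

/-- The multiplier `ω j / (a k - a j)` off the diagonal blocks. -/
def phi (p : I × I) : ℂ :=
  if p.1 ∉ D.P ∧ p.2 ∈ D.P then (D.ω p.2 : ℂ) / (D.a p.1 - D.a p.2) else 0

/-- The multiplier `ω k / (a k - a j)` off the diagonal blocks. -/
def psi (p : I × I) : ℂ :=
  if p.1 ∉ D.P ∧ p.2 ∈ D.P then (D.ω p.1 : ℂ) / (D.a p.1 - D.a p.2) else 0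

theorem norm_phi_le (p : I × I) : ‖D.phi p‖ ≤ 1 := by
  unfold phi
  split_ifs with h
  · rw [← Complex.ofReal_sub, ← Complex.ofReal_div, Complex.norm_real, Real.norm_eq_abs, abs_div,
      abs_of_pos (D.ω_pos _)]
    exact div_le_one_of_le₀ (D.gap_right _ h.1 _ h.2) (abs_nonneg _)
  · simp

theorem norm_psi_le (p : I × I) : ‖D.psi p‖ ≤ 1 := by
  unfold psi
  split_ifs with h
  · rw [← Complex.ofReal_sub, ← Complex.ofReal_div, Complex.norm_real, Real.norm_eq_abs, abs_div,
      abs_of_pos (D.ω_pos _)]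
    exact div_le_one_of_le₀ (D.gap_left _ h.1 _ h.2) (abs_nonneg _)
  · simp

theorem exists_X : ∃ X : L2 (I × I), ‖X‖ ≤ 2 * ‖D.β‖ ∧ ‖X + D.β‖ ≤ 5 * ‖D.β‖ ^ 2 ∧
      X = -(D.β + (hsMul D.β (mulBdd D.psi D.norm_psi_le X)
        - hsMul (mulBdd D.phi D.norm_phi_le X) D.β
        - hsMul (mulBdd D.phi D.norm_phi_le X) (hsMul D.β (mulBdd D.psi D.norm_psi_le X)))) :=
  exists_riccati D.phi D.psi D.norm_phi_le D.norm_psi_le D.β le_rfl D.norm_β_le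

/-- The solution of the Riccati equation. -/
def X : L2 (I × I) := D.exists_X.choose

theorem norm_X_le : ‖D.X‖ ≤ 2 * ‖D.β‖ := D.exists_X.choose_spec.1

theorem norm_X_add_le : ‖D.X + D.β‖ ≤ 5 * ‖D.β‖ ^ 2 := D.exists_X.choose_spec.2.1

/-- `φ X` -/
def phiX : L2 (I × I) := mulBdd D.phi D.norm_phi_le D.X

/-- `ψ X` -/
def psiX : L2 (I × I) := mulBdd D.psi D.norm_psi_le D.X

theorem norm_phiX_le : ‖D.phiX‖ ≤ 2 * ‖D.β‖ := (norm_mulBdd_le _ _ _).trans D.norm_X_le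

theorem norm_psiX_le : ‖D.psiX‖ ≤ 2 * ‖D.β‖ := (norm_mulBdd_le _ _ _).trans D.norm_X_le

/-- `β + β (ψ X)` -/
def γ : L2 (I × I) := D.β + hsMul D.β D.psiX

theorem γ_apply (k j : I) : D.γ (k, j) = D.β (k, j) + hsMul D.β D.psiX (k, j) := rfl

theorem norm_γ_le : ‖D.γ‖ ≤ ‖D.β‖ + ‖D.β‖ * (2 * ‖D.β‖) :=
  (norm_add_le _ _).trans (add_le_add_right ((norm_hsMul_le _ _).trans
    (mul_le_mul_of_nonneg_left D.norm_psiX_le (norm_nonneg _))) _)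

/-- The Riccati equation in the form in which invariance uses it: the quadratic expression factors
through `γ`, the rescaled product of the perturbation with the columns of `Z`. -/
theorem X_eq : D.X = hsMul D.phiX D.γ - D.γ := by
  have h := D.exists_X.choose_spec.2.2
  have e : D.γ = hsMul D.β D.psiX - -D.β := by unfold γ; abel
  have e2 : hsMul D.phiX (-D.β) = - hsMul D.phiX D.β := by
    rw [← zero_sub, hsMul_sub_right, ← zero_sub]
    congr 1
    ext ⟨i, k⟩
    simp [hsMul_apply]
  rw [e, hsMul_sub_right, e2]
  refine h.trans ?_
  change -(D.β + (hsMul D.β D.psiX - hsMul D.phiX D.β - hsMul D.phiX (hsMul D.β D.psiX))) = _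
  abel

/-- The columns `Z · j`, `j ∈ P`, span an invariant subspace of the perturbed matrix. -/
def Z (k j : I) : ℂ := √(D.ω j) / √(D.ω k) * ((if k = j then 1 else 0) + D.psiX (k, j))

/-- The matrix of the restriction to the invariant subspace. -/
def M (i j : I) : ℂ := (if i = j then (D.a i : ℂ) else 0) + √(D.ω i) * √(D.ω j) * D.γ (i, j)

theorem psiX_apply_of_mem {k : I} (hk : k ∈ D.P) (j : I) : D.psiX (k, j) = 0 := by
  simp [psiX, psi, hk]

theorem phiX_apply_of_notMem (k : I) {j : I} (hj : j ∉ D.P) : D.phiX (k, j) = 0 := by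
  simp [phiX, phi, hj]

theorem Z_of_mem {k : I} (hk : k ∈ D.P) (j : I) : D.Z k j = if k = j then 1 else 0 := by
  unfold Z
  rw [D.psiX_apply_of_mem hk]
  split_ifs with h
  · subst h
    simp [div_self (D.sqrt_ne k)]
  · simp

/-- Off P the two weights can be shared out in two ways, through `psiX` or through `phiX`. The first
makes products with the perturbation on the left Hilbert–Schmidt, the second makes products with
matrices on the right Hilbert–Schmidt; both rest on the gap conditions. -/
theorem Z_of_notMem {k j : I} (hk : k ∉ D.P) (hj : j ∈ D.P) :
    D.Z k j = √(D.ω k) * √(D.ω j) * D.X (k, j) / (D.a k - D.a j) := by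
  have hkj : k ≠ j := fun h => hk (h ▸ hj)
  have h1 := D.sqrt_ne k
  have h2 := D.sub_ne hk hj
  simp only [Z, hkj, if_false, zero_add, psiX, mulBdd_apply, psi, hk, hj, not_false_eq_true,
    and_self, if_true, ← D.sqrt_mul_self k]
  field_simp

theorem Z_eq_phiX {k j : I} (hk : k ∉ D.P) (hj : j ∈ D.P) :
    D.Z k j = √(D.ω k) / √(D.ω j) * D.phiX (k, j) := by
  have h1 := D.sqrt_ne j
  have h2 := D.sub_ne hk hj
  rw [D.Z_of_notMem hk hj]
  simp only [phiX, mulBdd_apply, phi, hk, hj, not_false_eq_true,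
    and_self, if_true, ← D.sqrt_mul_self j]
  field_simp

theorem summable_Z (j : I) : Summable fun k => D.ω k * ‖D.Z k j‖ ^ 2 := by
  have h1 : Summable fun k => ‖(if k = j then (1 : ℂ) else 0)‖ ^ 2 :=
    summable_of_ne_finset_zero (s := {j}) (fun k hk => by simp at hk; simp [hk])
  have h2 : Summable fun k => ‖D.psiX (k, j)‖ ^ 2 := (L2.summable D.psiX).comp_injective
    (i := fun k => (k, j)) fun _ _ h => (Prod.ext_iff.mp h).1
  refine Summable.of_nonneg_of_le (fun k => mul_nonneg (D.ω_pos k).le (sq_nonneg _)) (fun k => ?_)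
    (((h1.add h2).mul_left 2).mul_left (D.ω j))
  unfold Z
  have h3 : ‖((√(D.ω j) : ℝ) : ℂ) / √(D.ω k)‖ ^ 2 = D.ω j / D.ω k := by
    rw [← Complex.ofReal_div, Complex.norm_real, Real.norm_eq_abs, sq_abs, div_pow,
      Real.sq_sqrt (D.ω_pos j).le, Real.sq_sqrt (D.ω_pos k).le]
  rw [norm_mul, mul_pow, h3]
  have h4 := norm_add_le (if k = j then (1 : ℂ) else 0) (D.psiX (k, j))
  have h5 : ‖(if k = j then (1 : ℂ) else 0) + D.psiX (k, j)‖ ^ 2 ≤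
      2 * (‖(if k = j then (1 : ℂ) else 0)‖ ^ 2 + ‖D.psiX (k, j)‖ ^ 2) :=
    (pow_le_pow_left₀ (norm_nonneg _) h4 2).trans (add_sq_le)
  calc _ = D.ω j * ‖(if k = j then (1 : ℂ) else 0) + D.psiX (k, j)‖ ^ 2 := by
        have := (D.ω_pos k).ne'
        field_simp
    _ ≤ _ := mul_le_mul_of_nonneg_left h5 (D.ω_pos j).le

theorem tsum_b_Z (k j : I) :
    ∑' i, D.b k i * D.Z i j = √(D.ω k) * √(D.ω j) * D.γ (k, j) := by
  have e : ∀ i, D.b k i * D.Z i j = √(D.ω k) * √(D.ω j) *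
      ((if i = j then D.β (k, j) else 0) + D.β (k, i) * D.psiX (i, j)) := by
    intro i
    have := D.sqrt_ne i
    unfold b Z
    field_simp
    split_ifs with h
    · subst h; ring
    · ring
  simp only [e]
  rw [tsum_mul_left, Summable.tsum_add, tsum_ite_eq, γ_apply, hsMul_apply]
  · exact summable_of_ne_finset_zero (s := {j}) (fun k hk => by simp at hk; simp [hk])
  · exact L2.summable_mul _ _ _ _

theorem sum_eq_hsMul_phiX {K : Type*} (Y : L2 (I × K)) (k : I) (l : K) :
    ∑ j ∈ D.P, D.phiX (k, j) * Y (j, l) = hsMul D.phiX Y (k, l) := by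
  rw [hsMul_apply, tsum_eq_sum]
  intro j hj
  rw [D.phiX_apply_of_notMem k hj, zero_mul]

/-- In rows of P, where `Z` is the identity, this is the definition of `M`. In the other rows,
division by √(ω_k ω_j) leaves exactly the equation `X_eq`. -/
theorem intertwine (k : I) {j : I} (hj : j ∈ D.P) :
    D.a k * D.Z k j + ∑' i, D.b k i * D.Z i j = ∑ i ∈ D.P, D.Z k i * D.M i j := by
  rw [tsum_b_Z]
  by_cases hk : k ∈ D.P
  · simp only [D.Z_of_mem hk]
    simp [hk, M]
  · have e : ∀ i ∈ D.P, D.Z k i * D.M i j = (if i = j then D.a j * D.Z k j else 0) +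
        √(D.ω k) * √(D.ω j) * (D.phiX (k, i) * D.γ (i, j)) := by
      intro i hi
      have h0 := D.sqrt_ne i
      unfold M
      rw [mul_add, D.Z_eq_phiX hk hi]
      congr 1
      · split_ifs with h
        · subst h
          rw [D.Z_eq_phiX hk hj]
          ring
        · simp
      · field_simp
    rw [Finset.sum_congr rfl e, Finset.sum_add_distrib, ← Finset.mul_sum, sum_eq_hsMul_phiX,
      Finset.sum_ite_eq' D.P j, if_pos hj]
    have hX : D.X (k, j) = hsMul D.phiX D.γ (k, j) - D.γ (k, j) := by
      conv_lhs => rw [X_eq]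
      rfl
    have h1 : (D.a k - D.a j) * D.Z k j = √(D.ω k) * √(D.ω j) * D.X (k, j) := by
      rw [D.Z_of_notMem hk hj]
      field_simp [D.sub_ne hk hj]
    rw [hX] at h1
    linear_combination h1

theorem eq_zero_of_norm_le {E : Type*} [NormedAddCommGroup E] {x : E} {c : ℝ} (hc : c < 1)
    (h : ‖x‖ ≤ c * ‖x‖) : x = 0 := by
  by_contra hx
  have := norm_pos_iff.mpr hx
  nlinarith

/-- The complementary block has no spectrum at `μ`. -/
theorem eq_zero_of_complement {μ : ℂ} (hμ : ∀ k ∉ D.P, D.ω k ≤ ‖(D.a k : ℂ) - μ‖) {y : I → ℂ}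
    (hy : Summable fun k => D.ω k * ‖y k‖ ^ 2) (hyP : ∀ k ∈ D.P, y k = 0)
    (h : ∀ k ∉ D.P, (D.a k - μ) * y k + ∑' i, D.b k i * y i =
      ∑ j ∈ D.P, D.Z k j * ∑' i, D.b j i * y i) : y = 0 := by
  set Y := D.weighted y hy with hY
  let χ : I × Unit → ℂ := fun p => if p.1 ∈ D.P then 0 else (D.ω p.1 : ℂ) / (D.a p.1 - μ)
  have hχ : ∀ p, ‖χ p‖ ≤ 1 := by
    intro p
    simp only [χ]
    split_ifs with hp
    · simp
    · rw [norm_div, Complex.norm_real, Real.norm_eq_abs, abs_of_pos (D.ω_pos _)]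
      exact div_le_one_of_le₀ (hμ _ hp) (norm_nonneg _)
  -- Solving each row for y_k and rescaling by √ω turns the equation into a fixed point of a
  -- contraction; χ = ω / (a - μ) is bounded by 1 by the gap hypothesis.
  have key : Y = mulBdd χ hχ (hsMul D.phiX (hsMul D.β Y) - hsMul D.β Y) := by
    ext ⟨k, l⟩
    rw [mulBdd_apply]
    simp only [χ, lp.coeFn_sub, Pi.sub_apply]
    split_ifs with hk
    · rw [hY, weighted_apply, hyP k hk]; simp
    · have h1 := h k hk
      have h2 : (D.a k : ℂ) - μ ≠ 0 := norm_pos_iff.mp ((D.ω_pos k).trans_le (hμ k hk))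
      have h3 : ∀ j ∈ D.P, D.Z k j * ∑' i, D.b j i * y i =
          √(D.ω k) * (D.phiX (k, j) * hsMul D.β Y (j, ())) := by
        intro j hj
        have := D.sqrt_ne j
        rw [D.Z_eq_phiX hk hj, D.tsum_b_mul y hy, ← hY]
        field_simp
      rw [Finset.sum_congr rfl h3, ← Finset.mul_sum, sum_eq_hsMul_phiX, D.tsum_b_mul y hy,
        ← hY] at h1
      rw [hY, weighted_apply, ← hY, ← D.sqrt_mul_self k]
      have h4 : y k = √(D.ω k) * (hsMul D.phiX (hsMul D.β Y) (k, ())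
          - hsMul D.β Y (k, ())) / (D.a k - μ) := by
        rw [eq_div_iff h2]
        linear_combination h1
      rw [h4]
      field_simp
  -- The factor is in fact at most 1/8 + (1/4)(1/8) = 5/32.
  have hn : ‖Y‖ ≤ (1 / 2) * ‖Y‖ := by
    have e1 := norm_hsMul_le D.β Y
    have e2 := norm_hsMul_le D.phiX (hsMul D.β Y)
    have e3 := norm_sub_le (hsMul D.phiX (hsMul D.β Y)) (hsMul D.β Y)
    have e4 := norm_mulBdd_le χ hχ (hsMul D.phiX (hsMul D.β Y) - hsMul D.β Y)
    rw [← key] at e4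
    have e5 := D.norm_phiX_le
    have e6 := D.norm_β_le
    have n0 := norm_nonneg Y
    have e7 : ‖hsMul D.β Y‖ ≤ 1 / 8 * ‖Y‖ := e1.trans (mul_le_mul_of_nonneg_right e6 n0)
    have e8 : ‖D.phiX‖ * ‖hsMul D.β Y‖ ≤ 1 / 4 * (1 / 8 * ‖Y‖) :=
      mul_le_mul (by linarith) e7 (norm_nonneg _) (by norm_num)
    linarith
  have hY0 := eq_zero_of_norm_le (by norm_num) hn
  funext k
  have hk : D.weighted y hy (k, ()) = 0 := by rw [← hY, hY0]; rfl
  rw [weighted_apply] at hk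
  exact (mul_eq_zero.mp hk).resolve_left (D.sqrt_ne k)

/-- Eigenvalues of the block `M` are close to the diagonal entries. -/
theorem eq_zero_of_block {μ : ℂ} (hμ : ∀ k ∈ D.P, D.ω k ≤ ‖(D.a k : ℂ) - μ‖) {x : I → ℂ}
    (h : ∀ i ∈ D.P, ∑ j ∈ D.P, D.M i j * x j = μ * x i) : ∀ k ∈ D.P, x k = 0 := by
  set y : I → ℂ := fun k => if k ∈ D.P then x k else 0 with hy_def
  have hy : Summable fun k => D.ω k * ‖y k‖ ^ 2 :=
    summable_of_ne_finset_zero (s := D.P) (fun k hk => by simp [hy_def, hk])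
  set Y := D.weighted y hy with hY
  let χ : I × Unit → ℂ := fun p => if p.1 ∈ D.P then (D.ω p.1 : ℂ) / (μ - D.a p.1) else 0
  have hχ : ∀ p, ‖χ p‖ ≤ 1 := by
    intro p
    simp only [χ]
    split_ifs with hp
    · rw [norm_div, Complex.norm_real, Real.norm_eq_abs, abs_of_pos (D.ω_pos _), norm_sub_rev]
      exact div_le_one_of_le₀ (hμ _ hp) (norm_nonneg _)
    · simp
  -- The same contraction argument inside P, where `γ` with norm at most 1/8 + 1/32 is the whole
  -- rescaled perturbation of the diagonal.
  have key : Y = mulBdd χ hχ (hsMul D.γ Y) := by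
    ext ⟨k, l⟩
    rw [mulBdd_apply]
    simp only [χ]
    split_ifs with hk
    · have h1 := h k hk
      have h2 : μ - (D.a k : ℂ) ≠ 0 := by
        rw [← norm_pos_iff, norm_sub_rev]
        exact (D.ω_pos k).trans_le (hμ k hk)
      have h3 : ∀ j ∈ D.P, D.M k j * x j = (if k = j then D.a k * x k else 0) +
          √(D.ω k) * (D.γ (k, j) * Y (j, l)) := by
        intro j hj
        rw [hY, weighted_apply]
        simp only [hy_def, hj, if_true, M]
        split_ifs with hkj
        · subst hkj; ring
        · ring
      have h5 : ∑ j ∈ D.P, D.γ (k, j) * Y (j, l) = hsMul D.γ Y (k, l) := by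
        rw [hsMul_apply, tsum_eq_sum]
        intro j hj
        rw [hY, weighted_apply]
        simp [hy_def, hj]
      rw [Finset.sum_congr rfl h3, Finset.sum_add_distrib, ← Finset.mul_sum,
        Finset.sum_ite_eq, if_pos hk, h5] at h1
      rw [hY, weighted_apply, ← hY, ← D.sqrt_mul_self k]
      have h4 : y k = √(D.ω k) * hsMul D.γ Y (k, l) / (μ - D.a k) := by
        rw [eq_div_iff h2]
        simp only [hy_def, hk, if_true]
        linear_combination -h1
      rw [h4]
      field_simp
    · rw [hY, weighted_apply]
      simp [hy_def, hk]
  have hn : ‖Y‖ ≤ (1 / 2) * ‖Y‖ := by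
    have e1 := norm_hsMul_le D.γ Y
    have e4 := norm_mulBdd_le χ hχ (hsMul D.γ Y)
    rw [← key] at e4
    have e5 := D.norm_γ_le
    have e6 := D.norm_β_le
    have n0 := norm_nonneg Y
    have n1 := norm_nonneg D.β
    have e7 : ‖D.γ‖ ≤ 1 / 2 := by nlinarith
    exact e4.trans (e1.trans (mul_le_mul_of_nonneg_right e7 n0))
  have hY0 := eq_zero_of_norm_le (by norm_num) hn
  intro k hkP
  have hk : D.weighted y hy (k, ()) = 0 := by rw [← hY, hY0]; rfl
  rw [weighted_apply] at hk
  simpa [hy_def, hkP] using (mul_eq_zero.mp hk).resolve_left (D.sqrt_ne k)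

theorem M_diag (i : I) : D.M i i = D.a i + D.b i i + D.ω i * hsMul D.β D.psiX (i, i) := by
  unfold M b
  rw [γ_apply, if_pos rfl, D.sqrt_mul_self]
  ring

/-- The correction to the diagonal entry is ω_i (β (ψX))_{ii}, and ψX is itself of order ‖β‖. -/
theorem norm_M_diag_sub_le (i : I) :
    ‖D.M i i - (D.a i + D.b i i)‖ ≤ 2 * D.ω i * ‖D.β‖ ^ 2 := by
  rw [M_diag, add_sub_cancel_left, norm_mul, Complex.norm_real, Real.norm_eq_abs,
    abs_of_pos (D.ω_pos i)]
  have h1 := (lp.norm_apply_le_norm (by norm_num) (hsMul D.β D.psiX) (i, i)).trans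
    (norm_hsMul_le _ _)
  have h2 := mul_le_mul_of_nonneg_left D.norm_psiX_le (norm_nonneg D.β)
  have := mul_le_mul_of_nonneg_left (h1.trans h2) (D.ω_pos i).le
  linarith

/-- To leading order X = -β, which produces the classical second order perturbation sum. The error X
+ β is at most 5‖β‖² by the Riccati equation and contributes the third order. -/
theorem norm_M_diag_add_le {i : I} (hi : i ∈ D.P) :
    ‖D.M i i - (D.a i + D.b i i) +
      ∑' p, (if p ∈ D.P then 0 else D.b i p * D.b p i / (D.a p - D.a i))‖ ≤
      5 * D.ω i * ‖D.β‖ ^ 3 := by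
  have e : ∑' p, (if p ∈ D.P then 0 else D.b i p * D.b p i / (D.a p - D.a i)) =
      D.ω i * hsMul D.β (mulBdd D.psi D.norm_psi_le D.β) (i, i) := by
    rw [hsMul_apply, ← tsum_mul_left]
    refine tsum_congr fun p => ?_
    simp only [mulBdd_apply, psi, hi, and_true]
    by_cases hp : p ∈ D.P
    · simp [hp]
    · simp only [hp, if_false, not_false_eq_true, if_true, b, ← D.sqrt_mul_self]
      ring
  have e2 : D.M i i - (D.a i + D.b i i) + D.ω i * hsMul D.β (mulBdd D.psi D.norm_psi_le D.β) (i, i)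
      = D.ω i * hsMul D.β (mulBdd D.psi D.norm_psi_le (D.X + D.β)) (i, i) := by
    have e3 : mulBdd D.psi D.norm_psi_le (D.X + D.β) =
        D.psiX - mulBdd D.psi D.norm_psi_le (-D.β) := by
      rw [psiX, ← mulBdd_sub, sub_neg_eq_add]
    have e4 : hsMul D.β (mulBdd D.psi D.norm_psi_le (-D.β)) (i, i) =
        -hsMul D.β (mulBdd D.psi D.norm_psi_le D.β) (i, i) := by
      simp [hsMul_apply, tsum_neg]
    rw [e3, hsMul_sub_right, lp.coeFn_sub, Pi.sub_apply, e4, M_diag]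
    ring
  rw [e, e2, norm_mul, Complex.norm_real, Real.norm_eq_abs, abs_of_pos (D.ω_pos i)]
  have h1 := (lp.norm_apply_le_norm (by norm_num)
    (hsMul D.β (mulBdd D.psi D.norm_psi_le (D.X + D.β))) (i, i)).trans (norm_hsMul_le _ _)
  have h2 := mul_le_mul_of_nonneg_left ((norm_mulBdd_le D.psi D.norm_psi_le (D.X + D.β)).trans
    D.norm_X_add_le) (norm_nonneg D.β)
  have := mul_le_mul_of_nonneg_left (h1.trans h2) (D.ω_pos i).le
  linarith

end BlockData

/-! ### Algebraic multiplicities on a finite-dimensional invariant subspace -/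

section RootVectors

variable {E V : Type*} [AddCommGroup E] [Module ℂ E] [AddCommGroup V] [Module ℂ V]

/-- The hypothesis `hinj` says that T - μ is injective modulo the range of Φ. By induction every
root vector lies in that range, where T acts as M. -/
theorem rootKer_eq_map (T : E →ₗ.[ℂ] E) (μ : ℂ) (Φ : V →ₗ[ℂ] E) (hΦ : Function.Injective Φ)
    (M : Module.End ℂ V) (hdom : ∀ x, Φ x ∈ T.domain) (hT : ∀ x, T ⟨Φ x, hdom x⟩ = Φ (M x))
    (hinj : ∀ u : T.domain, T u - μ • (u : E) ∈ LinearMap.range Φ → (u : E) ∈ LinearMap.range Φ)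
    (p : ℕ) : rootKer T μ p = (M.genEigenspace μ p).map Φ := by
  have hΦM : ∀ x, T ⟨Φ x, hdom x⟩ - μ • Φ x = Φ ((M - μ • 1) x) := by
    intro x
    rw [hT]
    simp
  induction p with
  | zero => simp [rootKer]
  | succ p ih =>
    have key : ∀ x, x ∈ M.genEigenspace μ (p + 1 : ℕ) ↔
        (M - μ • 1) x ∈ M.genEigenspace μ p := by
      intro x
      rw [Module.End.mem_genEigenspace_nat, Module.End.mem_genEigenspace_nat, LinearMap.mem_ker,
        LinearMap.mem_ker, pow_succ, Module.End.mul_apply]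
    ext u
    rw [rootKer, ih]
    constructor
    · rintro ⟨⟨u, hu⟩, hmem, rfl⟩
      obtain ⟨y, hy, hyu⟩ := hmem
      have h1 : T ⟨u, hu⟩ - μ • u = Φ y := hyu.symm
      obtain ⟨x, rfl⟩ := hinj ⟨u, hu⟩ ⟨y, h1.symm⟩
      refine ⟨x, (key x).mpr ?_, rfl⟩
      have h2 := hΦ ((hΦM x).symm.trans h1)
      rw [h2]
      exact hy
    · rintro ⟨x, hx, rfl⟩
      exact ⟨⟨Φ x, hdom x⟩, ⟨_, (key x).mp hx, (hΦM x).symm⟩, rfl⟩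

/-- The root space is the image of the maximal generalized eigenspace of M, whose dimension is the
multiplicity of μ in the characteristic polynomial. -/
theorem algMultiplicity_eq_rootMultiplicity [FiniteDimensional ℂ V] (T : E →ₗ.[ℂ] E) (μ : ℂ)
    (Φ : V →ₗ[ℂ] E) (hΦ : Function.Injective Φ)
    (M : Module.End ℂ V) (hdom : ∀ x, Φ x ∈ T.domain) (hT : ∀ x, T ⟨Φ x, hdom x⟩ = Φ (M x))
    (hinj : ∀ u : T.domain, T u - μ • (u : E) ∈ LinearMap.range Φ →
      (u : E) ∈ LinearMap.range Φ) :
    algMultiplicity T μ = (M.charpoly.roots.count μ : ℕ∞) := by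
  have h : ⨆ p : ℕ, rootKer T μ p = (M.maxGenEigenspace μ).map Φ := by
    simp only [rootKer_eq_map T μ Φ hΦ M hdom hT hinj, ← Submodule.map_iSup]
    rw [Module.End.iSup_genEigenspace_eq]
  unfold algMultiplicity
  rw [h, ← Module.finrank_eq_rank,
    ← (Submodule.equivMapOfInjective Φ hΦ (M.maxGenEigenspace μ)).finrank_eq,
    LinearMap.finrank_maxGenEigenspace_eq, Polynomial.count_roots]
  simp

end RootVectors

/-! ### Weights and spectral gaps -/

/-- The distance from `|k|` to `p`, truncated below by `1`. -/
def sdist (p : ℕ) (k : ℤ) : ℝ := max 1 |(|(k : ℝ)| - p)|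

/-- A lower bound for the spectral gaps between the `k`-th and the `p`-th level. -/
def wt (m p : ℕ) (k : ℤ) : ℝ := ((4 : ℝ) ^ (2 * m))⁻¹ * (sdist p k * (|(k : ℝ)| + p) ^ (2 * m - 1))

/-- The unperturbed level `(y π)^{2m}`. -/
def level (m : ℕ) (y : ℝ) : ℝ := y ^ (2 * m) * Real.pi ^ (2 * m)

theorem one_le_sdist (p : ℕ) (k : ℤ) : 1 ≤ sdist p k := le_max_left _ _

theorem sdist_pos (p : ℕ) (k : ℤ) : 0 < sdist p k := one_pos.trans_le (one_le_sdist p k)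

theorem wt_pos (m : ℕ) {p : ℕ} (hp : 1 ≤ p) (k : ℤ) : 0 < wt m p k := by
  have h1 := sdist_pos p k
  have h2 : (1 : ℝ) ≤ p := by exact_mod_cast hp
  have h3 : 0 < |(k : ℝ)| + p := by positivity
  unfold wt
  positivity

theorem sub_mul_pow_le {t y : ℝ} (hy : 0 ≤ y) (h : y ≤ t) {n : ℕ} (hn : 1 ≤ n) :
    (t - y) * t ^ (n - 1) ≤ t ^ n - y ^ n := by
  obtain ⟨n, rfl⟩ := Nat.exists_eq_add_of_le' hn
  have := mul_le_mul_of_nonneg_left (pow_le_pow_left₀ hy h n) hy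
  simp only [Nat.add_sub_cancel, pow_succ']
  linarith

theorem abs_sub_mul_pow_le {t y : ℝ} (ht : 0 ≤ t) (hy : 0 ≤ y) {n : ℕ} (hn : 1 ≤ n) :
    |t - y| * (max t y) ^ (n - 1) ≤ |t ^ n - y ^ n| := by
  rcases le_total y t with h | h
  · rw [max_eq_left h, abs_of_nonneg (sub_nonneg.mpr h),
      abs_of_nonneg (sub_nonneg.mpr (pow_le_pow_left₀ hy h n))]
    exact sub_mul_pow_le hy h hn
  · rw [max_eq_right h, abs_sub_comm, abs_sub_comm (t ^ n), abs_of_nonneg (sub_nonneg.mpr h),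
      abs_of_nonneg (sub_nonneg.mpr (pow_le_pow_left₀ ht h n))]
    exact sub_mul_pow_le ht h hn

theorem level_abs (m : ℕ) (y : ℝ) : level m |y| = level m y := by
  unfold level
  rw [pow_mul, sq_abs, ← pow_mul]

/-- Rests on |t^{2m} - y^{2m}| ≥ |t - y| max(t, y)^{2m-1}. The point y is not tied to p, so that the
gaps to the dividing lines at p ± 1 are covered as well; the normalization 4^{-2m} of `wt` pays for
the factors 2 and 4^{2m-1}. -/
theorem wt_le_level {m : ℕ} (hm : 1 ≤ m) {p : ℕ} {k : ℤ} {y : ℝ} (hy : 0 ≤ y)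
    (h1 : sdist p k ≤ 2 * |(|(k : ℝ)| - y)|) (h2 : |(k : ℝ)| + p ≤ 4 * max |(k : ℝ)| y) :
    wt m p k ≤ |level m k - level m y| := by
  have h3 := abs_sub_mul_pow_le (abs_nonneg (k : ℝ)) hy (n := 2 * m) (by omega)
  rw [← level_abs m k]
  unfold level wt
  rw [← sub_mul, abs_mul, abs_of_pos (a := Real.pi ^ (2 * m)) (by positivity)]
  have hpi : (1 : ℝ) ≤ Real.pi ^ (2 * m) := one_le_pow₀ (by linarith [Real.pi_gt_three])
  have h4 : (|(k : ℝ)| + p) ^ (2 * m - 1) ≤ 4 ^ (2 * m - 1) * (max |(k : ℝ)| y) ^ (2 * m - 1) := by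
    rw [← mul_pow]
    exact pow_le_pow_left₀ (by positivity) h2 _
  have h5 : (4 : ℝ) ^ (2 * m) = 4 * 4 ^ (2 * m - 1) := by
    rw [← pow_succ']; congr 1; omega
  have h6 : (0 : ℝ) < 4 ^ (2 * m - 1) := by positivity
  have h7 : 0 ≤ max |(k : ℝ)| y ^ (2 * m - 1) := pow_nonneg (le_max_of_le_right hy) _
  calc _ ≤ ((4 : ℝ) ^ (2 * m))⁻¹ *
        (2 * |(|(k : ℝ)| - y)| * (4 ^ (2 * m - 1) * (max |(k : ℝ)| y) ^ (2 * m - 1))) := by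
        gcongr
    _ = 1 / 2 * (|(|(k : ℝ)| - y)| * (max |(k : ℝ)| y) ^ (2 * m - 1)) := by
        rw [h5]; field_simp; ring
    _ ≤ 1 * (|(|(k : ℝ)| - y)| * (max |(k : ℝ)| y) ^ (2 * m - 1)) := by
        gcongr; norm_num
    _ ≤ |(|(k : ℝ)| ^ (2 * m) - y ^ (2 * m))| * 1 := by rw [one_mul, mul_one]; exact h3
    _ ≤ _ := by gcongr

/-! ### Hilbert–Schmidt bounds -/

/-- The larger factor y is split as y^{3/4} y^{1/4}: the first part gives the decay in L, and the
second, being at least x^δ, makes the power of x summable over the integers. -/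
theorem inv_mul_inv_le {x y L δ : ℝ} (hx : 1 ≤ x) (hxy : x ≤ y) (hL : 0 < L) (hLy : L ≤ 4 * y)
    (hδ : δ ≤ 1 / 4) : (x * y)⁻¹ ≤ 4 * L ^ (-(3 / 4) : ℝ) * x ^ (-(1 + δ)) := by
  have hx0 : 0 < x := by linarith
  have hy0 : 0 < y := by linarith
  have e1 : y⁻¹ = y ^ (-(3 / 4) : ℝ) * y ^ (-(1 / 4) : ℝ) := by
    rw [← Real.rpow_add hy0, ← Real.rpow_neg_one]; norm_num
  have e2 : y ^ (-(3 / 4) : ℝ) ≤ 4 * L ^ (-(3 / 4) : ℝ) := by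
    have : y ^ (-(3 / 4) : ℝ) ≤ (L / 4) ^ (-(3 / 4) : ℝ) :=
      Real.rpow_le_rpow_of_nonpos (by positivity) (by linarith) (by norm_num)
    refine this.trans ?_
    rw [Real.div_rpow hL.le (by norm_num), div_eq_mul_inv, ← Real.rpow_neg (by norm_num), mul_comm]
    refine mul_le_mul_of_nonneg_right ?_ (Real.rpow_nonneg hL.le _)
    calc (4 : ℝ) ^ (-(-(3 / 4)) : ℝ) ≤ 4 ^ (1 : ℝ) :=
          Real.rpow_le_rpow_of_exponent_le (by norm_num) (by norm_num)
      _ = 4 := Real.rpow_one _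
  have e3 : y ^ (-(1 / 4) : ℝ) ≤ x ^ (-δ) :=
    (Real.rpow_le_rpow_of_nonpos hx0 hxy (by norm_num)).trans
      (Real.rpow_le_rpow_of_exponent_le hx (by linarith))
  have e4 : x ^ (-(1 + δ)) = x⁻¹ * x ^ (-δ) := by
    rw [← Real.rpow_neg_one, ← Real.rpow_add hx0]; ring_nf
  have := Real.rpow_nonneg hx0.le (-δ)
  have := Real.rpow_nonneg hy0.le (-(1 / 4))
  have := Real.rpow_nonneg hL.le (-(3 / 4))
  rw [mul_inv, e1, e4]
  calc x⁻¹ * (y ^ (-(3 / 4) : ℝ) * y ^ (-(1 / 4) : ℝ))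
      ≤ x⁻¹ * (4 * L ^ (-(3 / 4) : ℝ) * x ^ (-δ)) := by gcongr
    _ = _ := by ring

theorem inv_mul_inv_le' {x y L δ : ℝ} (hx : 1 ≤ x) (hy : 1 ≤ y) (hL : 0 < L)
    (hLy : L ≤ 2 * (x + y)) (hδ : δ ≤ 1 / 4) :
    (x * y)⁻¹ ≤ 4 * L ^ (-(3 / 4) : ℝ) * (x ^ (-(1 + δ)) + y ^ (-(1 + δ))) := by
  have h1 := Real.rpow_nonneg hL.le (-(3 / 4))
  have h2 := Real.rpow_nonneg (zero_le_one.trans hx) (-(1 + δ))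
  have h3 := Real.rpow_nonneg (zero_le_one.trans hy) (-(1 + δ))
  rcases le_total x y with h | h
  · refine (inv_mul_inv_le hx h hL (by linarith) hδ).trans ?_
    nlinarith [mul_nonneg h1 h3]
  · rw [mul_comm]
    refine (inv_mul_inv_le hy h hL (by linarith) hδ).trans ?_
    nlinarith [mul_nonneg h1 h2]

theorem rpow_mul_inv_le {x y δ : ℝ} (hx : 1 ≤ x) (hy : 1 ≤ y) (hδ : 0 ≤ δ) :
    x ^ (-δ) * y⁻¹ ≤ x ^ (-(1 + δ)) + y ^ (-(1 + δ)) := by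
  have hx0 : 0 < x := by linarith
  have hy0 : 0 < y := by linarith
  have h2 := Real.rpow_nonneg hx0.le (-(1 + δ))
  have h3 := Real.rpow_nonneg hy0.le (-(1 + δ))
  have e4 : ∀ {z : ℝ}, 0 < z → z ^ (-(1 + δ)) = z ^ (-δ) * z⁻¹ := fun {z} hz => by
    rw [← Real.rpow_neg_one, ← Real.rpow_add hz]; ring_nf
  rcases le_total x y with h | h
  · have : x ^ (-δ) * y⁻¹ ≤ x ^ (-δ) * x⁻¹ :=
      mul_le_mul_of_nonneg_left (inv_anti₀ hx0 h) (Real.rpow_nonneg hx0.le _)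
    rw [← e4 hx0] at this
    linarith
  · have : x ^ (-δ) * y⁻¹ ≤ y ^ (-δ) * y⁻¹ :=
      mul_le_mul_of_nonneg_right (Real.rpow_le_rpow_of_nonpos hy0 h (by linarith)) (by positivity)
    rw [← e4 hy0] at this
    linarith

/-- The profile `p^{2s} (⟨|l| - 2p⟩^{-3/4} + p^{-3/4}) + 1`. -/
def profile (s : ℝ) (p : ℕ) (l : ℤ) : ℝ :=
  (p : ℝ) ^ (2 * s) * (bracket (|l| - 2 * p) ^ (-(3 / 4) : ℝ) + (p : ℝ) ^ (-(3 / 4) : ℝ)) + 1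

theorem bracket_abs_sub (p : ℕ) (l : ℤ) :
    bracket (|l| - 2 * p) = 1 + |(|(l : ℝ)| - 2 * p)| := by
  unfold bracket
  push_cast
  rfl

/-- Here the weight ⟨l⟩ is at most 5p. For L = ⟨l⟩ the exponent 2s - 3/4 may be negative, in which
case only the bound 1 remains; this is the origin of the summand 1 in `profile`. If the exponent is
nonnegative, the summand p^{2s-3/4} takes over. -/
theorem profile_near {s : ℝ} (hs : 0 ≤ s) {p : ℕ} (hp : 1 ≤ p) {l : ℤ} {L : ℝ}
    (hl : |(l : ℝ)| ≤ 4 * p) (hL : L = bracket l ∨ L = bracket (|l| - 2 * p)) :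
    bracket l ^ (2 * s) * L ^ (-(3 / 4) : ℝ) ≤ 5 ^ (2 * s) * profile s p l := by
  have hp' : (1 : ℝ) ≤ p := by exact_mod_cast hp
  have hp0 : (0 : ℝ) < p := by linarith
  have hb : bracket l ≤ 5 * p := by unfold bracket; linarith
  have h5 : (1 : ℝ) ≤ 5 ^ (2 * s) := Real.one_le_rpow (by norm_num) (by linarith)
  have p1 : (0 : ℝ) ≤ (p : ℝ) ^ (2 * s) := by positivity
  have p2 : (0 : ℝ) ≤ (p : ℝ) ^ (-(3 / 4) : ℝ) := by positivity
  have p3 : (0 : ℝ) ≤ bracket (|l| - 2 * p) ^ (-(3 / 4) : ℝ) :=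
    Real.rpow_nonneg (bracket_pos _).le _
  unfold profile
  rcases hL with rfl | rfl
  · rw [← Real.rpow_add (bracket_pos l)]
    rcases le_total (2 * s) (3 / 4) with h | h
    · have e : bracket l ^ (2 * s + -(3 / 4)) ≤ 1 :=
        Real.rpow_le_one_of_one_le_of_nonpos (one_le_bracket l) (by linarith)
      nlinarith [mul_nonneg p1 (add_nonneg p3 p2)]
    · have e : bracket l ^ (2 * s + -(3 / 4)) ≤ (5 * p : ℝ) ^ (2 * s + -(3 / 4)) :=
        Real.rpow_le_rpow (bracket_pos l).le hb (by linarith)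
      have e2 : (5 * p : ℝ) ^ (2 * s + -(3 / 4)) =
          5 ^ (2 * s + -(3 / 4)) * ((p : ℝ) ^ (2 * s) * (p : ℝ) ^ (-(3 / 4) : ℝ)) := by
        rw [Real.mul_rpow (by norm_num) hp0.le, Real.rpow_add hp0]
      have e3 : (5 : ℝ) ^ (2 * s + -(3 / 4)) ≤ 5 ^ (2 * s) :=
        Real.rpow_le_rpow_of_exponent_le (by norm_num) (by linarith)
      rw [e2] at e
      have e4 := mul_le_mul_of_nonneg_right e3 (mul_nonneg p1 p2)
      nlinarith [mul_nonneg p1 p3]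
  · have e : bracket l ^ (2 * s) ≤ 5 ^ (2 * s) * (p : ℝ) ^ (2 * s) := by
      rw [← Real.mul_rpow (by norm_num) hp0.le]
      exact Real.rpow_le_rpow (bracket_pos l).le hb (by linarith)
    have e2 := mul_le_mul_of_nonneg_right e p3
    nlinarith [mul_nonneg p1 p2]

/-- One factor x U^n is as large as |l|^{n+1}, where n + 1 = 2m in the application. The power x^δ is
held back for summability; the rest absorbs ⟨l⟩^{2s} because 2s + δ ≤ n + 1, and the surplus is
turned into p^{-3/4} by |l| > p and 1 - δ ≥ 3/4. -/
theorem profile_far {s δ : ℝ} {n : ℕ} (hs : 0 ≤ s) (hδ0 : 0 < δ) (hδ : δ ≤ 1 / 4)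
    (hsn : 2 * s + δ ≤ n + 1) {p : ℕ} (hp : 1 ≤ p) {l : ℤ} (hl : 4 * p < |(l : ℝ)|)
    {x y U Y : ℝ} (hx1 : 1 ≤ x) (hy : 1 ≤ y)
    (hx : |(l : ℝ)| / 4 ≤ x) (hU : |(l : ℝ)| / 2 ≤ U) (hY : p ≤ Y) :
    bracket l ^ (2 * s) * ((x * U ^ n) * (y * Y ^ n))⁻¹ ≤ 2 ^ (2 * s) * 4 ^ (n + 1) *
      (((p : ℝ) ^ (2 * n))⁻¹ * profile s p l * (x ^ (-(1 + δ)) + y ^ (-(1 + δ)))) := by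
  have hp' : (1 : ℝ) ≤ p := by exact_mod_cast hp
  have hp0 : (0 : ℝ) < p := by linarith
  set t := |(l : ℝ)| with ht
  have ht0 : 0 < t := by linarith
  have hx0 : 0 < x := by linarith
  have hb : bracket l ^ (2 * s) ≤ 2 ^ (2 * s) * t ^ (2 * s) := by
    rw [← Real.mul_rpow (by norm_num) ht0.le]
    refine Real.rpow_le_rpow (bracket_pos l).le ?_ (by linarith)
    unfold bracket; linarith
  have h1 : x ^ δ * (4 ^ (n + 1))⁻¹ * t ^ ((n : ℝ) + 1 - δ) ≤ x * U ^ n := by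
    have e1 : x = x ^ δ * x ^ (1 - δ) := by rw [← Real.rpow_add hx0]; simp
    have e2 : (t / 4) ^ (1 - δ) ≤ x ^ (1 - δ) :=
      Real.rpow_le_rpow (by positivity) hx (by linarith)
    have e3 : (t / 4) ^ n ≤ U ^ n := pow_le_pow_left₀ (by positivity) (by linarith) n
    have e4 : t ^ ((n : ℝ) + 1 - δ) = t ^ (1 - δ) * t ^ n := by
      rw [← Real.rpow_natCast, ← Real.rpow_add ht0]; ring_nf
    have e5 : ((4 : ℝ) ^ (n + 1))⁻¹ * t ^ (1 - δ) * t ^ n ≤ (t / 4) ^ (1 - δ) * (t / 4) ^ n := by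
      rw [Real.div_rpow ht0.le (by norm_num), div_pow, pow_succ]
      have e6 : (4 : ℝ) ^ (1 - δ) ≤ 4 := by
        calc (4 : ℝ) ^ (1 - δ) ≤ 4 ^ (1 : ℝ) :=
              Real.rpow_le_rpow_of_exponent_le (by norm_num) (by linarith)
          _ = 4 := Real.rpow_one _
      have e7 : (0 : ℝ) < 4 ^ (1 - δ) := by positivity
      have e8 : (4 : ℝ)⁻¹ ≤ (4 ^ (1 - δ))⁻¹ := inv_anti₀ e7 e6
      calc ((4 : ℝ) ^ n * 4)⁻¹ * t ^ (1 - δ) * t ^ n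
          = 4⁻¹ * (t ^ (1 - δ) * (t ^ n / 4 ^ n)) := by field_simp
        _ ≤ (4 ^ (1 - δ))⁻¹ * (t ^ (1 - δ) * (t ^ n / 4 ^ n)) := by gcongr
        _ = _ := by field_simp
    calc x ^ δ * (4 ^ (n + 1))⁻¹ * t ^ ((n : ℝ) + 1 - δ)
        = x ^ δ * ((4 ^ (n + 1))⁻¹ * t ^ (1 - δ) * t ^ n) := by rw [e4]; ring
      _ ≤ x ^ δ * ((t / 4) ^ (1 - δ) * (t / 4) ^ n) := by gcongr
      _ ≤ x ^ δ * (x ^ (1 - δ) * U ^ n) := by gcongr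
      _ = (x ^ δ * x ^ (1 - δ)) * U ^ n := by ring
      _ = x * U ^ n := by rw [← e1]
  have h2 : y * (p : ℝ) ^ n ≤ y * Y ^ n := by gcongr
  have h3 : ((x * U ^ n) * (y * Y ^ n))⁻¹ ≤
      ((x ^ δ * (4 ^ (n + 1))⁻¹ * t ^ ((n : ℝ) + 1 - δ)) * (y * (p : ℝ) ^ n))⁻¹ := by
    refine inv_anti₀ (by positivity) (mul_le_mul h1 h2 (by positivity) ?_)
    exact (by positivity : (0 : ℝ) ≤ _).trans h1
  have h4 : ((x ^ δ * (4 ^ (n + 1))⁻¹ * t ^ ((n : ℝ) + 1 - δ)) * (y * (p : ℝ) ^ n))⁻¹ =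
      4 ^ (n + 1) * t ^ (-((n : ℝ) + 1 - δ)) * (x ^ (-δ) * y⁻¹) * ((p : ℝ) ^ n)⁻¹ := by
    rw [Real.rpow_neg ht0.le, Real.rpow_neg hx0.le]
    field_simp
  have h5 := rpow_mul_inv_le hx1 hy hδ0.le
  have h6 : t ^ (2 * s) * t ^ (-((n : ℝ) + 1 - δ)) ≤
      (p : ℝ) ^ (2 * s) * (p : ℝ) ^ (-(3 / 4) : ℝ) * ((p : ℝ) ^ n)⁻¹ := by
    rw [← Real.rpow_add ht0, ← Real.rpow_natCast (p : ℝ) n, ← Real.rpow_neg hp0.le,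
      ← Real.rpow_add hp0, ← Real.rpow_add hp0]
    exact (Real.rpow_le_rpow_of_nonpos hp0 (by linarith) (by linarith)).trans
      (Real.rpow_le_rpow_of_exponent_le hp' (by linarith))
  have h7 : (p : ℝ) ^ (2 * s) * (p : ℝ) ^ (-(3 / 4) : ℝ) ≤ profile s p l := by
    unfold profile
    have p3 : (0 : ℝ) ≤ bracket (|l| - 2 * p) ^ (-(3 / 4) : ℝ) :=
      Real.rpow_nonneg (bracket_pos _).le _
    have p1 : (0 : ℝ) ≤ (p : ℝ) ^ (2 * s) := by positivity
    nlinarith [mul_nonneg p1 p3]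
  have hq : 0 ≤ x ^ (-δ) * y⁻¹ := by positivity
  have hq2 : 0 ≤ profile s p l := le_trans (by positivity) h7
  calc bracket l ^ (2 * s) * ((x * U ^ n) * (y * Y ^ n))⁻¹
      ≤ (2 ^ (2 * s) * t ^ (2 * s)) *
        (4 ^ (n + 1) * t ^ (-((n : ℝ) + 1 - δ)) * (x ^ (-δ) * y⁻¹) * ((p : ℝ) ^ n)⁻¹) := by
        refine mul_le_mul hb (h3.trans_eq h4) ?_ (by positivity)
        have : 0 < U := by linarith
        have : 0 < Y := by linarith
        positivity
    _ = 2 ^ (2 * s) * 4 ^ (n + 1) * (((p : ℝ) ^ n)⁻¹ *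
        (t ^ (2 * s) * t ^ (-((n : ℝ) + 1 - δ))) * (x ^ (-δ) * y⁻¹)) := by ring
    _ ≤ 2 ^ (2 * s) * 4 ^ (n + 1) * (((p : ℝ) ^ n)⁻¹ *
        (profile s p l * ((p : ℝ) ^ n)⁻¹) * (x ^ (-(1 + δ)) + y ^ (-(1 + δ)))) := by
        have h8 := h6.trans (mul_le_mul_of_nonneg_right h7 (by positivity))
        gcongr
    _ = _ := by
        have : ((p : ℝ) ^ (2 * n))⁻¹ = ((p : ℝ) ^ n)⁻¹ * ((p : ℝ) ^ n)⁻¹ := by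
          rw [← mul_inv, ← pow_add]; ring_nf
        rw [this]; ring

/-- If k and i have the same sign, |k - i| is the difference of their moduli, hence bounded by the
two distances to p. For opposite signs it is the sum of the moduli, hence close to 2p. This is why
the mass of v near ±2p governs the estimates. -/
theorem sdist_add (p : ℕ) (k i : ℤ) :
    bracket (k - i) ≤ 2 * (sdist p k + sdist p i) ∨
      bracket (|k - i| - 2 * p) ≤ 2 * (sdist p k + sdist p i) := by
  have a1 := le_max_right 1 |(|(k : ℝ)| - p)|
  have a2 := le_max_right 1 |(|(i : ℝ)| - p)|
  have b1 := one_le_sdist p k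
  have b2 := one_le_sdist p i
  rw [bracket_abs_sub]
  unfold bracket
  unfold sdist at b1 b2 ⊢
  set X := max 1 |(|(k : ℝ)| - p)|
  set Y := max 1 |(|(i : ℝ)| - p)|
  push_cast
  have hp : (0 : ℝ) ≤ p := Nat.cast_nonneg p
  rw [abs_le] at a1 a2
  rcases abs_cases (k : ℝ) with h1 | h1 <;> rcases abs_cases (i : ℝ) with h2 | h2
  · left; rcases abs_cases ((k : ℝ) - i) with h3 | h3 <;> linarith
  · right; rcases abs_cases ((k : ℝ) - i) with h3 | h3 <;>
      rcases abs_cases (|(k : ℝ) - i| - 2 * p) with h4 | h4 <;> linarith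
  · right; rcases abs_cases ((k : ℝ) - i) with h3 | h3 <;>
      rcases abs_cases (|(k : ℝ) - i| - 2 * p) with h4 | h4 <;> linarith
  · left; rcases abs_cases ((k : ℝ) - i) with h3 | h3 <;> linarith

/-- The larger of |k| and |i| is at least |k - i| / 2, which exceeds 2p, so its distance to p is at
least half of it. -/
theorem sdist_far {p : ℕ} {k i : ℤ} (h : 4 * p < |((k - i : ℤ) : ℝ)|) :
    (|((k - i : ℤ) : ℝ)| / 4 ≤ sdist p k ∧ |((k - i : ℤ) : ℝ)| / 2 ≤ |(k : ℝ)| + p) ∨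
    (|((k - i : ℤ) : ℝ)| / 4 ≤ sdist p i ∧ |((k - i : ℤ) : ℝ)| / 2 ≤ |(i : ℝ)| + p) := by
  have a1 := (le_abs_self _).trans (le_max_right 1 |(|(k : ℝ)| - p)|)
  have a2 := (le_abs_self _).trans (le_max_right 1 |(|(i : ℝ)| - p)|)
  have hp : (0 : ℝ) ≤ p := Nat.cast_nonneg p
  unfold sdist
  push_cast at h ⊢
  have h3 := abs_sub (k : ℝ) i
  rcases le_total |(i : ℝ)| |(k : ℝ)| with h4 | h4
  · left; constructor <;> linarith
  · right; constructor <;> linarith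

/-- The pointwise form of the Hilbert–Schmidt bound. The right side is a function of k - i times a
sum of functions of k alone and of i alone, so the double sum over k and i factorizes. The two
regimes are separated at |k - i| = 4p. -/
theorem weight_pointwise {m : ℕ} (hm : 1 ≤ m) {s δ : ℝ} (hs : 0 ≤ s) (hδ0 : 0 < δ)
    (hδ : δ ≤ 1 / 4) (hsm : 2 * s + δ ≤ 2 * m) {p : ℕ} (hp : 1 ≤ p) (k i : ℤ) :
    bracket (k - i) ^ (2 * s) * (wt m p k * wt m p i)⁻¹ ≤
      (4 ^ (4 * m) * (4 * 5 ^ (2 * s) + 2 ^ (2 * s) * 4 ^ (2 * m))) *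
      (((p : ℝ) ^ (4 * m - 2))⁻¹ * profile s p (k - i) *
        (sdist p k ^ (-(1 + δ)) + sdist p i ^ (-(1 + δ)))) := by
  have hp' : (1 : ℝ) ≤ p := by exact_mod_cast hp
  have hp0 : (0 : ℝ) < p := by linarith
  obtain ⟨n, hn⟩ : ∃ n, n = 2 * m - 1 := ⟨_, rfl⟩
  have e1 : 4 * m - 2 = 2 * n := by omega
  have e2 : 2 * m = n + 1 := by omega
  have e3 : 4 * m = (n + 1) + (n + 1) := by omega
  set x := sdist p k with hx
  set y := sdist p i with hy
  set U := |(k : ℝ)| + p with hU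
  set Y := |(i : ℝ)| + p with hY
  have hx1 : 1 ≤ x := one_le_sdist p k
  have hy1 : 1 ≤ y := one_le_sdist p i
  have hU1 : p ≤ U := by rw [hU]; linarith [abs_nonneg (k : ℝ)]
  have hY1 : p ≤ Y := by rw [hY]; linarith [abs_nonneg (i : ℝ)]
  have hx0 : 0 < x := by linarith
  have hy0 : 0 < y := by linarith
  have hU0 : 0 < U := by linarith
  have hY0 : 0 < Y := by linarith
  have hsn : 2 * s + δ ≤ n + 1 := by
    have : (2 : ℝ) * m = n + 1 := by exact_mod_cast e2
    linarith
  have hprof : 0 ≤ profile s p (k - i) := by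
    unfold profile
    have := Real.rpow_nonneg (bracket_pos (|k - i| - 2 * p)).le (-(3 / 4) : ℝ)
    positivity
  have hX : 0 ≤ x ^ (-(1 + δ)) + y ^ (-(1 + δ)) := by positivity
  have hE : 0 ≤ ((p : ℝ) ^ (2 * n))⁻¹ * profile s p (k - i) *
    (x ^ (-(1 + δ)) + y ^ (-(1 + δ))) := by positivity
  have key : bracket (k - i) ^ (2 * s) * ((x * U ^ n) * (y * Y ^ n))⁻¹ ≤
      (4 * 5 ^ (2 * s) + 2 ^ (2 * s) * 4 ^ (n + 1)) * (((p : ℝ) ^ (2 * n))⁻¹ * profile s p (k - i) *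
    (x ^ (-(1 + δ)) + y ^ (-(1 + δ)))) := by
    rcases le_or_gt |((k - i : ℤ) : ℝ)| (4 * p) with hl | hl
    · obtain ⟨L, hL, hLle⟩ : ∃ L, (L = bracket (k - i) ∨ L = bracket (|k - i| - 2 * p)) ∧
          L ≤ 2 * (x + y) := by
        rcases sdist_add p k i with h | h
        · exact ⟨_, Or.inl rfl, h⟩
        · exact ⟨_, Or.inr rfl, h⟩
      have hL0 : 0 < L := by rcases hL with rfl | rfl <;> exact bracket_pos _
      have h1 := profile_near hs hp hl hL
      have h2 := inv_mul_inv_le' hx1 hy1 hL0 hLle hδ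
      have h3 : ((x * U ^ n) * (y * Y ^ n))⁻¹ ≤ (x * y)⁻¹ * ((p : ℝ) ^ (2 * n))⁻¹ := by
        rw [← mul_inv]
        refine inv_anti₀ (by positivity) ?_
        calc x * y * (p : ℝ) ^ (2 * n) = (x * (p : ℝ) ^ n) * (y * (p : ℝ) ^ n) := by
              rw [two_mul, pow_add]; ring
          _ ≤ _ := by gcongr
      have hb : 0 ≤ bracket (k - i) ^ (2 * s) := Real.rpow_nonneg (bracket_pos _).le _
      calc bracket (k - i) ^ (2 * s) * ((x * U ^ n) * (y * Y ^ n))⁻¹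
          ≤ bracket (k - i) ^ (2 * s) * ((4 * L ^ (-(3 / 4) : ℝ) *
            (x ^ (-(1 + δ)) + y ^ (-(1 + δ)))) * ((p : ℝ) ^ (2 * n))⁻¹) := by
            gcongr
            exact h3.trans (mul_le_mul_of_nonneg_right h2 (by positivity))
        _ = (bracket (k - i) ^ (2 * s) * L ^ (-(3 / 4) : ℝ)) * (4 *
            ((p : ℝ) ^ (2 * n))⁻¹ * (x ^ (-(1 + δ)) + y ^ (-(1 + δ)))) := by ring
        _ ≤ (5 ^ (2 * s) * profile s p (k - i)) * (4 *
            ((p : ℝ) ^ (2 * n))⁻¹ * (x ^ (-(1 + δ)) + y ^ (-(1 + δ)))) := by gcongr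
        _ = (4 * 5 ^ (2 * s)) * (((p : ℝ) ^ (2 * n))⁻¹ * profile s p (k - i) *
            (x ^ (-(1 + δ)) + y ^ (-(1 + δ)))) := by ring
        _ ≤ _ := by
            refine mul_le_mul_of_nonneg_right ?_ hE
            have : (0 : ℝ) ≤ 2 ^ (2 * s) * 4 ^ (n + 1) := by positivity
            linarith
    · have h : bracket (k - i) ^ (2 * s) * ((x * U ^ n) * (y * Y ^ n))⁻¹ ≤ 2 ^ (2 * s) * 4 ^ (n + 1) *
          (((p : ℝ) ^ (2 * n))⁻¹ * profile s p (k - i) * (x ^ (-(1 + δ)) + y ^ (-(1 + δ)))) := by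
        rcases sdist_far hl with ⟨h1, h2⟩ | ⟨h1, h2⟩
        · exact profile_far hs hδ0 hδ hsn hp hl hx1 hy1 h1 h2 hY1
        · have := profile_far hs hδ0 hδ hsn hp hl hy1 hx1 h1 h2 hU1
          rwa [add_comm (y ^ _), mul_comm (y * _)] at this
      refine h.trans (mul_le_mul_of_nonneg_right ?_ hE)
      have : (0 : ℝ) ≤ 4 * 5 ^ (2 * s) := by positivity
      linarith
  have e4 : (wt m p k * wt m p i)⁻¹ = 4 ^ (4 * m) * ((x * U ^ n) * (y * Y ^ n))⁻¹ := by
    unfold wt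
    rw [← hn, ← hx, ← hy, ← hU, ← hY, e3, e2, pow_add]
    simp only [mul_inv, inv_inv]
    ring
  have key2 := mul_le_mul_of_nonneg_left key (by positivity : (0 : ℝ) ≤ 4 ^ (4 * m))
  rw [e4, e1, e2]
  linarith

/-- The summand of the squared norm of `h^{-s}`. -/
def density (s : ℝ) (v : ℤ → ℂ) (l : ℤ) : ℝ := bracket l ^ (2 * -s) * ‖v l‖ ^ 2

theorem density_nonneg (s : ℝ) (v : ℤ → ℂ) (l : ℤ) : 0 ≤ density s v l :=
  mul_nonneg (Real.rpow_nonneg (bracket_pos l).le _) (sq_nonneg _)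

theorem summable_density {s : ℝ} {v : ℤ → ℂ} (hv : v ∈ hSpace (-s)) : Summable (density s v) := hv

theorem norm_sq_eq_density (s : ℝ) (v : ℤ → ℂ) (l : ℤ) :
    ‖v l‖ ^ 2 = bracket l ^ (2 * s) * density s v l := by
  unfold density
  rw [← mul_assoc, ← Real.rpow_add (bracket_pos l)]
  simp

/-- `∑ |v l|² ⟨l⟩^{-2s} ⟨|l| - 2p⟩^{-3/4}` -/
def localMass (s : ℝ) (v : ℤ → ℂ) (p : ℕ) : ℝ :=
  ∑' l : ℤ, density s v l * bracket (|l| - 2 * p) ^ (-(3 / 4) : ℝ)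

/-- The squared norm of `h^{-s}`. -/
def mass (s : ℝ) (v : ℤ → ℂ) : ℝ := ∑' l : ℤ, density s v l

theorem mass_nonneg (s : ℝ) (v : ℤ → ℂ) : 0 ≤ mass s v := tsum_nonneg (density_nonneg s v)

theorem bracket_rpow_le_one (l : ℤ) {c : ℝ} (hc : c ≤ 0) : bracket l ^ c ≤ 1 :=
  Real.rpow_le_one_of_one_le_of_nonpos (one_le_bracket l) hc

theorem bracket_rpow_nonneg (l : ℤ) (c : ℝ) : 0 ≤ bracket l ^ c :=
  Real.rpow_nonneg (bracket_pos l).le c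

theorem summable_localMass {s : ℝ} {v : ℤ → ℂ} (hv : v ∈ hSpace (-s)) (p : ℕ) :
    Summable fun l : ℤ => density s v l * bracket (|l| - 2 * p) ^ (-(3 / 4) : ℝ) :=
  Summable.of_nonneg_of_le (fun l => mul_nonneg (density_nonneg s v l) (bracket_rpow_nonneg _ _))
    (fun l => mul_le_of_le_one_right (density_nonneg s v l)
      (bracket_rpow_le_one _ (by norm_num))) (summable_density hv)

theorem localMass_nonneg (s : ℝ) (v : ℤ → ℂ) (p : ℕ) : 0 ≤ localMass s v p :=
  tsum_nonneg fun l => mul_nonneg (density_nonneg s v l) (bracket_rpow_nonneg _ _)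

theorem localMass_le {s : ℝ} {v : ℤ → ℂ} (hv : v ∈ hSpace (-s)) (p : ℕ) :
    localMass s v p ≤ mass s v :=
  (summable_localMass hv p).tsum_le_tsum (fun l => mul_le_of_le_one_right (density_nonneg s v l)
      (bracket_rpow_le_one _ (by norm_num))) (summable_density hv)

/-- Cauchy–Schwarz with the density split into two square roots; the exponent 3/4 doubles to 3/2,
which is summable over p. -/
theorem localMass_sq_le {s : ℝ} {v : ℤ → ℂ} (hv : v ∈ hSpace (-s)) (p : ℕ) :
    localMass s v p ^ 2 ≤
      mass s v * ∑' l : ℤ, density s v l * bracket (|l| - 2 * p) ^ (-(3 / 2) : ℝ) := by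
  have h2 : Summable fun l : ℤ => density s v l * bracket (|l| - 2 * p) ^ (-(3 / 2) : ℝ) :=
    Summable.of_nonneg_of_le
      (fun l => mul_nonneg (density_nonneg s v l) (bracket_rpow_nonneg _ _))
      (fun l => mul_le_of_le_one_right (density_nonneg s v l)
        (bracket_rpow_le_one _ (by norm_num))) (summable_density hv)
  have e1 : ∀ l, √(density s v l) ^ 2 = density s v l := fun l => Real.sq_sqrt (density_nonneg s v l)
  have e2 : ∀ l : ℤ, (√(density s v l) * bracket (|l| - 2 * p) ^ (-(3 / 4) : ℝ)) ^ 2 =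
      density s v l * bracket (|l| - 2 * p) ^ (-(3 / 2) : ℝ) := fun l => by
    rw [mul_pow, e1, ← Real.rpow_natCast (bracket (|l| - 2 * p) ^ (-(3 / 4) : ℝ)),
      ← Real.rpow_mul (bracket_pos _).le]
    norm_num
  have h := (cauchy_schwarz_family (f := fun l => √(density s v l))
    (g := fun l : ℤ => √(density s v l) * bracket (|l| - 2 * p) ^ (-(3 / 4) : ℝ))
    (fun _ => Real.sqrt_nonneg _)
    (fun l => mul_nonneg (Real.sqrt_nonneg _) (bracket_rpow_nonneg _ _))
    (by simpa only [e1] using summable_density hv) (by simpa only [e2] using h2)).2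
  simp only [e1, e2, ← mul_assoc, Real.mul_self_sqrt (density_nonneg s v _)] at h
  exact h

/-- The local masses are square summable, with a bound by the mass. -/
theorem summable_localMass_sq {s : ℝ} {v : ℤ → ℂ} (hv : v ∈ hSpace (-s)) :
    (Summable fun p : ℕ => localMass s v p ^ 2) ∧ ∑' p : ℕ, localMass s v p ^ 2 ≤
      mass s v ^ 2 * ∑' j : ℤ, bracket j ^ (-(3 / 2) : ℝ) := by
  have hB : Summable fun j : ℤ => bracket j ^ (-(3 / 2) : ℝ) := summable_bracket (by norm_num)
  set B := ∑' j : ℤ, bracket j ^ (-(3 / 2) : ℝ)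
  have inj : ∀ l : ℤ, Function.Injective fun p : ℕ => |l| - 2 * (p : ℤ) := fun l a b h => by
    simp only at h; omega
  have s1 : ∀ l : ℤ, Summable fun p : ℕ => bracket (|l| - 2 * p) ^ (-(3 / 2) : ℝ) :=
    fun l => hB.comp_injective (inj l)
  have b1 : ∀ l : ℤ, ∑' p : ℕ, bracket (|l| - 2 * p) ^ (-(3 / 2) : ℝ) ≤ B := fun l =>
    tsum_comp_le_tsum_of_inj hB (fun j => bracket_rpow_nonneg j _) (inj l)
  have s2 : ∀ l : ℤ, Summable fun p : ℕ =>
      density s v l * bracket (|l| - 2 * p) ^ (-(3 / 2) : ℝ) := fun l => (s1 l).mul_left _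
  -- Tonelli: for fixed l the integers |l| - 2p are distinct, so the sum over p is at most the full
  -- sum of ⟨j⟩^{-3/2}, whatever l is.
  have hF : Summable fun q : ℤ × ℕ => density s v q.1 * bracket (|q.1| - 2 * q.2) ^ (-(3 / 2) : ℝ) := by
    refine (summable_prod_of_nonneg ?_).mpr ⟨?_, ?_⟩
    · exact fun q => mul_nonneg (density_nonneg s v _) (bracket_rpow_nonneg _ _)
    · intro l
      simpa only using s2 l
    refine Summable.of_nonneg_of_le (fun l => tsum_nonneg fun p =>
      mul_nonneg (density_nonneg s v _) (bracket_rpow_nonneg _ _)) (fun l => ?_)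
      ((summable_density hv).mul_right B)
    simp only [tsum_mul_left]
    exact mul_le_mul_of_nonneg_left (b1 l) (density_nonneg s v l)
  have hG : Summable fun p : ℕ => ∑' l : ℤ, density s v l * bracket (|l| - 2 * p) ^ (-(3 / 2) : ℝ) :=
    ((Equiv.prodComm ℕ ℤ).summable_iff.mpr hF).prod
  have hGle : ∑' p : ℕ, ∑' l : ℤ, density s v l * bracket (|l| - 2 * p) ^ (-(3 / 2) : ℝ) ≤
      mass s v * B := by
    have hcomm := Summable.tsum_comm (f := fun (l : ℤ) (p : ℕ) =>
      density s v l * bracket (|l| - 2 * p) ^ (-(3 / 2) : ℝ)) hF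
    have hF' : Summable fun l : ℤ => ∑' p : ℕ,
      density s v l * bracket (|l| - 2 * p) ^ (-(3 / 2) : ℝ) := hF.prod
    rw [hcomm, mass, ← tsum_mul_right]
    refine hF'.tsum_le_tsum (fun l => ?_) ((summable_density hv).mul_right B)
    rw [tsum_mul_left]
    exact mul_le_mul_of_nonneg_left (b1 l) (density_nonneg s v l)
  have hs : Summable fun p : ℕ => localMass s v p ^ 2 :=
    Summable.of_nonneg_of_le (fun p => sq_nonneg _) (localMass_sq_le hv) (hG.mul_left _)
  refine ⟨hs, (hs.tsum_le_tsum (localMass_sq_le hv) (hG.mul_left _)).trans ?_⟩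
  rw [tsum_mul_left, sq, mul_assoc]
  exact mul_le_mul_of_nonneg_left hGle (mass_nonneg s v)

theorem sdist_rpow_le {δ : ℝ} (hδ : 0 < δ) (p : ℕ) (k : ℤ) :
    sdist p k ^ (-(1 + δ)) ≤ 2 ^ (1 + δ) *
      (bracket (k - p) ^ (-(1 + δ)) + bracket (k + p) ^ (-(1 + δ))) := by
  have key : ∀ l : ℤ, bracket l ≤ 2 * sdist p k →
      sdist p k ^ (-(1 + δ)) ≤ 2 ^ (1 + δ) * bracket l ^ (-(1 + δ)) := by
    intro l hl
    have h1 := Real.rpow_le_rpow_of_nonpos (bracket_pos l) hl (by linarith : -(1 + δ) ≤ 0)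
    rw [Real.mul_rpow (by norm_num) (sdist_pos p k).le, Real.rpow_neg (by norm_num),
      inv_mul_le_iff₀ (by positivity)] at h1
    exact h1
  have b1 := one_le_sdist p k
  have a1 := le_max_right 1 |(|(k : ℝ)| - p)|
  have h0 : (0 : ℝ) ≤ 2 ^ (1 + δ) := by positivity
  have n1 := mul_nonneg h0 (bracket_rpow_nonneg (k - p) (-(1 + δ)))
  have n2 := mul_nonneg h0 (bracket_rpow_nonneg (k + p) (-(1 + δ)))
  rw [mul_add]
  rcases abs_cases (k : ℝ) with h1 | h1
  · have e : |(k : ℝ) - p| ≤ sdist p k := by rw [← h1.1]; exact a1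
    have := key (k - p) (by unfold bracket; push_cast; linarith)
    linarith
  · have e : |(k : ℝ) + p| ≤ sdist p k := by
      rw [← abs_neg, neg_add', ← h1.1]; exact a1
    have := key (k + p) (by unfold bracket; push_cast; linarith)
    linarith

/-- The point is uniformity in p: the truncated distance to {p, -p} is comparable to a bracket
centered at p or at -p, and the sum over ℤ is translation invariant. -/
theorem tsum_sdist_le {δ : ℝ} (hδ : 0 < δ) (p : ℕ) :
    (Summable fun k : ℤ => sdist p k ^ (-(1 + δ))) ∧ ∑' k : ℤ, sdist p k ^ (-(1 + δ)) ≤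
      2 ^ (1 + δ) * (2 * ∑' j : ℤ, bracket j ^ (-(1 + δ))) := by
  have hB : Summable fun j : ℤ => bracket j ^ (-(1 + δ)) := summable_bracket (by linarith)
  have h1 : Summable fun k : ℤ => bracket (k - p) ^ (-(1 + δ)) :=
    hB.comp_injective (i := fun k : ℤ => k - p) sub_left_injective
  have h2 : Summable fun k : ℤ => bracket (k + p) ^ (-(1 + δ)) :=
    hB.comp_injective (i := fun k : ℤ => k + p) (add_left_injective _)
  have e1 : ∑' k : ℤ, bracket (k - p) ^ (-(1 + δ)) = ∑' j : ℤ, bracket j ^ (-(1 + δ)) :=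
    (Equiv.subRight (p : ℤ)).tsum_eq (fun j => bracket j ^ (-(1 + δ)))
  have e2 : ∑' k : ℤ, bracket (k + p) ^ (-(1 + δ)) = ∑' j : ℤ, bracket j ^ (-(1 + δ)) :=
    (Equiv.addRight (p : ℤ)).tsum_eq (fun j => bracket j ^ (-(1 + δ)))
  have hs : Summable fun k : ℤ => sdist p k ^ (-(1 + δ)) :=
    Summable.of_nonneg_of_le (fun k => Real.rpow_nonneg (sdist_pos p k).le _)
      (sdist_rpow_le hδ p) ((h1.add h2).mul_left _)
  refine ⟨hs, (hs.tsum_le_tsum (sdist_rpow_le hδ p) ((h1.add h2).mul_left _)).trans_eq ?_⟩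
  rw [tsum_mul_left, h1.tsum_add h2, e1, e2]
  ring

/-- Sums over pairs `(k, i)` of a function of the difference times functions of one entry. -/
theorem hasSum_sub_mul {f e : ℤ → ℝ} (hf : Summable f) (he : Summable e) (hf0 : ∀ l, 0 ≤ f l)
    (he0 : ∀ l, 0 ≤ e l) :
    HasSum (fun q : ℤ × ℤ => f (q.1 - q.2) * (e q.1 + e q.2)) (2 * ((∑' l, f l) * ∑' l, e l)) := by
  have h : HasSum (fun q : ℤ × ℤ => f q.1 * e q.2) _ :=
    hf.hasSum.mul he.hasSum (hf.mul_of_nonneg he hf0 he0)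
  let E1 : ℤ × ℤ ≃ ℤ × ℤ :=
    { toFun := fun q => (q.1 - q.2, q.2)
      invFun := fun q => (q.1 + q.2, q.2)
      left_inv := fun q => by simp
      right_inv := fun q => by simp }
  let E2 : ℤ × ℤ ≃ ℤ × ℤ :=
    { toFun := fun q => (q.1 - q.2, q.1)
      invFun := fun q => (q.2, q.2 - q.1)
      left_inv := fun q => by simp
      right_inv := fun q => by simp }
  have h1 := E1.hasSum_iff.mpr h
  have h2 := E2.hasSum_iff.mpr h
  rw [two_mul]
  refine (h2.add h1).congr_fun fun q => ?_
  simp only [Function.comp_apply, E1, E2, Equiv.coe_fn_mk]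
  ring

/-- The Hilbert–Schmidt bound for the weighted convolution matrix. -/
theorem exists_hs_bound {m : ℕ} (hm : 1 ≤ m) {s : ℝ} (hs : 0 ≤ s) (hsm : s < m) :
    ∃ C : ℝ, 0 < C ∧ ∀ p : ℕ, 1 ≤ p → ∀ v ∈ hSpace (-s),
      (Summable fun q : ℤ × ℤ => ‖v (q.1 - q.2)‖ ^ 2 * (wt m p q.1 * wt m p q.2)⁻¹) ∧
      ∑' q : ℤ × ℤ, ‖v (q.1 - q.2)‖ ^ 2 * (wt m p q.1 * wt m p q.2)⁻¹ ≤
        C * (((p : ℝ) ^ (4 * m - 2))⁻¹ * ((p : ℝ) ^ (2 * s) *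
          (localMass s v p + (p : ℝ) ^ (-(3 / 4) : ℝ) * mass s v) + mass s v)) := by
  -- A positive δ with 2s + δ ≤ 2m exists because s < m; this is where α < 1 is needed.
  obtain ⟨δ, hδ0, hδ, hsδ⟩ : ∃ δ : ℝ, 0 < δ ∧ δ ≤ 1 / 4 ∧ 2 * s + δ ≤ 2 * m :=
    ⟨min (1 / 4) (2 * (m - s)), lt_min (by norm_num) (by linarith), min_le_left _ _, by
      linarith [min_le_right (1 / 4 : ℝ) (2 * (m - s))]⟩
  set K : ℝ := 4 ^ (4 * m) * (4 * 5 ^ (2 * s) + 2 ^ (2 * s) * 4 ^ (2 * m)) with hK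
  have hK0 : 0 < K := by positivity
  set E : ℝ := 2 ^ (1 + δ) * (2 * ∑' j : ℤ, bracket j ^ (-(1 + δ))) with hE
  have hE0 : 0 ≤ E := by
    have : 0 ≤ ∑' j : ℤ, bracket j ^ (-(1 + δ)) := tsum_nonneg fun j => bracket_rpow_nonneg j _
    positivity
  refine ⟨2 * K * (E + 1), by positivity, fun p hp v hv => ?_⟩
  obtain ⟨he, heE⟩ := tsum_sdist_le hδ0 p
  have hp0 : (0 : ℝ) < p := by exact_mod_cast hp
  set c : ℝ := ((p : ℝ) ^ (4 * m - 2))⁻¹ with hc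
  have hc0 : 0 < c := by positivity
  have hf : HasSum (fun l => density s v l * profile s p l) ((p : ℝ) ^ (2 * s) *
          (localMass s v p + (p : ℝ) ^ (-(3 / 4) : ℝ) * mass s v) + mass s v) := by
    have h1 := (summable_localMass hv p).hasSum
    have h2 := (summable_density hv).hasSum
    refine (((h1.add (h2.mul_left ((p : ℝ) ^ (-(3 / 4) : ℝ)))).mul_left
      ((p : ℝ) ^ (2 * s))).add h2).congr_fun fun l => ?_
    unfold profile
    ring
  set S := (p : ℝ) ^ (2 * s) *
          (localMass s v p + (p : ℝ) ^ (-(3 / 4) : ℝ) * mass s v) + mass s v with hS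
  have hf0 : ∀ l, 0 ≤ density s v l * profile s p l := fun l => by
    refine mul_nonneg (density_nonneg s v l) ?_
    unfold profile
    have := bracket_rpow_nonneg (|l| - 2 * p) (-(3 / 4))
    positivity
  have hS0 : 0 ≤ S := hf.nonneg hf0
  -- The double sum separates into the sum over differences, which is the mass expression `S`, and
  -- the uniformly bounded sum of the truncated distances.
  have hmain := (hasSum_sub_mul hf.summable he hf0
    (fun k => Real.rpow_nonneg (sdist_pos p k).le _)).mul_left (K * c)
  have hle : ∀ q : ℤ × ℤ, ‖v (q.1 - q.2)‖ ^ 2 * (wt m p q.1 * wt m p q.2)⁻¹ ≤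
      K * c * (density s v (q.1 - q.2) * profile s p (q.1 - q.2) *
        (sdist p q.1 ^ (-(1 + δ)) + sdist p q.2 ^ (-(1 + δ)))) := by
    rintro ⟨k, i⟩
    have h := mul_le_mul_of_nonneg_left (weight_pointwise hm hs hδ0 hδ hsδ hp k i)
      (density_nonneg s v (k - i))
    simp only [norm_sq_eq_density s v]
    rw [← hK, ← hc] at h
    linarith
  have hsum : Summable fun q : ℤ × ℤ => ‖v (q.1 - q.2)‖ ^ 2 * (wt m p q.1 * wt m p q.2)⁻¹ :=
    Summable.of_nonneg_of_le (fun q => mul_nonneg (sq_nonneg _)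
      (inv_nonneg.mpr (mul_nonneg (wt_pos m hp _).le (wt_pos m hp _).le))) hle hmain.summable
  refine ⟨hsum, (hsum.tsum_le_tsum hle hmain.summable).trans ?_⟩
  rw [hmain.tsum_eq, hf.tsum_eq]
  have h3 : S * ∑' k : ℤ, sdist p k ^ (-(1 + δ)) ≤ S * (E + 1) :=
    mul_le_mul_of_nonneg_left (by linarith) hS0
  calc K * c * (2 * (S * ∑' k : ℤ, sdist p k ^ (-(1 + δ)))) ≤ K * c * (2 * (S * (E + 1))) := by
        gcongr
    _ = _ := by ring

/-! ### Regularity of sequences -/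

/-- A variant of `weight_bound` that does not require 2 ≤ a + b. The vectors produced by the block
construction lie a priori only in h^m, and mα + m may be less than 2. The larger of ⟨k⟩ and ⟨j⟩
dominates ⟨k - j⟩, and the remaining powers reduce to ⟨·⟩^{-b}, square summable for b ≥ 1. -/
theorem weight_bound_of_one_le {a b : ℝ} (ha : 0 ≤ a) (hle : a ≤ b) (hb : 1 ≤ b) :
    ∃ P Q : ℤ → ℝ, (∀ k, 0 ≤ P k) ∧ (∀ k, 0 ≤ Q k) ∧ (Summable fun k => P k ^ 2) ∧
      (Summable fun k => Q k ^ 2) ∧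
      ∀ k j : ℤ, bracket k ^ (-a) * bracket (k - j) ^ a * bracket j ^ (-b) ≤ P k + Q j := by
  have hS : Summable fun k : ℤ => (2 ^ a * bracket k ^ (-b)) ^ 2 := by
    have h : ∀ k : ℤ, (2 ^ a * bracket k ^ (-b)) ^ 2 = (2 ^ a) ^ 2 * bracket k ^ (-(2 * b)) := by
      intro k
      rw [mul_pow, ← Real.rpow_natCast (bracket k ^ (-b)), ← Real.rpow_mul (bracket_pos k).le]
      congr 2
      push_cast
      ring
    simp only [h]
    exact (summable_bracket (by linarith)).mul_left _
  have pos : ∀ k : ℤ, 0 ≤ 2 ^ a * bracket k ^ (-b) := fun k =>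
    mul_nonneg (by positivity) (bracket_rpow_nonneg k _)
  refine ⟨fun k => 2 ^ a * bracket k ^ (-b), fun k => 2 ^ a * bracket k ^ (-b), pos, pos, hS, hS,
    fun k j => ?_⟩
  have key : ∀ t : ℝ, 0 < t → bracket (k - j) ≤ 2 * t → bracket (k - j) ^ a ≤ 2 ^ a * t ^ a :=
    fun t ht h => by
      rw [← Real.mul_rpow (by norm_num) ht.le]
      exact Real.rpow_le_rpow (bracket_pos _).le h ha
  have p1 := bracket_rpow_nonneg k (-a)
  have p2 := bracket_rpow_nonneg j (-b)
  have hadd := bracket_sub_le_add k j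
  rcases le_total (bracket k) (bracket j) with hkj | hkj
  · have e1 := key (bracket j) (bracket_pos j) (by linarith)
    have e2 : bracket j ^ a * bracket j ^ (-b) ≤ bracket k ^ (a - b) := by
      rw [← Real.rpow_add (bracket_pos j)]
      exact Real.rpow_le_rpow_of_nonpos (bracket_pos k) hkj (by linarith)
    have e3 : bracket k ^ (-a) * bracket k ^ (a - b) = bracket k ^ (-b) := by
      rw [← Real.rpow_add (bracket_pos k)]; ring_nf
    calc bracket k ^ (-a) * bracket (k - j) ^ a * bracket j ^ (-b)
        ≤ bracket k ^ (-a) * (2 ^ a * bracket j ^ a) * bracket j ^ (-b) := by gcongr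
      _ = 2 ^ a * (bracket k ^ (-a) * (bracket j ^ a * bracket j ^ (-b))) := by ring
      _ ≤ 2 ^ a * (bracket k ^ (-a) * bracket k ^ (a - b)) := by gcongr
      _ = 2 ^ a * bracket k ^ (-b) := by rw [e3]
      _ ≤ _ := le_add_of_nonneg_right (pos j)
  · have e1 := key (bracket k) (bracket_pos k) (by linarith)
    have e2 : bracket k ^ (-a) * bracket k ^ a = 1 := by
      rw [← Real.rpow_add (bracket_pos k)]; simp
    calc bracket k ^ (-a) * bracket (k - j) ^ a * bracket j ^ (-b)
        ≤ bracket k ^ (-a) * (2 ^ a * bracket k ^ a) * bracket j ^ (-b) := by gcongr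
      _ = 2 ^ a * (bracket k ^ (-a) * bracket k ^ a) * bracket j ^ (-b) := by ring
      _ = 2 ^ a * bracket j ^ (-b) := by rw [e2, mul_one]
      _ ≤ _ := le_add_of_nonneg_left (pos k)

/-- Convolution maps `h^{-a} × h^b` into `h^{-a}` for `0 ≤ a ≤ b`, `1 ≤ b`. -/
theorem conv_mem_of_one_le {a b : ℝ} (ha : 0 ≤ a) (hle : a ≤ b) (hb : 1 ≤ b) {v u : ℤ → ℂ}
    (hv : v ∈ hSpace (-a)) (hu : u ∈ hSpace b) : conv v u ∈ hSpace (-a) := by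
  obtain ⟨P, Q, hP0, hQ0, hP, hQ, hPQ⟩ := weight_bound_of_one_le ha hle hb
  have pos : ∀ (c : ℝ) (k : ℤ), 0 < bracket k ^ c := fun c k =>
    Real.rpow_pos_of_pos (bracket_pos k) c
  obtain ⟨X, hXdef⟩ : ∃ X : ℤ → ℝ, X = fun l => bracket l ^ (-a) * ‖v l‖ := ⟨_, rfl⟩
  obtain ⟨Y, hYdef⟩ : ∃ Y : ℤ → ℝ, Y = fun j => bracket j ^ b * ‖u j‖ := ⟨_, rfl⟩
  have hX0 : ∀ l, 0 ≤ X l := fun l => by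
    rw [hXdef]; exact mul_nonneg (pos _ l).le (norm_nonneg _)
  have hY0 : ∀ j, 0 ≤ Y j := fun j => by
    rw [hYdef]; exact mul_nonneg (pos _ j).le (norm_nonneg _)
  have hX : Summable fun l => X l ^ 2 := by
    rw [hXdef]; exact summable_rpow_mul_iff.mp hv
  have hY : Summable fun j => Y j ^ 2 := by
    rw [hYdef]; exact summable_rpow_mul_iff.mp hu
  have hXk : ∀ k, Summable fun j => X (k - j) ^ 2 := fun k =>
    (Equiv.subLeft k).summable_iff.mpr hX
  have hXY : Summable fun p : ℤ × ℤ => X (p.1 - p.2) ^ 2 * Y p.2 ^ 2 := by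
    have h := hX.mul_of_nonneg hY (fun _ => sq_nonneg _) (fun _ => sq_nonneg _)
    let e : ℤ × ℤ ≃ ℤ × ℤ :=
      { toFun := fun p => (p.1 - p.2, p.2)
        invFun := fun p => (p.1 + p.2, p.2)
        left_inv := fun p => by simp
        right_inv := fun p => by simp }
    exact (e.summable_iff (f := fun q : ℤ × ℤ => X q.1 ^ 2 * Y q.2 ^ 2)).mpr h
  have hXYk : ∀ k, Summable fun j => (X (k - j) * Y j) ^ 2 := fun k => by
    simpa only [mul_pow] using hXY.prod_factor k
  rw [summable_rpow_mul_iff]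
  refine Summable.of_nonneg_of_le (fun k => sq_nonneg _) (fun k => ?_)
    (((hP.mul_right ((∑' l, X l ^ 2) * ∑' j, Y j ^ 2)).mul_left 2).add
      ((hXY.prod.mul_left (∑' j, Q j ^ 2)).mul_left 2))
  have hs := summable_conv ha hle hv hu k
  obtain ⟨s1, c1⟩ := cauchy_schwarz (f := fun j => X (k - j)) (g := Y) (fun j => hX0 _) hY0
    (hXk k) hY
  obtain ⟨s2, c2⟩ := cauchy_schwarz (f := Q) (g := fun j => X (k - j) * Y j) hQ0
    (fun j => mul_nonneg (hX0 _) (hY0 _)) hQ (hXYk k)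
  have e1 : ∑' j, X (k - j) ^ 2 = ∑' l, X l ^ 2 :=
    (Equiv.subLeft k).tsum_eq (fun l => X l ^ 2)
  rw [e1] at c1
  have key : bracket k ^ (-a) * ‖conv v u k‖ ≤
      P k * (∑' j, X (k - j) * Y j) + ∑' j, Q j * (X (k - j) * Y j) := by
    have h1 : ‖conv v u k‖ ≤ ∑' j, ‖v (k - j)‖ * ‖u j‖ := by
      unfold conv
      have h := norm_tsum_le_tsum_norm (f := fun j => v (k - j) * u j) (by simpa using hs)
      simpa using h
    calc bracket k ^ (-a) * ‖conv v u k‖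
        ≤ bracket k ^ (-a) * ∑' j, ‖v (k - j)‖ * ‖u j‖ :=
          mul_le_mul_of_nonneg_left h1 (pos _ k).le
      _ = ∑' j, bracket k ^ (-a) * (‖v (k - j)‖ * ‖u j‖) := by rw [tsum_mul_left]
      _ ≤ ∑' j, (P k * (X (k - j) * Y j) + Q j * (X (k - j) * Y j)) := by
          refine Summable.tsum_le_tsum (fun j => ?_) (hs.mul_left _) ((s1.mul_left _).add s2)
          have w := mul_le_mul_of_nonneg_right (hPQ k j) (mul_nonneg (hX0 (k - j)) (hY0 j))
          have i1 : bracket (k - j) ^ a * bracket (k - j) ^ (-a) = 1 := by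
            rw [← Real.rpow_add (bracket_pos _)]; simp
          have i2 : bracket j ^ (-b) * bracket j ^ b = 1 := by
            rw [← Real.rpow_add (bracket_pos _)]; simp
          calc bracket k ^ (-a) * (‖v (k - j)‖ * ‖u j‖)
              = bracket k ^ (-a) * (bracket (k - j) ^ a * bracket (k - j) ^ (-a)) *
                (bracket j ^ (-b) * bracket j ^ b) * (‖v (k - j)‖ * ‖u j‖) := by
                rw [i1, i2]; ring
            _ = bracket k ^ (-a) * bracket (k - j) ^ a * bracket j ^ (-b) *
                (X (k - j) * Y j) := by simp only [hXdef, hYdef]; ring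
            _ ≤ _ := w.trans (by rw [add_mul])
      _ = _ := by rw [(s1.mul_left (P k)).tsum_add s2, tsum_mul_left]
  have n0 : 0 ≤ bracket k ^ (-a) * ‖conv v u k‖ := mul_nonneg (pos _ k).le (norm_nonneg _)
  have key2 := pow_le_pow_left₀ n0 key 2
  have c1' := mul_le_mul_of_nonneg_left c1 (sq_nonneg (P k))
  simp only [mul_pow] at c2
  set A := ∑' j, X (k - j) * Y j
  set B := ∑' j, Q j * (X (k - j) * Y j)
  nlinarith [sq_nonneg (P k * A - B)]

theorem hSpace_mono {s t : ℝ} (h : s ≤ t) {u : ℤ → ℂ} (hu : u ∈ hSpace t) : u ∈ hSpace s := by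
  refine Summable.of_nonneg_of_le (fun k => mul_nonneg (bracket_rpow_nonneg k _) (sq_nonneg _))
    (fun k => ?_) (show Summable fun k : ℤ => bracket k ^ (2 * t) * ‖u k‖ ^ 2 from hu)
  exact mul_le_mul_of_nonneg_right
    (Real.rpow_le_rpow_of_exponent_le (one_le_bracket k) (by linarith)) (sq_nonneg _)

/-- Elliptic regularity for the diagonal part. Only odd k matter, so |k| ≥ 1 and ⟨k⟩ ≤ 2|k|; the
zero entry at k = 0 does no harm. -/
theorem mem_of_diag_mem {m : ℕ} {s : ℝ} {u : ℤ → ℂ} (hu : ∀ k, u (2 * k) = 0)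
    (h : diag m u ∈ hSpace s) : u ∈ hSpace (s + 2 * m) := by
  rw [summable_rpow_mul_iff] at h ⊢
  refine Summable.of_nonneg_of_le (fun k => sq_nonneg _) (fun k => ?_)
    (h.mul_left (((2 : ℝ) ^ (2 * m)) ^ 2))
  rw [← mul_pow]
  have p : 0 < bracket k ^ s := Real.rpow_pos_of_pos (bracket_pos k) s
  rcases Int.even_or_odd' k with ⟨i, hi | hi⟩
  · rw [hi, hu i]; simp [diag, hu i]
  refine pow_le_pow_left₀ (mul_nonneg (bracket_rpow_nonneg k _) (norm_nonneg _)) ?_ 2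
  have e : bracket k ^ (s + 2 * m) = bracket k ^ s * bracket k ^ (2 * m) := by
    rw [Real.rpow_add (bracket_pos k)]
    congr 1
    rw [← Real.rpow_natCast]
    push_cast
    rfl
  have hk : (1 : ℝ) ≤ |(k : ℝ)| := by
    have : (1 : ℤ) ≤ |k| := Int.one_le_abs (by omega)
    exact_mod_cast this
  have h : bracket k ^ (2 * m) ≤ 2 ^ (2 * m) * |(k : ℝ)| ^ (2 * m) := by
    rw [← mul_pow]
    exact pow_le_pow_left₀ (bracket_pos k).le (by unfold bracket; linarith) _
  have n : ‖diag m u k‖ = |(k : ℝ)| ^ (2 * m) * Real.pi ^ (2 * m) * ‖u k‖ := by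
    simp [diag, abs_of_pos Real.pi_pos]
  have hpi : (1 : ℝ) ≤ Real.pi ^ (2 * m) := one_le_pow₀ (by linarith [Real.pi_gt_three])
  rw [n, e]
  calc bracket k ^ s * bracket k ^ (2 * m) * ‖u k‖
      ≤ bracket k ^ s * (2 ^ (2 * m) * |(k : ℝ)| ^ (2 * m) * 1) * ‖u k‖ := by
        rw [mul_one]; gcongr
    _ ≤ bracket k ^ s * (2 ^ (2 * m) * |(k : ℝ)| ^ (2 * m) * Real.pi ^ (2 * m)) * ‖u k‖ := by
        gcongr
    _ = _ := by ring

/-- The odd integers. -/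
abbrev OddInt := {k : ℤ // Odd k}

/-- Extension by zero from the odd integers. -/
def extendOdd (y : OddInt → ℂ) (k : ℤ) : ℂ := if h : Odd k then y ⟨k, h⟩ else 0

theorem extendOdd_coe (y : OddInt → ℂ) (k : OddInt) : extendOdd y k = y k := by
  simp [extendOdd, k.2]

theorem extendOdd_of_not_odd (y : OddInt → ℂ) {k : ℤ} (hk : ¬ Odd k) : extendOdd y k = 0 := by
  simp [extendOdd, hk]

theorem extendOdd_restrict {u : ℤ → ℂ} (hu : ∀ k, u (2 * k) = 0) :
    extendOdd (fun k => u k) = u := by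
  funext k
  by_cases hk : Odd k
  · simp [extendOdd, hk]
  · rw [extendOdd_of_not_odd _ hk]
    obtain ⟨i, hi⟩ := Int.not_odd_iff_even.mp hk
    rw [hi, ← two_mul, hu]

theorem tsum_odd {f : ℤ → ℂ} (hf : ∀ k, ¬ Odd k → f k = 0) : ∑' k, f k = ∑' k : OddInt, f k :=
  (Subtype.val_injective.tsum_eq fun k hk => by
    by_contra h
    exact hk (hf k fun ho => h ⟨⟨k, ho⟩, rfl⟩)).symm

theorem summable_odd_iff {f : ℤ → ℝ} (hf : ∀ k, ¬ Odd k → f k = 0) :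
    (Summable fun k : OddInt => f k) ↔ Summable f :=
  Subtype.val_injective.summable_iff fun k hk => hf k fun ho => hk ⟨⟨k, ho⟩, rfl⟩

theorem bracket_rpow_two_mul (m : ℕ) (k : ℤ) : bracket k ^ (2 * (m : ℝ)) = bracket k ^ (2 * m) := by
  rw [← Real.rpow_natCast]
  push_cast
  rfl

theorem summable_wt_mul {m p : ℕ} (hm : 1 ≤ m) (hp : 1 ≤ p) {u : ℤ → ℂ} (hu : u ∈ hSpace m) :
    Summable fun k : OddInt => wt m p k * ‖u k‖ ^ 2 := by
  have hu' : Summable fun k : ℤ => bracket k ^ (2 * (m : ℝ)) * ‖u k‖ ^ 2 := hu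
  have h : Summable fun k : ℤ => wt m p k * ‖u k‖ ^ 2 := by
    refine Summable.of_nonneg_of_le (fun k => mul_nonneg (wt_pos m hp k).le (sq_nonneg _))
      (fun k => ?_) (hu'.mul_left ((1 + p : ℝ) ^ (2 * m)))
    rw [← mul_assoc, bracket_rpow_two_mul, ← mul_pow]
    refine mul_le_mul_of_nonneg_right ?_ (sq_nonneg _)
    have hp' : (1 : ℝ) ≤ p := by exact_mod_cast hp
    have hk := abs_nonneg (k : ℝ)
    have h1 : sdist p k ≤ |(k : ℝ)| + p := max_le (by linarith) (by
      rw [abs_le]; constructor <;> linarith)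
    have h2 : |(k : ℝ)| + p ≤ (1 + p) * bracket k := by unfold bracket; nlinarith
    have h4 := (sdist_pos p k).le
    have h3 : ((4 : ℝ) ^ (2 * m))⁻¹ ≤ 1 := inv_le_one_of_one_le₀ (one_le_pow₀ (by norm_num))
    unfold wt
    calc _ ≤ 1 * ((|(k : ℝ)| + p) * (|(k : ℝ)| + p) ^ (2 * m - 1)) := by gcongr
      _ = (|(k : ℝ)| + p) ^ (2 * m) := by rw [one_mul, ← pow_succ']; congr 1; omega
      _ ≤ _ := pow_le_pow_left₀ (by linarith) h2 _
  exact h.comp_injective Subtype.val_injective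

/-- For fixed p the weights grow like |k|^{2m}, so the weighted square summability of the abstract
block argument is membership in h^m. The constant depends on p, which is harmless for a qualitative
statement. -/
theorem extendOdd_mem {m p : ℕ} (hm : 1 ≤ m) (hp : 1 ≤ p) {y : OddInt → ℂ}
    (hy : Summable fun k : OddInt => wt m p k * ‖y k‖ ^ 2) : extendOdd y ∈ hSpace m := by
  have hy' : Summable fun k : ℤ => wt m p k * ‖extendOdd y k‖ ^ 2 := by
    rw [← summable_odd_iff fun k hk => by rw [extendOdd_of_not_odd y hk]; simp]
    simpa only [extendOdd_coe] using hy
  refine Summable.of_nonneg_of_le (fun k => mul_nonneg (bracket_rpow_nonneg k _) (sq_nonneg _))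
      (fun k => ?_) (hy'.mul_left ((4 : ℝ) ^ (2 * m) * (p + 2)))
  rw [← mul_assoc, bracket_rpow_two_mul]
  refine mul_le_mul_of_nonneg_right ?_ (sq_nonneg _)
  have hp' : (1 : ℝ) ≤ p := by exact_mod_cast hp
  have hk := abs_nonneg (k : ℝ)
  have hb := one_le_bracket k
  have h1 : bracket k ≤ (p + 2) * sdist p k := by
    have b1 := one_le_sdist p k
    have b2 := (le_abs_self _).trans (le_max_right 1 |(|(k : ℝ)| - p)|)
    change |(k : ℝ)| - p ≤ sdist p k at b2
    unfold bracket
    nlinarith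
  have h2 : bracket k ≤ |(k : ℝ)| + p := by unfold bracket; linarith
  have hs := sdist_pos p k
  unfold wt
  calc bracket k ^ (2 * m) = bracket k * bracket k ^ (2 * m - 1) := by
        rw [← pow_succ']; congr 1; omega
    _ ≤ ((p + 2) * sdist p k) * (|(k : ℝ)| + p) ^ (2 * m - 1) := by gcongr
    _ = _ := by
        have : (4 : ℝ) ^ (2 * m) ≠ 0 := by positivity
        field_simp

/-! ### The operator as a perturbed diagonal matrix -/

/-- The squared moduli of the weighted convolution matrix. -/
def convEntry (m p : ℕ) (v : ℤ → ℂ) (q : ℤ × ℤ) : ℝ :=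
  ‖v (q.1 - q.2)‖ ^ 2 * (wt m p q.1 * wt m p q.2)⁻¹

theorem norm_weighted_entry_sq (m : ℕ) {p : ℕ} (hp : 1 ≤ p) (v : ℤ → ℂ) (k i : ℤ) :
    ‖v (k - i) / (√(wt m p k) * √(wt m p i))‖ ^ 2 = convEntry m p v (k, i) := by
  have h1 := (wt_pos m hp k).le
  have h2 := (wt_pos m hp i).le
  rw [← Complex.ofReal_mul, norm_div, div_pow, Complex.norm_real, Real.norm_eq_abs, sq_abs, mul_pow,
    Real.sq_sqrt h1, Real.sq_sqrt h2, div_eq_mul_inv]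
  rfl

theorem prodMap_coe_injective :
    Function.Injective fun q : OddInt × OddInt => ((q.1 : ℤ), (q.2 : ℤ)) := fun a b h => by
  simp only [Prod.mk.injEq] at h
  exact Prod.ext (Subtype.ext h.1) (Subtype.ext h.2)

/-- The weighted convolution matrix. -/
def convBeta (m : ℕ) {p : ℕ} (hp : 1 ≤ p) (v : ℤ → ℂ) (hv : Summable (convEntry m p v)) :
    L2 (OddInt × OddInt) :=
  ⟨fun q => v (q.1 - q.2) / (√(wt m p q.1) * √(wt m p q.2)), memL2_iff.mpr (by
    simp only [norm_weighted_entry_sq m hp]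
    exact hv.comp_injective prodMap_coe_injective)⟩

theorem norm_convBeta_sq_le (m : ℕ) {p : ℕ} (hp : 1 ≤ p) (v : ℤ → ℂ)
    (hv : Summable (convEntry m p v)) :
    ‖convBeta m hp v hv‖ ^ 2 ≤ ∑' q, convEntry m p v q := by
  rw [L2.norm_sq]
  change ∑' q : OddInt × OddInt, ‖v (q.1 - q.2) / (√(wt m p q.1) * √(wt m p q.2))‖ ^ 2 ≤ _
  simp only [norm_weighted_entry_sq m hp]
  refine tsum_comp_le_tsum_of_inj hv (fun q => ?_) prodMap_coe_injective
  have h1 := (wt_pos m hp q.1).le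
  have h2 := (wt_pos m hp q.2).le
  unfold convEntry
  positivity

/-- The block data of `T_α(v)` for a finite set `P` of odd integers and weights centered at `p`. -/
def convBlock (m : ℕ) {p : ℕ} (hp : 1 ≤ p) (v : ℤ → ℂ) (hv : Summable (convEntry m p v))
    (hsmall : ∑' q, convEntry m p v q ≤ (1 / 8) ^ 2) (P : Finset OddInt)
    (gl : ∀ k ∉ P, ∀ j ∈ P, wt m p k ≤ |level m (k : ℤ) - level m (j : ℤ)|)
    (gr : ∀ k ∉ P, ∀ j ∈ P, wt m p j ≤ |level m (k : ℤ) - level m (j : ℤ)|) :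
    BlockData OddInt where
  a k := level m (k : ℤ)
  ω k := wt m p k
  P := P
  β := convBeta m hp v hv
  ω_pos k := wt_pos m hp k
  gap_left := gl
  gap_right := gr
  norm_β_le := le_of_sq_le_sq ((norm_convBeta_sq_le m hp v hv).trans hsmall) (by norm_num)

/-- `D` represents the perturbation by the convolution with `v`, with weights centered at `p`. -/
structure Represents (D : BlockData OddInt) (m p : ℕ) (v : ℤ → ℂ) : Prop where
  a_eq : ∀ k : OddInt, D.a k = level m (k : ℤ)
  ω_eq : ∀ k : OddInt, D.ω k = wt m p k
  b_eq : ∀ k j : OddInt, D.b k j = v (k - j)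

theorem convBlock_represents (m : ℕ) {p : ℕ} (hp : 1 ≤ p) (v : ℤ → ℂ)
    (hv : Summable (convEntry m p v)) (hsmall : ∑' q, convEntry m p v q ≤ (1 / 8) ^ 2)
    (P : Finset OddInt)
    (gl : ∀ k ∉ P, ∀ j ∈ P, wt m p k ≤ |level m (k : ℤ) - level m (j : ℤ)|)
    (gr : ∀ k ∉ P, ∀ j ∈ P, wt m p j ≤ |level m (k : ℤ) - level m (j : ℤ)|) :
    Represents (convBlock m hp v hv hsmall P gl gr) m p v where
  a_eq _ := rfl
  ω_eq _ := rfl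
  b_eq k j := by
    have h1 := (convBlock m hp v hv hsmall P gl gr).sqrt_ne k
    have h2 := (convBlock m hp v hv hsmall P gl gr).sqrt_ne j
    change (√(wt m p k) : ℂ) * √(wt m p j) * (v (k - j) / (√(wt m p k) * √(wt m p j))) = _
    exact mul_div_cancel₀ _ (mul_ne_zero h1 h2)

namespace Represents

variable {m p : ℕ} {v : ℤ → ℂ} {D : BlockData OddInt}

theorem conv_apply (h : Represents D m p v) {u : ℤ → ℂ} (hu : ∀ k, u (2 * k) = 0) (k : OddInt) :
    conv v u k = ∑' i : OddInt, D.b k i * u i := by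
  unfold conv
  rw [tsum_odd]
  · simp only [h.b_eq]
  · intro i hi
    obtain ⟨j, hj⟩ := Int.not_odd_iff_even.mp hi
    rw [hj, ← two_mul, hu, mul_zero]

theorem conv_even {v u : ℤ → ℂ} (hv : ∀ k, v (2 * k + 1) = 0) (hu : ∀ k, u (2 * k) = 0) (k : ℤ) :
    conv v u (2 * k) = 0 := by
  have z : ∀ j, v (2 * k - j) * u j = 0 := by
    intro j
    rcases Int.even_or_odd' j with ⟨i, hi | hi⟩
    · rw [hi, hu i, mul_zero]
    · have : 2 * k - j = 2 * (k - i - 1) + 1 := by rw [hi]; ring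
      rw [this, hv, zero_mul]
  simp [conv, z]

theorem diag_apply (h : Represents D m p v) (u : ℤ → ℂ) (k : OddInt) :
    diag m u k = D.a k * u k := by
  rw [h.a_eq]
  unfold diag level
  push_cast
  rfl

/-- The sequence `∑_j Z · j x j`. -/
def embed (D : BlockData OddInt) (x : D.P → ℂ) : ℤ → ℂ :=
  extendOdd fun k => ∑ j : D.P, D.Z k j * x j

theorem embed_coe (x : D.P → ℂ) (k : OddInt) : embed D x k = ∑ j : D.P, D.Z k j * x j :=
  extendOdd_coe _ k

theorem embed_even (x : D.P → ℂ) (k : ℤ) : embed D x (2 * k) = 0 :=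
  extendOdd_of_not_odd _ (by simp)

theorem embed_mem_P (x : D.P → ℂ) (k : D.P) : embed D x (k : OddInt) = x k := by
  rw [embed_coe, Finset.sum_eq_single k]
  · rw [D.Z_of_mem k.2, if_pos rfl, one_mul]
  · intro j _ hj
    rw [D.Z_of_mem k.2, if_neg (fun h => hj (Subtype.ext h.symm)), zero_mul]
  · simp

theorem embed_mem (h : Represents D m p v) (hm : 1 ≤ m) (hp : 1 ≤ p) (x : D.P → ℂ) :
    embed D x ∈ hSpace m := by
  have e : embed D x = ∑ j : D.P, x j • extendOdd fun k => D.Z k j := by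
    funext k
    rw [Finset.sum_apply]
    by_cases hk : Odd k
    · simp [embed, extendOdd, hk, mul_comm]
    · simp [embed, extendOdd, hk]
  rw [e]
  refine Submodule.sum_mem _ fun j _ => Submodule.smul_mem _ _ (extendOdd_mem hm hp ?_)
  simpa only [h.ω_eq] using D.summable_Z j

/-- The matrix of the operator on the invariant subspace. -/
def blockMatrix (D : BlockData OddInt) : Matrix D.P D.P ℂ := Matrix.of fun i j => D.M i j

/-- At odd indices this is `BlockData.intertwine`, with the finite sum over P taken out of the
convolution. At even indices everything vanishes, since v vanishes at the odd integers. -/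
theorem diag_add_conv_embed (h : Represents D m p v) (hv : ∀ k, v (2 * k + 1) = 0) (x : D.P → ℂ) :
    diag m (embed D x) + conv v (embed D x) = embed D ((blockMatrix D).mulVec x) := by
  funext k
  by_cases hk : Odd k
  · obtain ⟨k, rfl⟩ : ∃ k' : OddInt, (k' : ℤ) = k := ⟨⟨k, hk⟩, rfl⟩
    rw [Pi.add_apply, h.diag_apply, h.conv_apply (embed_even x)]
    simp only [embed_coe, Finset.mul_sum]
    rw [Summable.tsum_finsetSum fun j _ => ?_, ← Finset.sum_add_distrib]
    · have e : ∀ j : D.P, D.a k * (D.Z k j * x j) + ∑' i, D.b k i * (D.Z i j * x j) =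
          ∑ i : D.P, D.Z k i * (D.M i j * x j) := by
        intro j
        simp only [← mul_assoc]
        rw [tsum_mul_right, ← add_mul, D.intertwine k j.2, Finset.sum_mul,
          ← Finset.sum_coe_sort D.P]
      rw [Finset.sum_congr rfl fun j _ => e j, Finset.sum_comm]
      refine Finset.sum_congr rfl fun i _ => ?_
      rw [← Finset.mul_sum]
      rfl
    · simp only [← mul_assoc]
      exact (D.summable_b_mul _ (D.summable_Z j) k).mul_right _
  · have h1 : embed D x k = 0 := extendOdd_of_not_odd _ hk
    have h2 : embed D ((blockMatrix D).mulVec x) k = 0 := extendOdd_of_not_odd _ hk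
    obtain ⟨i, hi⟩ := Int.not_odd_iff_even.mp hk
    rw [← two_mul] at hi
    rw [h2, Pi.add_apply, diag, h1, hi, conv_even hv (embed_even x), mul_zero, add_zero]

theorem summable_ω_mul (h : Represents D m p v) (hm : 1 ≤ m) (hp : 1 ≤ p) {u : ℤ → ℂ}
    (hu : u ∈ hSpace m) : Summable fun k : OddInt => D.ω k * ‖u k‖ ^ 2 := by
  simpa only [h.ω_eq] using summable_wt_mul hm hp hu

/-- A sequence whose image under `T - μ` lies in the invariant subspace lies there itself, if the
complementary block has no spectrum at `μ`. -/
theorem eq_embed (h : Represents D m p v) (hm : 1 ≤ m) (hp : 1 ≤ p)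
    (hv : ∀ k, v (2 * k + 1) = 0) {μ : ℂ}
    (hμ : ∀ k ∉ D.P, D.ω k ≤ ‖(D.a k : ℂ) - μ‖) {u : ℤ → ℂ} (hu : u ∈ hSpace m)
    (hu0 : ∀ k, u (2 * k) = 0) {x : D.P → ℂ} (hx : diag m u + conv v u - μ • u = embed D x) :
    u = embed D fun j => u (j : OddInt) := by
  set w := embed D fun j => u (j : OddInt) with hw
  have hwm : w ∈ hSpace m := h.embed_mem hm hp _
  have hw0 : ∀ k, w (2 * k) = 0 := embed_even _
  have su := h.summable_ω_mul hm hp hu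
  have sw := h.summable_ω_mul hm hp hwm
  have sy : Summable fun k : OddInt => D.ω k * ‖(u - w) k‖ ^ 2 :=
    h.summable_ω_mul hm hp ((hSpace m).sub_mem hu hwm)
  have hwT := h.diag_add_conv_embed hv (fun j => u (j : OddInt))
  rw [← hw] at hwT
  set x' : D.P → ℂ := (blockMatrix D).mulVec fun j => u (j : OddInt)
  -- The image of u - w under T - μ lies in the invariant subspace; its coefficients are still
  -- unknown.
  have key : ∀ k : OddInt, (D.a k - μ) * (u - w) k + ∑' i : OddInt, D.b k i * (u - w) i =
      ∑ j : D.P, D.Z k j * (x j - x' j + μ * u (j : OddInt)) := by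
    intro k
    have e1 := congrFun hx (k : ℤ)
    have e2 := congrFun hwT (k : ℤ)
    have e3 : w k = ∑ j : D.P, D.Z k j * u (j : OddInt) := embed_coe _ _
    simp only [Pi.add_apply, Pi.sub_apply, Pi.smul_apply, smul_eq_mul, h.diag_apply,
      h.conv_apply hu0, h.conv_apply hw0, embed_coe] at e1 e2
    have e4 : ∑' i : OddInt, D.b k i * (u - w) i =
        ∑' i : OddInt, D.b k i * u i - ∑' i : OddInt, D.b k i * w i := by
      rw [← (D.summable_b_mul (fun i : OddInt => u i) su k).tsum_sub
        (D.summable_b_mul (fun i : OddInt => w i) sw k)]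
      simp only [Pi.sub_apply, mul_sub]
    have e5 : ∑ j : D.P, D.Z k j * (x j - x' j + μ * u (j : OddInt)) =
        ∑ j : D.P, D.Z k j * x j - ∑ j : D.P, D.Z k j * x' j +
          μ * ∑ j : D.P, D.Z k j * u (j : OddInt) := by
      rw [Finset.mul_sum, ← Finset.sum_sub_distrib, ← Finset.sum_add_distrib]
      exact Finset.sum_congr rfl fun j _ => by ring
    rw [e4, e5, ← e3, Pi.sub_apply]
    linear_combination e1 - e2
  have hyP : ∀ k ∈ D.P, (u - w) (k : ℤ) = 0 := fun k hk => by
    have := embed_mem_P (D := D) (fun j => u (j : OddInt)) ⟨k, hk⟩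
    rw [Pi.sub_apply, hw, this, sub_self]
  -- Since u - w vanishes on P and `Z` is the identity there, row j of `key` identifies the j-th
  -- coefficient as ∑ b_{ji} (u - w)_i. This is the shape of the complementary equation.
  have hz := D.eq_zero_of_complement hμ (y := fun k : OddInt => (u - w) k) sy hyP (by
    intro k _
    rw [key k, ← Finset.sum_coe_sort D.P]
    refine Finset.sum_congr rfl fun j _ => ?_
    have e := key j
    rw [hyP j j.2, mul_zero, zero_add] at e
    rw [e, Finset.sum_eq_single j]
    · rw [D.Z_of_mem j.2, if_pos rfl, one_mul]
    · intro i _ hi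
      rw [D.Z_of_mem j.2, if_neg (fun h => hi (Subtype.ext h.symm)), zero_mul]
    · simp)
  have e1 := extendOdd_restrict (u := u - w) (fun k => by simp [hu0, hw0])
  rw [hz] at e1
  refine sub_eq_zero.mp (e1.symm.trans ?_)
  funext k
  simp [extendOdd]

/-- The resolvent condition on the complement is exactly what makes T - μ injective modulo the
invariant subspace, so the whole root space lives on the finite block. -/
theorem algMultiplicity_eq (h : Represents D m p v) (hm : 1 ≤ m) (hp : 1 ≤ p) {α : ℝ}
    (hα : α ∈ Set.Icc (0 : ℝ) 1) (hv : v ∈ hPlus (-(m * α))) {μ : ℂ}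
    (hμ : ∀ k ∉ D.P, D.ω k ≤ ‖(D.a k : ℂ) - μ‖) :
    algMultiplicity (operatorT m hm α hα v hv) μ = ((blockMatrix D).charpoly.roots.count μ : ℕ∞) := by
  have hm1 : (1 : ℝ) ≤ m := by exact_mod_cast hm
  have hs0 : 0 ≤ m * α := mul_nonneg (by linarith) hα.1
  have hsm : m * α ≤ m := by nlinarith [hα.2]
  have mem : ∀ x, embed D x ∈ hSpace m := h.embed_mem hm hp
  -- Bootstrap from h^m to the operator domain: invariance expresses A^m u as an element of the
  -- subspace minus v * u, both in h^{-mα}; then the diagonal part is inverted.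
  have dom : ∀ x, embed D x ∈ hSpace (m * (2 - α)) := by
    intro x
    have e1 := h.diag_add_conv_embed hv.2 x
    have e2 := conv_mem_of_one_le hs0 hsm hm1 hv.1 (mem x)
    have e3 : diag m (embed D x) ∈ hSpace (-(m * α)) := by
      rw [← eq_sub_iff_add_eq] at e1
      rw [e1]
      exact (hSpace _).sub_mem (hSpace_mono (by linarith) (mem _)) e2
    have e4 := mem_of_diag_mem (embed_even x) e3
    have e5 : -((m : ℝ) * α) + 2 * m = m * (2 - α) := by ring
    rwa [e5] at e4
  let Φ : (D.P → ℂ) →ₗ[ℂ] hMinus (-(m * α)) :=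
    { toFun := fun x => ⟨embed D x, hSpace_mono (by linarith) (mem x), embed_even x⟩
      map_add' := fun x y => by
        apply Subtype.ext
        funext k
        by_cases hk : Odd k
        · simp [embed, extendOdd, hk, mul_add, Finset.sum_add_distrib]
        · simp [embed, extendOdd, hk]
      map_smul' := fun c x => by
        apply Subtype.ext
        funext k
        by_cases hk : Odd k
        · simp [embed, extendOdd, hk, Finset.mul_sum, mul_left_comm]
        · simp [embed, extendOdd, hk] }
  have hΦ : ∀ x, (Φ x : ℤ → ℂ) = embed D x := fun _ => rfl
  have hinj : Function.Injective Φ := by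
    intro x y hxy
    funext j
    have e := congrFun (congrArg Subtype.val hxy) ((j : OddInt) : ℤ)
    rwa [hΦ, hΦ, embed_mem_P, embed_mem_P] at e
  rw [← Matrix.charpoly_toLin']
  refine algMultiplicity_eq_rootMultiplicity _ μ Φ hinj _ (fun x => ⟨dom x, embed_even x⟩)
    (fun x => ?_) ?_
  · apply Subtype.ext
    rw [hΦ, Matrix.toLin'_apply]
    exact h.diag_add_conv_embed hv.2 x
  · rintro ⟨u, hu⟩ ⟨x, hx⟩
    have hx' := (congrArg Subtype.val hx).symm
    have hum : (u : ℤ → ℂ) ∈ hSpace m :=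
      hSpace_mono (by nlinarith) (show (u : ℤ → ℂ) ∈ hSpace (m * (2 - α)) from hu.1)
    refine ⟨_, Subtype.ext (h.eq_embed hm hp hv.2 hμ hum u.2.2 (x := x) ?_).symm⟩
    exact hx'

/-- A Gershgorin type statement: each eigenvalue of the block lies in one of the open discs of
radius ω_k around a_k, k in P. -/
theorem not_mem_roots {D : BlockData OddInt} {μ : ℂ}
    (hμ : ∀ k ∈ D.P, D.ω k ≤ ‖(D.a k : ℂ) - μ‖) : μ ∉ (blockMatrix D).charpoly.roots := by
  intro hroot
  rw [Polynomial.mem_roots (Matrix.charpoly_monic _).ne_zero, ← Matrix.charpoly_toLin',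
    ← Module.End.hasEigenvalue_iff_isRoot_charpoly] at hroot
  obtain ⟨x, hx, hx0⟩ := hroot.exists_hasEigenvector
  rw [Module.End.mem_eigenspace_iff, Matrix.toLin'_apply] at hx
  have hz := D.eq_zero_of_block hμ (x := fun k => if h : k ∈ D.P then x ⟨k, h⟩ else 0) (by
    intro i hi
    have e := congrFun hx ⟨i, hi⟩
    rw [← Finset.sum_coe_sort D.P]
    simpa [Matrix.mulVec, dotProduct, blockMatrix, hi] using e)
  apply hx0
  funext k
  simpa using hz k k.2
end Represents

/-! ### Listing eigenvalues in lexicographic order -/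

theorem LexLE.re_le {z w : ℂ} (h : LexLE z w) : z.re ≤ w.re := by
  rcases h with h | h
  · exact h.le
  · exact h.1.le

/-- The spectrum is divided by vertical lines `Re = c i` into a left block `R 0` with `2 N`
eigenvalues, and blocks `R (i + 1)` with two eigenvalues each. -/
structure SpectralBlocks (mult : ℂ → ℕ∞) (N : ℕ) (c : ℕ → ℝ) (R : ℕ → Multiset ℂ) : Prop where
  mono : Monotone c
  unbounded : ∀ x : ℝ, ∃ i, x ≤ c i
  card_zero : (R 0).card = 2 * N
  card_succ : ∀ i, (R (i + 1)).card = 2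
  re_lt_zero : ∀ z ∈ R 0, z.re < c 0
  re_mem_succ : ∀ i, ∀ z ∈ R (i + 1), c i < z.re ∧ z.re < c (i + 1)
  mult_zero : ∀ μ : ℂ, μ.re ≤ c 0 → mult μ = (R 0).count μ
  mult_succ : ∀ i, ∀ μ : ℂ, c i ≤ μ.re → μ.re ≤ c (i + 1) → mult μ = (R (i + 1)).count μ

/-- The indices of the eigenvalues in a region with finitely many eigenvalues. -/
theorem exists_indices {mult : ℂ → ℕ∞} {lam : ℕ → ℂ}
    (hcount : ∀ μ : ℂ, {k : ℕ | 1 ≤ k ∧ lam k = μ}.encard = mult μ) (S : Set ℂ) (R : Multiset ℂ)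
    (hR : ∀ z ∈ R, z ∈ S) (hS : ∀ μ ∈ S, mult μ = R.count μ) :
    ∃ K : Finset ℕ, (∀ k, k ∈ K ↔ 1 ≤ k ∧ lam k ∈ S) ∧ K.val.map lam = R := by
  have h1 : ∀ k, 1 ≤ k → lam k ∈ S → lam k ∈ R := by
    intro k hk hkS
    rw [← Multiset.one_le_count_iff_mem]
    have h := hcount (lam k)
    rw [hS _ hkS] at h
    have h2 : (1 : ℕ∞) ≤ {j : ℕ | 1 ≤ j ∧ lam j = lam k}.encard := by
      rw [Set.one_le_encard_iff_nonempty]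
      exact ⟨k, hk, rfl⟩
    rw [h] at h2
    exact_mod_cast h2
  have hfin : ({k : ℕ | 1 ≤ k ∧ lam k ∈ S}).Finite := by
    have hsub : {k : ℕ | 1 ≤ k ∧ lam k ∈ S} ⊆
        ⋃ μ ∈ R.toFinset, {k : ℕ | 1 ≤ k ∧ lam k = μ} := by
      intro k hk
      simp only [Set.mem_iUnion]
      exact ⟨lam k, Multiset.mem_toFinset.mpr (h1 k hk.1 hk.2), hk.1, rfl⟩
    -- Each value occurs finitely often because its multiplicity in the region is the count in a
    -- multiset.
    refine Set.Finite.subset (Set.Finite.biUnion R.toFinset.finite_toSet fun μ hμ => ?_) hsub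
    rw [← Set.encard_lt_top_iff, hcount, hS μ (hR μ (Multiset.mem_toFinset.mp hμ))]
    exact ENat.natCast_lt_top _
  refine ⟨hfin.toFinset, fun k => by simp, ?_⟩
  ext μ
  rw [Multiset.count_map]
  by_cases hμ : μ ∈ S
  · have h := hcount μ
    rw [hS μ hμ] at h
    have e : {k : ℕ | 1 ≤ k ∧ lam k = μ} = ↑(hfin.toFinset.filter fun k => μ = lam k) := by
      ext k
      simp only [Set.mem_ofPred_eq, Finset.coe_filter, Set.Finite.mem_toFinset]
      constructor
      · rintro ⟨a, rfl⟩; exact ⟨⟨a, hμ⟩, rfl⟩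
      · rintro ⟨⟨a, -⟩, rfl⟩; exact ⟨a, rfl⟩
    rw [e, Set.encard_coe_eq_coe_finsetCard] at h
    exact_mod_cast h
  · rw [Multiset.count_eq_zero_of_notMem fun h => hμ (hR μ h), Multiset.card_eq_zero,
      Multiset.filter_eq_nil]
    rintro k hk rfl
    exact hμ (by simpa using (hfin.mem_toFinset.mp hk).2)

theorem eq_Icc_of_lower {K : Finset ℕ} {n : ℕ} (hn : K.card = n) (h0 : 0 ∉ K)
    (hlow : ∀ j k, 1 ≤ j → j ≤ k → k ∈ K → j ∈ K) : K = Finset.Icc 1 n := by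
  rcases K.eq_empty_or_nonempty with rfl | hne
  · simp at hn; subst hn; simp
  · have hM := K.max'_mem hne
    have e : K = Finset.Icc 1 (K.max' hne) := by
      ext k
      rw [Finset.mem_Icc]
      constructor
      · intro hk
        exact ⟨Nat.one_le_iff_ne_zero.mpr fun h => h0 (h ▸ hk), K.le_max' k hk⟩
      · rintro ⟨h1, h2⟩
        exact hlow k _ h1 h2 hM
    have hc := congrArg Finset.card e
    rw [hn, Nat.card_Icc] at hc
    have : K.max' hne = n := by omega
    rwa [this] at e

namespace SpectralBlocks

variable {mult : ℂ → ℕ∞} {N : ℕ} {c : ℕ → ℝ} {R : ℕ → Multiset ℂ}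

theorem left_indices (h : SpectralBlocks mult N c R) {lam : ℕ → ℂ}
    (hcount : ∀ μ : ℂ, {k : ℕ | 1 ≤ k ∧ lam k = μ}.encard = mult μ)
    (hlex : ∀ j k : ℕ, 1 ≤ j → j ≤ k → LexLE (lam j) (lam k)) :
    (Finset.Icc 1 (2 * N)).val.map lam = R 0 ∧
      ∀ k, k ∈ Finset.Icc 1 (2 * N) ↔ 1 ≤ k ∧ (lam k).re ≤ c 0 := by
  obtain ⟨K, hK, hKR⟩ := exists_indices hcount {z | z.re ≤ c 0} (R 0)
    (fun z hz => (h.re_lt_zero z hz).le) h.mult_zero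
  have hcard : K.card = 2 * N := by
    rw [← h.card_zero, ← hKR, Multiset.card_map]; rfl
  have e := eq_Icc_of_lower hcard (fun h0 => by simpa using ((hK 0).mp h0).1)
    (fun j k hj hjk hk => (hK j).mpr ⟨hj, (hlex j k hj hjk).re_le.trans ((hK k).mp hk).2⟩)
  rw [e] at hKR hK
  exact ⟨hKR, hK⟩

/-- Lexicographic order makes the indices with Re λ ≤ c_i an initial segment, and its length is the
number of eigenvalues to the left of the line. So the two eigenvalues of block i + 1 occupy the next
two indices. Their order is immaterial, since only the sum is used. -/
theorem block_indices (h : SpectralBlocks mult N c R) {lam : ℕ → ℂ}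
    (hcount : ∀ μ : ℂ, {k : ℕ | 1 ≤ k ∧ lam k = μ}.encard = mult μ)
    (hlex : ∀ j k : ℕ, 1 ≤ j → j ≤ k → LexLE (lam j) (lam k)) (i : ℕ) :
    (∀ k, k ∈ Finset.Icc 1 (2 * (N + i)) ↔ 1 ≤ k ∧ (lam k).re ≤ c i) ∧
    (lam (2 * (N + i) + 1) + lam (2 * (N + i) + 2) = (R (i + 1)).sum) := by
  have step : ∀ i, (∀ k, k ∈ Finset.Icc 1 (2 * (N + i)) ↔ 1 ≤ k ∧ (lam k).re ≤ c i) →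
      (∀ k, k ∈ Finset.Icc 1 (2 * (N + (i + 1))) ↔ 1 ≤ k ∧ (lam k).re ≤ c (i + 1)) ∧
      (lam (2 * (N + i) + 1) + lam (2 * (N + i) + 2) = (R (i + 1)).sum) := by
    intro i ih
    obtain ⟨K, hK, hKR⟩ := exists_indices hcount {z | c i < z.re ∧ z.re ≤ c (i + 1)} (R (i + 1))
      (fun z hz => ⟨(h.re_mem_succ i z hz).1, (h.re_mem_succ i z hz).2.le⟩)
      (fun μ hμ => h.mult_succ i μ hμ.1.le hμ.2)
    have hcard : K.card = 2 := by
      rw [← h.card_succ i, ← hKR, Multiset.card_map]; rfl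
    have hU : ∀ k, k ∈ Finset.Icc 1 (2 * (N + i)) ∪ K ↔ 1 ≤ k ∧ (lam k).re ≤ c (i + 1) := by
      intro k
      rw [Finset.mem_union, ih, hK]
      constructor
      · rintro (⟨h1, h2⟩ | ⟨h1, h2⟩)
        · exact ⟨h1, h2.trans (h.mono (Nat.le_succ i))⟩
        · exact ⟨h1, h2.2⟩
      · rintro ⟨h1, h2⟩
        rcases le_or_gt (lam k).re (c i) with h3 | h3
        · exact Or.inl ⟨h1, h3⟩
        · exact Or.inr ⟨h1, h3, h2⟩
    have hdisj : Disjoint (Finset.Icc 1 (2 * (N + i))) K := by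
      rw [Finset.disjoint_left]
      intro k hk hk2
      exact absurd ((ih k).mp hk).2 (not_le.mpr ((hK k).mp hk2).2.1)
    have hUcard : (Finset.Icc 1 (2 * (N + i)) ∪ K).card = 2 * (N + (i + 1)) := by
      rw [Finset.card_union_of_disjoint hdisj, hcard, Nat.card_Icc]; omega
    have e := eq_Icc_of_lower hUcard (fun h0 => by simpa using ((hU 0).mp h0).1)
      (fun j k hj hjk hk => (hU j).mpr ⟨hj, (hlex j k hj hjk).re_le.trans ((hU k).mp hk).2⟩)
    refine ⟨by rw [← e]; exact hU, ?_⟩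
    have hK2 : K = {2 * (N + i) + 1, 2 * (N + i) + 2} := by
      have h1 : K = Finset.Icc 1 (2 * (N + (i + 1))) \ Finset.Icc 1 (2 * (N + i)) := by
        rw [← e, Finset.union_sdiff_cancel_left hdisj]
      rw [h1]
      ext k
      simp only [Finset.mem_sdiff, Finset.mem_Icc, Finset.mem_insert, Finset.mem_singleton]
      omega
    have hs : ∑ k ∈ K, lam k = (R (i + 1)).sum := by rw [← hKR]; rfl
    rw [← hs, hK2, Finset.sum_pair (by omega)]
  have all : ∀ i, ∀ k, k ∈ Finset.Icc 1 (2 * (N + i)) ↔ 1 ≤ k ∧ (lam k).re ≤ c i := by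
    intro i
    induction i with
    | zero => exact (h.left_indices hcount hlex).2
    | succ i ih => exact (step i ih).1
  exact ⟨all i, (step i (all i)).2⟩

theorem exists_sorted (S : Multiset ℂ) : ∃ l : List ℂ, (l : Multiset ℂ) = S ∧ l.Pairwise LexLE := by
  classical
  have : IsTrans ℂ LexLE := ⟨fun a b c h1 h2 => by
    unfold LexLE at *
    rcases h1 with h1 | h1 <;> rcases h2 with h2 | h2
    · exact Or.inl (h1.trans h2)
    · exact Or.inl (h2.1 ▸ h1)
    · exact Or.inl (h1.1 ▸ h2)
    · exact Or.inr ⟨h1.1.trans h2.1, h1.2.trans h2.2⟩⟩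
  have : Std.Antisymm LexLE := ⟨fun a b h1 h2 => by
    unfold LexLE at *
    rcases h1 with h1 | h1 <;> rcases h2 with h2 | h2
    · linarith
    · linarith [h2.1]
    · linarith [h1.1]
    · exact Complex.ext h1.1 (le_antisymm h1.2 h2.2)⟩
  have : Std.Total LexLE := ⟨fun a b => by
    unfold LexLE
    rcases lt_trichotomy a.re b.re with h | h | h
    · exact Or.inl (Or.inl h)
    · rcases le_total a.im b.im with h2 | h2
      · exact Or.inl (Or.inr ⟨h, h2⟩)
      · exact Or.inr (Or.inr ⟨h.symm, h2⟩)
    · exact Or.inr (Or.inl h)⟩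
  exact ⟨S.sort LexLE, S.sort_eq LexLE, S.pairwise_sort LexLE⟩

/-- The concatenation of lists `l 0 ++ ⋯ ++ l i`. -/
def accumulate (l : ℕ → List ℂ) : ℕ → List ℂ
  | 0 => l 0
  | i + 1 => accumulate l i ++ l (i + 1)

theorem accumulate_prefix (l : ℕ → List ℂ) {i j : ℕ} (hij : i ≤ j) :
    accumulate l i <+: accumulate l j := by
  induction hij with
  | refl => exact List.prefix_rfl
  | step _ ih => exact ih.trans (List.prefix_append _ _)

theorem encard_indices (l : List ℂ) (μ : ℂ) :
    {k : ℕ | 1 ≤ k ∧ k ≤ l.length ∧ l.getD (k - 1) 0 = μ}.encard = l.count μ := by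
  have hl : (Finset.range l.length).val.map (fun k => l.getD k 0) = (l : Multiset ℂ) := by
    rw [Finset.range_val, Multiset.range, Multiset.map_coe, Multiset.coe_eq_coe]
    refine List.Perm.of_eq (List.ext_getElem (by simp) fun k h1 h2 => ?_)
    simp at h1
    simp [h1]
  have e : {k : ℕ | 1 ≤ k ∧ k ≤ l.length ∧ l.getD (k - 1) 0 = μ} = (fun k => k + 1) ''
      ((Finset.range l.length).filter fun k => μ = l.getD k 0 : Finset ℕ) := by
    ext k
    simp only [Set.mem_ofPred_eq, Set.mem_image, Finset.coe_filter, Finset.mem_range]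
    constructor
    · rintro ⟨h1, h2, h3⟩
      exact ⟨k - 1, ⟨by omega, h3.symm⟩, by omega⟩
    · rintro ⟨j, ⟨h1, h2⟩, rfl⟩
      exact ⟨by omega, by omega, h2.symm⟩
  rw [e, (add_left_injective 1).encard_image, Set.encard_coe_eq_coe_finsetCard,
    ← Multiset.coe_count, ← hl, Multiset.count_map]
  rfl

/-- Each block is sorted and the lists are concatenated; the dividing lines make the concatenation
sorted, and their unboundedness ensures that every eigenvalue appears. -/
theorem exists_sequence (h : SpectralBlocks mult N c R) :
    ∃ lam : ℕ → ℂ, (∀ j k : ℕ, 1 ≤ j → j ≤ k → LexLE (lam j) (lam k)) ∧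
      ∀ μ : ℂ, {k : ℕ | 1 ≤ k ∧ lam k = μ}.encard = mult μ := by
  choose l hl hsort using fun i => exists_sorted (R i)
  set A := accumulate l with hA
  have hmem : ∀ i z, z ∈ l i ↔ z ∈ R i := fun i z => by rw [← hl i, Multiset.mem_coe]
  have hlen : ∀ i, (A i).length = 2 * (N + i) := by
    intro i
    induction i with
    | zero => rw [Nat.add_zero, ← h.card_zero, ← hl 0]; rfl
    | succ i ih =>
      have e : (l (i + 1)).length = 2 := by rw [← h.card_succ i, ← hl (i + 1)]; rfl
      rw [hA, accumulate, List.length_append, ← hA, ih, e]; omega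
  have hre : ∀ i, ∀ z ∈ A i, z.re < c i := by
    intro i
    induction i with
    | zero => exact fun z hz => h.re_lt_zero z ((hmem 0 z).mp hz)
    | succ i ih =>
      intro z hz
      rcases List.mem_append.mp hz with h1 | h1
      · exact (ih z h1).trans_le (h.mono (Nat.le_succ i))
      · exact (h.re_mem_succ i z ((hmem _ z).mp h1)).2
  have hpw : ∀ i, (A i).Pairwise LexLE := by
    intro i
    induction i with
    | zero => exact hsort 0
    | succ i ih =>
      refine List.pairwise_append.mpr ⟨ih, hsort _, fun a ha b hb => Or.inl ?_⟩
      exact (hre i a ha).trans (h.re_mem_succ i b ((hmem _ b).mp hb)).1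
  have hcnt : ∀ i, ∀ μ : ℂ, μ.re ≤ c i → mult μ = ((A i).count μ : ℕ) := by
    intro i
    induction i with
    | zero =>
      intro μ hμ
      rw [h.mult_zero μ hμ, ← hl 0, Multiset.coe_count]; rfl
    | succ i ih =>
      intro μ hμ
      rw [hA, accumulate, List.count_append, ← hA]
      rcases le_or_gt μ.re (c i) with h1 | h1
      · have h0 : (l (i + 1)).count μ = 0 := List.count_eq_zero.mpr fun h2 =>
          absurd h1 (not_le.mpr (h.re_mem_succ i μ ((hmem _ μ).mp h2)).1)
        rw [ih μ h1, h0, add_zero]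
      · have h0 : (A i).count μ = 0 := List.count_eq_zero.mpr fun h2 =>
          absurd (hre i μ h2) (not_lt.mpr h1.le)
        rw [h.mult_succ i μ h1.le hμ, h0, zero_add, ← hl (i + 1), Multiset.coe_count]
  -- The k-th list has length 2(N + k) ≥ k, so for k ≥ 1 the default value is never reached; by the
  -- prefix property any longer list gives the same entry.
  set lam : ℕ → ℂ := fun k => (A k).getD (k - 1) 0 with hlam
  have hlam_eq : ∀ i k, 1 ≤ k → k ≤ (A i).length → lam k = (A i).getD (k - 1) 0 := by
    intro i k hk hki
    have hk2 : k ≤ (A k).length := by rw [hlen]; omega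
    rw [hlam]
    simp only
    rw [List.getD_eq_getElem _ _ (by omega : k - 1 < (A k).length),
      List.getD_eq_getElem _ _ (by omega : k - 1 < (A i).length)]
    rcases le_total i k with hik | hik
    · exact ((accumulate_prefix l hik).getElem (show k - 1 < (A i).length by omega)).symm
    · exact (accumulate_prefix l hik).getElem (show k - 1 < (A k).length by omega)
  -- Entries beyond the first i + 1 blocks lie strictly to the right of the line c_i, so a value
  -- with real part at most c_i occurs only within the first i + 1 blocks.
  have hbig : ∀ i j k, (A i).length < k → k ≤ (A (i + j)).length → c i < (lam k).re := by
    intro i j k hk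
    induction j with
    | zero => intro h1; exact absurd hk (not_lt.mpr h1)
    | succ j ih =>
      intro h1
      rcases le_or_gt k (A (i + j)).length with h2 | h2
      · exact ih h2
      · have e : lam k = (A (i + j) ++ l (i + j + 1)).getD (k - 1) 0 :=
          hlam_eq (i + (j + 1)) k (by omega) h1
        have h3 : k - 1 - (A (i + j)).length < (l (i + j + 1)).length := by
          have h4 : (A (i + (j + 1))).length = (A (i + j)).length + (l (i + j + 1)).length :=
            List.length_append
          omega
        rw [List.getD_append_right _ _ _ _ (by omega), List.getD_eq_getElem _ _ h3] at e
        have hz := h.re_mem_succ (i + j) (lam k) ((hmem _ _).mp (e ▸ List.getElem_mem h3))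
        exact (h.mono (Nat.le_add_right i j)).trans_lt hz.1
  refine ⟨lam, fun j k hj hjk => ?_, fun μ => ?_⟩
  · have hk2 : k ≤ (A k).length := by rw [hlen]; omega
    rw [hlam_eq k j hj (hjk.trans hk2), hlam_eq k k (hj.trans hjk) hk2,
      List.getD_eq_getElem _ _ (by omega : j - 1 < (A k).length),
      List.getD_eq_getElem _ _ (by omega : k - 1 < (A k).length)]
    rcases hjk.eq_or_lt with rfl | hlt
    · exact Or.inr ⟨rfl, le_rfl⟩
    · exact List.pairwise_iff_getElem.mp (hpw k) _ _ _ _ (by omega)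
  · obtain ⟨i, hi⟩ := h.unbounded μ.re
    rw [hcnt i μ hi, ← encard_indices]
    congr 1
    ext k
    constructor
    · rintro ⟨h1, h2⟩
      have hki : k ≤ (A i).length := by
        by_contra hcon
        have := hbig i k k (by omega) (by rw [hlen]; omega)
        rw [h2] at this
        linarith
      exact ⟨h1, hki, by rw [← hlam_eq i k h1 hki, h2]⟩
    · rintro ⟨h1, h2, h3⟩
      exact ⟨h1, by rw [hlam_eq i k h1 h2, h3]⟩

end SpectralBlocks

/-! ### The left block and the two-dimensional blocks -/

theorem level_mono (m : ℕ) {x y : ℝ} (h : |x| ≤ |y|) : level m x ≤ level m y := by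
  rw [← level_abs m x, ← level_abs m y]
  unfold level
  gcongr

theorem le_norm_sub_of_re_le {a b c : ℝ} {μ : ℂ} (hμ : μ.re ≤ b) (hab : b ≤ a)
    (h : c ≤ |a - b|) : c ≤ ‖(a : ℂ) - μ‖ := by
  have h1 := Complex.abs_re_le_norm ((a : ℂ) - μ)
  rw [Complex.sub_re, Complex.ofReal_re] at h1
  rw [abs_of_nonneg (by linarith)] at h
  linarith [le_abs_self (a - μ.re)]

theorem le_norm_sub_of_le_re {a b c : ℝ} {μ : ℂ} (hμ : b ≤ μ.re) (hab : a ≤ b)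
    (h : c ≤ |a - b|) : c ≤ ‖(a : ℂ) - μ‖ := by
  have h1 := Complex.abs_re_le_norm ((a : ℂ) - μ)
  rw [Complex.sub_re, Complex.ofReal_re] at h1
  rw [abs_of_nonpos (by linarith)] at h
  linarith [neg_abs_le (a - μ.re)]

theorem card_roots_blockMatrix (D : BlockData OddInt) :
    (Represents.blockMatrix D).charpoly.roots.card = D.P.card := by
  rw [IsAlgClosed.card_roots_eq_natDegree, Matrix.charpoly_natDegree_eq_dim, Fintype.card_coe]

/-- The odd integers in `(-p, p)`. -/
def leftSet (p : ℕ) : Finset OddInt := (Finset.Ioo (-(p : ℤ)) p).subtype Odd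

theorem mem_leftSet {p : ℕ} {k : OddInt} : k ∈ leftSet p ↔ |(k : ℤ)| < p := by
  rw [leftSet, Finset.mem_subtype, Finset.mem_Ioo, abs_lt]

theorem card_leftSet (N : ℕ) : (leftSet (2 * N)).card = 2 * N := by
  rw [leftSet, Finset.card_subtype]
  have e : (Finset.Ioo (-((2 * N : ℕ) : ℤ)) ((2 * N : ℕ) : ℤ)).filter Odd =
      (Finset.range (2 * N)).image fun i : ℕ => 2 * (i : ℤ) - 2 * N + 1 := by
    ext k
    simp only [Finset.mem_filter, Finset.mem_Ioo, Finset.mem_image, Finset.mem_range]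
    constructor
    · rintro ⟨⟨h1, h2⟩, ⟨j, hj⟩⟩
      exact ⟨(j + N).toNat, by omega, by omega⟩
    · rintro ⟨i, hi, rfl⟩
      exact ⟨⟨by push_cast; omega, by push_cast; omega⟩, ⟨(i : ℤ) - N, by ring⟩⟩
  rw [e, Finset.card_image_of_injective, Finset.card_range]
  intro a b h
  simp only at h
  omega

/-- The odd integers `k` with `|k| = p`. -/
def pairSet (p : ℕ) : Finset OddInt := ({(p : ℤ), -(p : ℤ)} : Finset ℤ).subtype Odd

theorem mem_pairSet {p : ℕ} {k : OddInt} : k ∈ pairSet p ↔ |(k : ℤ)| = p := by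
  rw [pairSet, Finset.mem_subtype, Finset.mem_insert, Finset.mem_singleton,
    abs_eq (by positivity)]

theorem pairSet_eq {p : ℕ} (hp : Odd (p : ℤ)) :
    pairSet p = {⟨(p : ℤ), hp⟩, ⟨-(p : ℤ), hp.neg⟩} := by
  ext k
  simp [pairSet, Subtype.ext_iff]

theorem card_pairSet {p : ℕ} (hp : Odd (p : ℤ)) : (pairSet p).card = 2 := by
  rw [pairSet_eq hp, Finset.card_pair]
  intro h
  have := congrArg Subtype.val h
  simp only at this
  obtain ⟨j, hj⟩ := hp
  omega

theorem abs_cast_le {p : ℕ} {k : ℤ} (h : |k| + 1 ≤ p) : |(k : ℝ)| + 1 ≤ p := by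
  exact_mod_cast h

theorem le_abs_cast {p : ℕ} {k : ℤ} (h : (p : ℤ) + 1 ≤ |k|) : (p : ℝ) + 1 ≤ |(k : ℝ)| := by
  exact_mod_cast h

section Left

variable {m N : ℕ}

/-- The center 2N is even and k is odd, so the truncation in `sdist` is inactive. The level of 2N
serves as the dividing line, and the gap to it is bounded below from both sides. -/
theorem wt_le_left (hm : 1 ≤ m) (N : ℕ) (k : OddInt) :
    wt m (2 * N) k ≤ |level m (k : ℤ) - level m (2 * N : ℕ)| := by
  have hN : (0 : ℝ) ≤ (2 * N : ℕ) := Nat.cast_nonneg _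
  have hk : 1 ≤ |(|((k : ℤ) : ℝ)| - (2 * N : ℕ))| := by
    have h : (1 : ℤ) ≤ |(|(k : ℤ)| - (2 * N : ℕ))| := by
      refine Int.one_le_abs ?_
      obtain ⟨j, hj⟩ := k.2
      rcases abs_cases (k : ℤ) with h1 | h1 <;> omega
    exact_mod_cast h
  refine wt_le_level hm hN ?_ ?_
  · rw [sdist, max_eq_right hk]
    linarith
  · have h1 := le_max_left |((k : ℤ) : ℝ)| ((2 * N : ℕ) : ℝ)
    have h2 := le_max_right |((k : ℤ) : ℝ)| ((2 * N : ℕ) : ℝ)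
    have h3 := abs_nonneg ((k : ℤ) : ℝ)
    linarith

theorem level_le_of_mem_left {k : OddInt} (hk : k ∈ leftSet (2 * N)) :
    level m (k : ℤ) ≤ level m (2 * N : ℕ) := by
  rw [mem_leftSet] at hk
  refine level_mono m ?_
  rw [abs_of_nonneg (Nat.cast_nonneg (2 * N) : (0 : ℝ) ≤ _)]
  have : |(k : ℤ)| ≤ ((2 * N : ℕ) : ℤ) := hk.le
  exact_mod_cast this

theorem level_ge_of_notMem_left {k : OddInt} (hk : k ∉ leftSet (2 * N)) :
    level m (2 * N : ℕ) ≤ level m (k : ℤ) := by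
  rw [mem_leftSet, not_lt] at hk
  refine level_mono m ?_
  rw [abs_of_nonneg (Nat.cast_nonneg (2 * N) : (0 : ℝ) ≤ _)]
  exact_mod_cast hk

theorem left_gap (hm : 1 ≤ m) {k j : OddInt} (hk : k ∉ leftSet (2 * N))
    (hj : j ∈ leftSet (2 * N)) :
    wt m (2 * N) k ≤ |level m (k : ℤ) - level m (j : ℤ)| ∧
      wt m (2 * N) j ≤ |level m (k : ℤ) - level m (j : ℤ)| := by
  have h1 := wt_le_left hm N k
  have h2 := wt_le_left hm N j
  have h3 := level_le_of_mem_left (m := m) hj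
  have h4 := level_ge_of_notMem_left (m := m) hk
  rw [abs_of_nonneg (by linarith)] at h1
  rw [abs_of_nonpos (by linarith)] at h2
  rw [abs_of_nonneg (by linarith)]
  constructor <;> linarith

end Left

section Pair

variable {m p : ℕ}

/-- By parity ||k| - p| ≥ 2, so moving the reference point from p to any y within distance 1 costs
at most a factor 2. With y = p this gives the block separation, with y = p ± 1 the resolvent bound
between the dividing lines. -/
theorem wt_le_pair (hm : 1 ≤ m) (hodd : Odd (p : ℤ)) {k : OddInt}
    (hk : k ∉ pairSet p) {y : ℝ} (hy : 0 ≤ y) (hyp : |p - y| ≤ 1) :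
    wt m p k ≤ |level m (k : ℤ) - level m y| := by
  rw [mem_pairSet] at hk
  have h2 : 2 ≤ |(|((k : ℤ) : ℝ)| - p)| := by
    have h : (2 : ℤ) ≤ |(|(k : ℤ)| - p)| := by
      obtain ⟨j, hj⟩ := k.2
      obtain ⟨i, hi⟩ := hodd
      rcases abs_cases (k : ℤ) with h1 | h1 <;>
        rcases abs_cases (|(k : ℤ)| - p) with h2 | h2 <;> omega
    exact_mod_cast h
  have h1 : 1 ≤ |((k : ℤ) : ℝ)| := by
    have h : (1 : ℤ) ≤ |(k : ℤ)| := Int.one_le_abs (by obtain ⟨j, hj⟩ := k.2; omega)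
    exact_mod_cast h
  refine wt_le_level hm hy ?_ ?_
  · rw [sdist, max_eq_right (by linarith)]
    have := abs_sub_le |((k : ℤ) : ℝ)| y p
    rw [abs_sub_comm y] at this
    linarith
  · have h1 := le_max_left |((k : ℤ) : ℝ)| y
    have h2 := le_max_right |((k : ℤ) : ℝ)| y
    linarith [(abs_le.mp hyp).2]

theorem wt_le_of_mem_pair (hm : 1 ≤ m) {k : OddInt} (hk : k ∈ pairSet p) {y : ℝ} (hy : 0 ≤ y)
    (hyp : 1 ≤ |p - y|) : wt m p k ≤ |level m (k : ℤ) - level m y| := by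
  rw [mem_pairSet] at hk
  have hk' : |((k : ℤ) : ℝ)| = p := by exact_mod_cast hk
  refine wt_le_level hm hy ?_ ?_
  · rw [sdist, hk', sub_self, abs_zero, max_eq_left zero_le_one]
    linarith
  · have h1 := le_max_left |((k : ℤ) : ℝ)| y
    rw [hk'] at h1 ⊢
    linarith [(Nat.cast_nonneg p : (0 : ℝ) ≤ p)]

theorem level_of_mem_pair {k : OddInt} (hk : k ∈ pairSet p) : level m (k : ℤ) = level m p := by
  rw [mem_pairSet] at hk
  have hk' : |((k : ℤ) : ℝ)| = p := by exact_mod_cast hk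
  rw [← level_abs m ((k : ℤ) : ℝ), hk']

theorem pair_gap (hm : 1 ≤ m) (hodd : Odd (p : ℤ)) {k j : OddInt}
    (hk : k ∉ pairSet p) (hj : j ∈ pairSet p) :
    wt m p k ≤ |level m (k : ℤ) - level m (j : ℤ)| ∧
      wt m p j ≤ |level m (k : ℤ) - level m (j : ℤ)| := by
  constructor
  · rw [level_of_mem_pair hj]
    exact wt_le_pair hm hodd hk (Nat.cast_nonneg p) (by simp)
  · rw [abs_sub_comm, ← level_abs m ((k : ℤ) : ℝ)]
    refine wt_le_of_mem_pair hm hj (abs_nonneg _) ?_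
    rw [mem_pairSet] at hk
    have h : (1 : ℤ) ≤ |(p - |(k : ℤ)|)| := Int.one_le_abs (by omega)
    exact_mod_cast h

/-- In the strip between the levels of p - 1 and p + 1 the real part of μ is separated from every
outside level by the nearer of the two lines. -/
theorem pair_resolvent (hm : 1 ≤ m) (hp : 1 ≤ p) (hodd : Odd (p : ℤ)) {μ : ℂ}
    (h1 : level m (p - 1) ≤ μ.re) (h2 : μ.re ≤ level m (p + 1)) {k : OddInt}
    (hk : k ∉ pairSet p) : wt m p k ≤ ‖((level m (k : ℤ) : ℝ) : ℂ) - μ‖ := by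
  have hp' : (1 : ℝ) ≤ p := by exact_mod_cast hp
  have hk' := hk
  rw [mem_pairSet] at hk'
  rcases lt_or_gt_of_ne hk' with h | h
  · refine le_norm_sub_of_le_re h1 ?_ (wt_le_pair hm hodd hk (by linarith) (by simp))
    refine level_mono m ?_
    rw [abs_of_nonneg (by linarith : (0 : ℝ) ≤ p - 1)]
    linarith [abs_cast_le (Int.add_one_le_iff.mpr h)]
  · refine le_norm_sub_of_re_le h2 ?_ (wt_le_pair hm hodd hk (by linarith) (by simp))
    refine level_mono m ?_
    rw [abs_of_nonneg (by linarith : (0 : ℝ) ≤ p + 1)]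
    exact le_abs_cast (Int.add_one_le_iff.mpr h)

/-- On and outside the two dividing lines μ avoids the Gershgorin discs around the level of p, whose
radius is the weight; hence the roots of the pair block lie strictly inside the strip. -/
theorem pair_not_root (hm : 1 ≤ m) (hp : 1 ≤ p) {μ : ℂ}
    (h : μ.re ≤ level m (p - 1) ∨ level m (p + 1) ≤ μ.re) {k : OddInt}
    (hk : k ∈ pairSet p) : wt m p k ≤ ‖((level m (k : ℤ) : ℝ) : ℂ) - μ‖ := by
  have hp' : (1 : ℝ) ≤ p := by exact_mod_cast hp
  rcases h with h | h
  · refine le_norm_sub_of_re_le h ?_ (wt_le_of_mem_pair hm hk (by linarith) (by simp))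
    rw [level_of_mem_pair hk]
    refine level_mono m ?_
    rw [abs_of_nonneg (by linarith : (0 : ℝ) ≤ p - 1), abs_of_nonneg (by linarith : (0 : ℝ) ≤ p)]
    linarith
  · refine le_norm_sub_of_le_re h ?_ (wt_le_of_mem_pair hm hk (by linarith) (by simp))
    rw [level_of_mem_pair hk]
    refine level_mono m ?_
    rw [abs_of_nonneg (by linarith : (0 : ℝ) ≤ p + 1), abs_of_nonneg (by linarith : (0 : ℝ) ≤ p)]
    linarith

end Pair

/-- The block data of the left block. -/
def leftBlock {m : ℕ} (hm : 1 ≤ m) {N : ℕ} (hN : 1 ≤ 2 * N) (v : ℤ → ℂ)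
    (hv : Summable (convEntry m (2 * N) v))
    (hsmall : ∑' q, convEntry m (2 * N) v q ≤ (1 / 8) ^ 2) : BlockData OddInt :=
  convBlock m hN v hv hsmall (leftSet (2 * N)) (fun _ hk _ hj => (left_gap hm hk hj).1)
    (fun _ hk _ hj => (left_gap hm hk hj).2)

/-- The block data of the block at `±p`. -/
def pairBlock {m : ℕ} (hm : 1 ≤ m) {p : ℕ} (hp : 1 ≤ p) (hodd : Odd (p : ℤ)) (v : ℤ → ℂ)
    (hv : Summable (convEntry m p v))
    (hsmall : ∑' q, convEntry m p v q ≤ (1 / 8) ^ 2) : BlockData OddInt :=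
  convBlock m hp v hv hsmall (pairSet p) (fun _ hk _ hj => (pair_gap hm hodd hk hj).1)
    (fun _ hk _ hj => (pair_gap hm hodd hk hj).2)

/-- The eigenvalues of the block at `±p`. -/
def pairRoots {m : ℕ} (hm : 1 ≤ m) {p : ℕ} (hp : 1 ≤ p) (hodd : Odd (p : ℤ)) (v : ℤ → ℂ)
    (hv : Summable (convEntry m p v))
    (hsmall : ∑' q, convEntry m p v q ≤ (1 / 8) ^ 2) : Multiset ℂ :=
  (Represents.blockMatrix (pairBlock hm hp hodd v hv hsmall)).charpoly.roots

/-- The second order term of the mean of the eigenvalues at `±p`. -/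
def secondOrder (m p : ℕ) (v : ℤ → ℂ) : ℂ :=
  ∑' q : OddInt, if |(q : ℤ)| = p then 0 else
    v (p - q) * v (q - p) / ((level m (q : ℤ) : ℝ) - (level m p : ℝ))

section PairRoots

variable {m : ℕ} (hm : 1 ≤ m) {p : ℕ} (hp : 1 ≤ p) (hodd : Odd (p : ℤ)) {v : ℤ → ℂ}
    (hv : Summable (convEntry m p v)) (hsmall : ∑' q, convEntry m p v q ≤ (1 / 8) ^ 2)

/-- The sum of the roots is the trace; the off-diagonal entries of the 2×2 block do not enter. -/
theorem sum_pairRoots : (pairRoots hm hp hodd v hv hsmall).sum =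
    (pairBlock hm hp hodd v hv hsmall).M ⟨p, hodd⟩ ⟨p, hodd⟩ +
    (pairBlock hm hp hodd v hv hsmall).M ⟨-p, hodd.neg⟩ ⟨-p, hodd.neg⟩ := by
  set D := pairBlock hm hp hodd v hv hsmall with hD
  have hP : D.P = {⟨p, hodd⟩, ⟨-p, hodd.neg⟩} := pairSet_eq hodd
  rw [pairRoots, ← Matrix.trace_eq_sum_roots_charpoly_of_splits (IsAlgClosed.splits _),
    Matrix.trace]
  change ∑ j : D.P, D.M j j = _
  rw [Finset.sum_coe_sort D.P fun j => D.M j j, hP, Finset.sum_pair]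
  intro h
  have := congrArg Subtype.val h
  simp only at this
  omega

/-- The first order terms on the diagonal are v(0) = 0, and both diagonal entries carry the same
level and weight. -/
theorem norm_sum_pairRoots_sub_le (hv0 : v 0 = 0) :
    ‖(pairRoots hm hp hodd v hv hsmall).sum - 2 * (level m p : ℝ)‖ ≤
      4 * wt m p p * ∑' q, convEntry m p v q := by
  set D := pairBlock hm hp hodd v hv hsmall with hD
  have hrep : Represents D m p v := convBlock_represents m hp v hv hsmall _ _ _
  have hq : ‖D.β‖ ^ 2 ≤ ∑' q, convEntry m p v q := norm_convBeta_sq_le m hp v hv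
  have h1 := D.norm_M_diag_sub_le ⟨p, hodd⟩
  have h2 := D.norm_M_diag_sub_le ⟨-p, hodd.neg⟩
  have e1 : level m ((-p : ℤ) : ℝ) = level m p := by
    rw [← level_abs m]; push_cast; rw [abs_neg, level_abs]
  have e2 : wt m p (-p : ℤ) = wt m p p := by unfold wt sdist; push_cast; rw [abs_neg]
  simp only [hrep.a_eq, hrep.b_eq, hrep.ω_eq, sub_self, hv0, add_zero, e1, e2] at h1 h2
  rw [sum_pairRoots, ← hD]
  have hw := (wt_pos m hp p).le
  have h3 := mul_le_mul_of_nonneg_left hq (by positivity : 0 ≤ 4 * wt m p p)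
  refine le_trans ?_ h3
  have e3 : ∀ x y z : ℂ, x + y - 2 * z = (x - z) + (y - z) := fun x y z => by ring
  rw [e3]
  refine (norm_add_le _ _).trans ?_
  push_cast at h1 h2 ⊢
  linarith

theorem norm_sum_pairRoots_add_le (hv0 : v 0 = 0) :
    ‖(pairRoots hm hp hodd v hv hsmall).sum - 2 * (level m p : ℝ) + 2 * secondOrder m p v‖ ≤
      10 * wt m p p * √(∑' q, convEntry m p v q) ^ 3 := by
  set D := pairBlock hm hp hodd v hv hsmall with hD
  have hrep : Represents D m p v := convBlock_represents m hp v hv hsmall _ _ _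
  have hq : ‖D.β‖ ≤ √(∑' q, convEntry m p v q) :=
    Real.le_sqrt_of_sq_le (norm_convBeta_sq_le m hp v hv)
  have hmem : ∀ q : OddInt, q ∈ D.P ↔ |(q : ℤ)| = p := fun q => mem_pairSet
  have h1 := D.norm_M_diag_add_le (i := ⟨p, hodd⟩) ((hmem _).mpr (by simp))
  have h2 := D.norm_M_diag_add_le (i := ⟨-p, hodd.neg⟩) ((hmem _).mpr (by simp))
  have e1 : level m ((-p : ℤ) : ℝ) = level m p := by
    rw [← level_abs m]; push_cast; rw [abs_neg, level_abs]
  have e2 : wt m p (-p : ℤ) = wt m p p := by unfold wt sdist; push_cast; rw [abs_neg]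
  -- The reflection q ↦ -q preserves levels and exchanges the two factors, so the second order terms
  -- at p and at -p coincide.
  have e4 : ∑' q : OddInt, (if |(q : ℤ)| = p then 0 else v (-p - q) * v (q - -p) /
      (((level m (q : ℤ) : ℝ) : ℂ) - (level m p : ℝ))) = secondOrder m p v := by
    let e : OddInt ≃ OddInt :=
      { toFun := fun q => ⟨-q, q.2.neg⟩
        invFun := fun q => ⟨-q, q.2.neg⟩
        left_inv := fun q => by simp
        right_inv := fun q => by simp }
    rw [secondOrder, ← e.tsum_eq]
    refine tsum_congr fun q => ?_
    have e5 : level m ((e q : ℤ) : ℝ) = level m ((q : ℤ) : ℝ) := by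
      change level m ((-(q : ℤ) : ℤ) : ℝ) = _
      rw [← level_abs m]; push_cast; rw [abs_neg, level_abs]
    rw [e5]
    change (if |(-(q : ℤ))| = p then 0 else v (-p - -q) * v (-q - -p) / _) = _
    rw [abs_neg]
    have e6 : -(p : ℤ) - -q = q - p := by ring
    have e7 : -(q : ℤ) - -p = p - q := by ring
    rw [e6, e7, mul_comm (v _)]
  have e8 : ((⟨p, hodd⟩ : OddInt) : ℤ) = p := rfl
  have e9 : ((⟨-p, hodd.neg⟩ : OddInt) : ℤ) = -p := rfl
  simp only [hrep.a_eq, hrep.b_eq, hrep.ω_eq, sub_self, hv0, add_zero, e1, e2, hmem] at h1 h2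
  rw [e4] at h2
  rw [sum_pairRoots, ← hD]
  have hw := (wt_pos m hp p).le
  have h3 := mul_le_mul_of_nonneg_left (pow_le_pow_left₀ (norm_nonneg _) hq 3)
    (by positivity : 0 ≤ 10 * wt m p p)
  refine le_trans ?_ h3
  have e3 : ∀ x y z w : ℂ, x + y - 2 * z + 2 * w = (x - z + w) + (y - z + w) :=
    fun x y z w => by ring
  rw [e3]
  refine (norm_add_le _ _).trans ?_
  have h1' : ‖D.M ⟨p, hodd⟩ ⟨p, hodd⟩ - (level m p : ℝ) + secondOrder m p v‖ ≤
      5 * wt m p p * ‖D.β‖ ^ 3 := by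
    simpa [secondOrder] using h1
  linarith

end PairRoots

/-- The division of the spectrum of `T_α(v)`, if the weighted convolution matrices are small. -/
theorem exists_spectralBlocks {m : ℕ} (hm : 1 ≤ m) {α : ℝ} (hα : α ∈ Set.Icc (0 : ℝ) 1)
    {v : ℤ → ℂ} (hv : v ∈ hPlus (-(m * α))) {N : ℕ} (hN : 1 ≤ N)
    (hsum : ∀ p, 2 * N ≤ p → Summable (convEntry m p v))
    (hsmall : ∀ p, 2 * N ≤ p → ∑' q, convEntry m p v q ≤ (1 / 8) ^ 2) :
    ∃ R : ℕ → Multiset ℂ,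
      SpectralBlocks (algMultiplicity (operatorT m hm α hα v hv)) N
        (fun i => level m ((2 * (N + i) : ℕ) : ℝ)) R ∧
      (∀ z ∈ R 0, ‖z‖ ≤ level m (2 * N : ℕ) + ∑ k ∈ leftSet (2 * N), wt m (2 * N) k) ∧
      ∀ i, R (i + 1) = pairRoots hm (p := 2 * (N + i) + 1) (by omega) ⟨(N + i : ℤ), by push_cast; ring⟩ v
        (hsum _ (by omega)) (hsmall _ (by omega)) := by
  have hodd : ∀ i : ℕ, Odd ((2 * (N + i) + 1 : ℕ) : ℤ) := fun i => ⟨(N + i : ℤ), by push_cast; ring⟩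
  set L := leftBlock hm (N := N) (by omega) v (hsum _ le_rfl) (hsmall _ le_rfl) with hL
  have hLrep : Represents L m (2 * N) v := convBlock_represents _ _ _ _ _ _ _ _
  have hLmem : ∀ k : OddInt, k ∈ L.P ↔ k ∈ leftSet (2 * N) := fun _ => Iff.rfl
  let R : ℕ → Multiset ℂ := fun n => match n with
    | 0 => (Represents.blockMatrix L).charpoly.roots
    | i + 1 => pairRoots hm (p := 2 * (N + i) + 1) (by omega) (hodd i) v
        (hsum _ (by omega)) (hsmall _ (by omega))
  have c1 : ∀ i : ℕ, ((2 * (N + i) + 1 : ℕ) : ℝ) - 1 = ((2 * (N + i) : ℕ) : ℝ) := fun i => by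
    push_cast; ring
  have c2 : ∀ i : ℕ, ((2 * (N + i) + 1 : ℕ) : ℝ) + 1 = ((2 * (N + (i + 1)) : ℕ) : ℝ) := fun i => by
    push_cast; ring
  refine ⟨R, ?_, ?_, fun i => rfl⟩
  · refine ⟨?_, ?_, ?_, ?_, ?_, ?_, ?_, ?_⟩
    · intro i j hij
      refine level_mono m ?_
      rw [abs_of_nonneg (Nat.cast_nonneg _), abs_of_nonneg (Nat.cast_nonneg _)]
      exact_mod_cast (by omega : 2 * (N + i) ≤ 2 * (N + j))
    · intro x
      obtain ⟨i, hi⟩ := exists_nat_ge x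
      refine ⟨i, ?_⟩
      have h1 : (1 : ℝ) ≤ ((2 * (N + i) : ℕ) : ℝ) := by
        exact_mod_cast (by omega : 1 ≤ 2 * (N + i))
      have h2 : (i : ℝ) ≤ ((2 * (N + i) : ℕ) : ℝ) := by
        exact_mod_cast (by omega : i ≤ 2 * (N + i))
      have h3 := le_self_pow₀ h1 (by omega : 2 * m ≠ 0)
      have hpi : (1 : ℝ) ≤ Real.pi ^ (2 * m) := one_le_pow₀ (by linarith [Real.pi_gt_three])
      unfold level
      nlinarith
    · exact (card_roots_blockMatrix L).trans (card_leftSet N)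
    · exact fun i => (card_roots_blockMatrix _).trans (card_pairSet (hodd i))
    -- On or to the right of the line through 2N every disc of the left block is avoided.
    · intro z hz
      by_contra hcon
      refine Represents.not_mem_roots (D := L) (fun k hk => ?_) hz
      rw [hLrep.a_eq, hLrep.ω_eq]
      exact le_norm_sub_of_le_re (not_lt.mp hcon) (level_le_of_mem_left ((hLmem k).mp hk))
        (wt_le_left hm N k)
    · intro i z hz
      by_contra hcon
      have hrep : Represents (pairBlock hm (p := 2 * (N + i) + 1) (by omega) (hodd i) v
        (hsum _ (by omega)) (hsmall _ (by omega))) m (2 * (N + i) + 1) v :=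
          convBlock_represents _ _ _ _ _ _ _ _
      refine Represents.not_mem_roots (fun k hk => ?_) hz
      rw [hrep.a_eq, hrep.ω_eq]
      refine pair_not_root hm (by omega) ?_ hk
      rw [c1, c2]
      by_contra hc
      push Not at hc
      exact hcon hc
    · intro μ hμ
      refine hLrep.algMultiplicity_eq hm (by omega) hα hv fun k hk => ?_
      rw [hLrep.a_eq, hLrep.ω_eq]
      exact le_norm_sub_of_re_le hμ (level_ge_of_notMem_left hk) (wt_le_left hm N k)
    · intro i μ h1 h2
      have hrep : Represents (pairBlock hm (p := 2 * (N + i) + 1) (by omega) (hodd i) v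
        (hsum _ (by omega)) (hsmall _ (by omega))) m (2 * (N + i) + 1) v :=
          convBlock_represents _ _ _ _ _ _ _ _
      refine hrep.algMultiplicity_eq hm (by omega) hα hv fun k hk => ?_
      rw [hrep.a_eq, hrep.ω_eq]
      exact pair_resolvent hm (by omega) (hodd i) (by rw [c1]; exact h1) (by rw [c2]; exact h2) hk
  -- A root lies within ω_k of some a_k, which is at most the level of 2N; the sum of all weights is
  -- a crude bound for the largest one, and it does not depend on v.
  · intro z hz
    by_contra hcon
    push Not at hcon
    refine Represents.not_mem_roots (D := L) (fun k hk => ?_) hz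
    rw [hLrep.a_eq, hLrep.ω_eq]
    have h1 := level_le_of_mem_left (m := m) hk
    have h2 : wt m (2 * N) k ≤ ∑ k ∈ leftSet (2 * N), wt m (2 * N) k :=
      Finset.single_le_sum (f := fun k : OddInt => wt m (2 * N) k)
        (fun j _ => (wt_pos m (by omega) (j : ℤ)).le) hk
    have h3 := norm_sub_norm_le z ((level m (k : ℤ) : ℝ) : ℂ)
    rw [norm_sub_rev]
    have h4 : 0 ≤ level m (k : ℤ) := by
      rw [← level_abs]; unfold level; positivity
    rw [Complex.norm_real, Real.norm_eq_abs, abs_of_nonneg h4] at h3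
    linarith

/-! ### The second order term for `m = 1` and `s ≤ 1 / 4` -/

theorem norm_mul_neg_le (s : ℝ) (v : ℤ → ℂ) (l : ℤ) :
    ‖v l * v (-l)‖ ≤ bracket l ^ (2 * s) * ((density s v l + density s v (-l)) / 2) := by
  have e : bracket (-l) = bracket l := by unfold bracket; push_cast; rw [abs_neg]
  have h1 := norm_sq_eq_density s v l
  have h2 := norm_sq_eq_density s v (-l)
  rw [e] at h2
  rw [norm_mul]
  nlinarith [sq_nonneg (‖v l‖ - ‖v (-l)‖)]

/-- The symmetrized density has the same even moments as the density, so both masses are unchanged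
when |v(l) v(-l)| is estimated by the arithmetic mean. -/
theorem hasSum_symm_mul {s : ℝ} {v : ℤ → ℂ} {g : ℤ → ℝ} {a : ℝ} (hg : ∀ l, g (-l) = g l)
    (h : HasSum (fun l => density s v l * g l) a) :
    HasSum (fun l => (density s v l + density s v (-l)) / 2 * g l) a := by
  have h2 : HasSum (fun l => density s v (-l) * g (-l)) a := (Equiv.neg ℤ).hasSum_iff.mpr h
  have h3 := (h.add h2).div_const 2
  rw [add_self_div_two] at h3
  refine h3.congr_fun fun l => ?_
  rw [hg]
  ring

/-- For |l| ≤ 4p the factor ⟨l⟩^{2s} is at most 5 p^{2s}. Beyond that, |l - 2p| is comparable to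
⟨l⟩, and ⟨l⟩^{2s-1} decays since 2s < 1. At l = 2p the convention 1/0 = 0 makes the left side
vanish. -/
theorem rpow_bracket_div_le {s : ℝ} (hs : 0 ≤ s) (hs4 : s ≤ 1 / 4) {p : ℕ} (hp : 1 ≤ p) (l : ℤ) :
    bracket l ^ (2 * s) * |((l : ℝ) - 2 * p)|⁻¹ ≤ 10 * ((p : ℝ) ^ (2 * s) *
      (bracket (|l| - 2 * p) ^ (-(3 / 4) : ℝ) + (p : ℝ) ^ (-(3 / 4) : ℝ))) := by
  have hp' : (1 : ℝ) ≤ p := by exact_mod_cast hp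
  have hp0 : (0 : ℝ) < p := by linarith
  have n1 := bracket_rpow_nonneg (|l| - 2 * p) (-(3 / 4))
  have n2 : 0 ≤ (p : ℝ) ^ (-(3 / 4) : ℝ) := by positivity
  have n3 : 0 ≤ (p : ℝ) ^ (2 * s) := by positivity
  have n4 := bracket_rpow_nonneg l (2 * s)
  by_cases h0 : l = 2 * p
  · rw [h0]; push_cast; rw [sub_self, abs_zero, inv_zero, mul_zero]
    rw [h0] at n1
    positivity
  have h1 : (1 : ℝ) ≤ |(l : ℝ) - 2 * p| := by
    have : (1 : ℤ) ≤ |l - 2 * p| := Int.one_le_abs (sub_ne_zero.mpr h0)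
    exact_mod_cast this
  rcases le_or_gt |(l : ℝ)| (4 * p) with hl | hl
  · have e1 : bracket l ^ (2 * s) ≤ 5 * (p : ℝ) ^ (2 * s) := by
      calc bracket l ^ (2 * s) ≤ (5 * p : ℝ) ^ (2 * s) :=
            Real.rpow_le_rpow (bracket_pos l).le (by unfold bracket; linarith) (by linarith)
        _ = 5 ^ (2 * s) * (p : ℝ) ^ (2 * s) := Real.mul_rpow (by norm_num) hp0.le
        _ ≤ 5 ^ (1 : ℝ) * (p : ℝ) ^ (2 * s) := by
            gcongr
            · norm_num
            · linarith
        _ = _ := by rw [Real.rpow_one]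
    have e2 : |(l : ℝ) - 2 * p|⁻¹ ≤ 2 * bracket (|l| - 2 * p) ^ (-(3 / 4) : ℝ) := by
      have hb : bracket (|l| - 2 * p) ≤ 2 * |(l : ℝ) - 2 * p| := by
        rw [bracket_abs_sub]
        have := abs_abs_sub_abs_le (l : ℝ) (2 * p)
        rw [abs_of_nonneg (by linarith : (0 : ℝ) ≤ 2 * p)] at this
        linarith
      have h3 : |(l : ℝ) - 2 * p|⁻¹ ≤ 2 * (bracket (|l| - 2 * p))⁻¹ := by
        rw [← div_eq_mul_inv, le_div_iff₀ (bracket_pos _), inv_mul_le_iff₀ (by linarith)]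
        linarith
      have h4 : (bracket (|l| - 2 * p))⁻¹ ≤ bracket (|l| - 2 * p) ^ (-(3 / 4) : ℝ) := by
        rw [← Real.rpow_neg_one]
        exact Real.rpow_le_rpow_of_exponent_le (one_le_bracket _) (by norm_num)
      linarith
    calc _ ≤ (5 * (p : ℝ) ^ (2 * s)) * (2 * bracket (|l| - 2 * p) ^ (-(3 / 4) : ℝ)) := by gcongr
      _ ≤ _ := by nlinarith [mul_nonneg n3 n2]
  · have e1 : |(l : ℝ) - 2 * p|⁻¹ ≤ 4 * (bracket l)⁻¹ := by
      have h2 := abs_sub_abs_le_abs_sub (l : ℝ) (2 * p)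
      rw [abs_of_nonneg (by linarith : (0 : ℝ) ≤ 2 * p)] at h2
      rw [← div_eq_mul_inv, le_div_iff₀ (bracket_pos _), inv_mul_le_iff₀ (by linarith)]
      unfold bracket
      linarith
    have e2 : bracket l ^ (2 * s) * (bracket l)⁻¹ ≤ (p : ℝ) ^ (2 * s) * (p : ℝ) ^ (-(3 / 4) : ℝ) := by
      rw [← Real.rpow_neg_one, ← Real.rpow_add (bracket_pos l), ← Real.rpow_add hp0]
      refine (Real.rpow_le_rpow_of_nonpos hp0 (by unfold bracket; linarith) (by linarith)).trans
        (Real.rpow_le_rpow_of_exponent_le hp' (by linarith))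
    calc _ ≤ bracket l ^ (2 * s) * (4 * (bracket l)⁻¹) := by gcongr
      _ = 4 * (bracket l ^ (2 * s) * (bracket l)⁻¹) := by ring
      _ ≤ 4 * ((p : ℝ) ^ (2 * s) * (p : ℝ) ^ (-(3 / 4) : ℝ)) := by gcongr
      _ ≤ _ := by nlinarith [mul_nonneg n3 n2, mul_nonneg n3 n1]

/-- Substitution l = p - q, with q² - p² = l (l - 2p). The excluded indices q = ±p correspond to l =
0 and l = 2p, where division by zero gives 0; even q contribute nothing as v vanishes at odd
integers. -/
theorem secondOrder_one_eq {p : ℕ} (hodd : Odd (p : ℤ)) {v : ℤ → ℂ}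
    (hv : ∀ k, v (2 * k + 1) = 0) :
    secondOrder 1 p v = ∑' l : ℤ, v l * v (-l) / (l * (l - 2 * p) * Real.pi ^ 2) := by
  have e1 : ∑' l : ℤ, v l * v (-l) / (l * (l - 2 * p) * Real.pi ^ 2) =
      ∑' q : ℤ, v (p - q) * v (q - p) / (((p - q : ℤ) : ℂ) * (((p - q : ℤ) : ℂ) - 2 * p)
        * Real.pi ^ 2) := by
    rw [← (Equiv.subLeft (p : ℤ)).tsum_eq]
    refine tsum_congr fun q => ?_
    simp only [Equiv.subLeft_apply, neg_sub]
  rw [e1, tsum_odd, secondOrder]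
  · refine tsum_congr fun q => ?_
    split_ifs with h
    · rcases (abs_eq (Nat.cast_nonneg p)).mp h with h | h <;> rw [h] <;> push_cast
      · simp
      · have : (p : ℂ) - -p - 2 * p = 0 := by ring
        rw [this]; simp
    · congr 1
      unfold level
      push_cast
      ring
  · intro q hq
    obtain ⟨j, hj⟩ := hodd
    obtain ⟨i, hi⟩ := Int.not_odd_iff_even.mp hq
    have : (p : ℤ) - q = 2 * (j - i) + 1 := by rw [hj, hi]; ring
    rw [this, hv]
    simp

/-- The partial fraction 1/(l (l - 2p)) = (1/(l - 2p) - 1/l) / (2p) gains a factor 1/p. The product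
v(l) v(-l) is even, so its sum against 1/l is zero, and only the part concentrated at l near 2p
remains. -/
theorem norm_secondOrder_le {s : ℝ} (hs : 0 ≤ s) (hs4 : s ≤ 1 / 4) {p : ℕ} (hp : 1 ≤ p)
    (hodd : Odd (p : ℤ)) {v : ℤ → ℂ} (hv : v ∈ hPlusZero (-s)) :
    ‖secondOrder 1 p v‖ ≤ 10 * ((p : ℝ)⁻¹ * ((p : ℝ) ^ (2 * s) *
      (localMass s v p + (p : ℝ) ^ (-(3 / 4) : ℝ) * mass s v))) := by
  have hv1 : v ∈ hSpace (-s) := hv.1.1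
  have hp' : (1 : ℝ) ≤ p := by exact_mod_cast hp
  have hp0 : (0 : ℝ) < p := by linarith
  set V : ℤ → ℂ := fun l => v l * v (-l) with hV
  have hVneg : ∀ l, V (-l) = V l := fun l => by simp only [hV, neg_neg]; ring
  have hV0 : V 0 = 0 := by simp [hV, hv.2]
  set u : ℤ → ℝ := fun l => (density s v l + density s v (-l)) / 2 with hu
  have hu0 : ∀ l, 0 ≤ u l := fun l => by
    have := density_nonneg s v l
    have := density_nonneg s v (-l)
    positivity
  have hVle : ∀ l, ‖V l‖ ≤ bracket l ^ (2 * s) * u l := norm_mul_neg_le s v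
  have hu1 : HasSum u (mass s v) := by
    have h := hasSum_symm_mul (s := s) (v := v) (g := fun _ => 1) (fun _ => rfl)
      (by simpa only [mul_one] using (summable_density hv1).hasSum)
    simp only [mul_one] at h
    exact h
  have hu2 : HasSum (fun l : ℤ => u l * bracket (|l| - 2 * p) ^ (-(3 / 4) : ℝ)) (localMass s v p) :=
    hasSum_symm_mul (fun l => by rw [abs_neg]) (summable_localMass hv1 p).hasSum
  have hdom : HasSum (fun l : ℤ => 10 * ((p : ℝ) ^ (2 * s) * (u l * bracket (|l| - 2 * p) ^ (-(3 / 4) : ℝ)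
      + (p : ℝ) ^ (-(3 / 4) : ℝ) * u l))) (10 * ((p : ℝ) ^ (2 * s) *
      (localMass s v p + (p : ℝ) ^ (-(3 / 4) : ℝ) * mass s v))) :=
    ((hu2.add (hu1.mul_left _)).mul_left _).mul_left _
  have hle1 : ∀ l : ℤ, ‖V l * ((l : ℂ) - 2 * p)⁻¹‖ ≤ 10 * ((p : ℝ) ^ (2 * s) *
      (u l * bracket (|l| - 2 * p) ^ (-(3 / 4) : ℝ) + (p : ℝ) ^ (-(3 / 4) : ℝ) * u l)) := by
    intro l
    have e : ‖((l : ℂ) - 2 * p)⁻¹‖ = |((l : ℝ) - 2 * p)|⁻¹ := by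
      rw [norm_inv, ← Real.norm_eq_abs, ← Complex.norm_real]
      push_cast
      rfl
    rw [norm_mul, e]
    have h1 := mul_le_mul_of_nonneg_right (hVle l) (inv_nonneg.mpr (abs_nonneg ((l : ℝ) - 2 * p)))
    have h2 := mul_le_mul_of_nonneg_left (rpow_bracket_div_le hs hs4 hp l) (hu0 l)
    linarith
  have hle2 : ∀ l : ℤ, ‖V l * (l : ℂ)⁻¹‖ ≤ 2 * u l := by
    intro l
    by_cases hl : l = 0
    · rw [hl, hV0]; simpa using hu0 0
    have h1 : (1 : ℝ) ≤ |(l : ℝ)| := by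
      have : (1 : ℤ) ≤ |l| := Int.one_le_abs hl
      exact_mod_cast this
    rw [norm_mul, norm_inv, Complex.norm_intCast, ← div_eq_mul_inv, div_le_iff₀ (by linarith)]
    have h2 : bracket l ^ (2 * s) ≤ 2 * |(l : ℝ)| := by
      calc bracket l ^ (2 * s) ≤ bracket l ^ (1 : ℝ) :=
            Real.rpow_le_rpow_of_exponent_le (one_le_bracket l) (by linarith)
        _ = bracket l := Real.rpow_one _
        _ ≤ _ := by unfold bracket; linarith
    have h3 := mul_le_mul_of_nonneg_right h2 (hu0 l)
    linarith [hVle l]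
  have s1 : Summable fun l : ℤ => V l * ((l : ℂ) - 2 * p)⁻¹ :=
    Summable.of_norm_bounded hdom.summable hle1
  have s2 : Summable fun l : ℤ => V l * (l : ℂ)⁻¹ :=
    Summable.of_norm_bounded (hu1.summable.mul_left 2) hle2
  have z2 : ∑' l : ℤ, V l * (l : ℂ)⁻¹ = 0 := by
    have h := (Equiv.neg ℤ).tsum_eq fun l : ℤ => V l * (l : ℂ)⁻¹
    have h2 : ∀ l : ℤ, V ((Equiv.neg ℤ) l) * (((Equiv.neg ℤ) l : ℤ) : ℂ)⁻¹ =
        -(V l * (l : ℂ)⁻¹) := fun l => by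
      simp only [Equiv.neg_apply, hVneg]
      push_cast
      rw [inv_neg, mul_neg]
    simp only [h2, tsum_neg] at h
    exact self_eq_neg.mp h.symm
  have hp0c : (p : ℂ) ≠ 0 := by exact_mod_cast hp0.ne'
  have hpi : (Real.pi : ℂ) ≠ 0 := by exact_mod_cast Real.pi_ne_zero
  -- At l = 2p the left side is 0 by convention while the term with 1/l is not, hence the correction
  -- concentrated at that index.
  have term : ∀ l : ℤ, v l * v (-l) / (l * (l - 2 * p) * Real.pi ^ 2) =
      ((2 * p : ℂ) * Real.pi ^ 2)⁻¹ * (V l * ((l : ℂ) - 2 * p)⁻¹ - V l * (l : ℂ)⁻¹ +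
        if l = 2 * p then V (2 * p) * (2 * p : ℂ)⁻¹ else 0) := by
    intro l
    change V l / _ = _
    split_ifs with h1
    · rw [h1]; push_cast; simp
    · by_cases h2 : l = 0
      · rw [h2, hV0]; simp
      · have h3 : (l : ℂ) ≠ 0 := by exact_mod_cast h2
        have h4 : (l : ℂ) - 2 * p ≠ 0 := by
          rw [sub_ne_zero]; exact_mod_cast h1
        field_simp
        ring
  have hlast : HasSum (fun l : ℤ => if l = 2 * p then V (2 * p) * (2 * p : ℂ)⁻¹ else 0)
      (V (2 * p) * (2 * p : ℂ)⁻¹) := hasSum_ite_eq _ _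
  have total : secondOrder 1 p v = ((2 * p : ℂ) * Real.pi ^ 2)⁻¹ *
      ((∑' l : ℤ, V l * ((l : ℂ) - 2 * p)⁻¹) + V (2 * p) * (2 * p : ℂ)⁻¹) := by
    rw [secondOrder_one_eq hodd hv.1.2]
    simp only [term]
    rw [tsum_mul_left, (s1.sub s2).tsum_add hlast.summable, s1.tsum_sub s2, z2, hlast.tsum_eq,
      sub_zero]
  have b1 : ‖∑' l : ℤ, V l * ((l : ℂ) - 2 * p)⁻¹‖ ≤ 10 * ((p : ℝ) ^ (2 * s) *
      (localMass s v p + (p : ℝ) ^ (-(3 / 4) : ℝ) * mass s v)) := by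
    rw [← hdom.tsum_eq]
    exact tsum_of_norm_bounded hdom.summable.hasSum hle1
  have b2 : ‖V (2 * p) * (2 * p : ℂ)⁻¹‖ ≤ 10 * ((p : ℝ) ^ (2 * s) *
      (localMass s v p + (p : ℝ) ^ (-(3 / 4) : ℝ) * mass s v)) := by
    have c1 : u (2 * p) ≤ mass s v := le_hasSum hu1 _ fun l _ => hu0 l
    have c2 : bracket (2 * p) ^ (2 * s) ≤ 3 * (p : ℝ) ^ (2 * s) := by
      calc bracket (2 * p) ^ (2 * s) ≤ (3 * p : ℝ) ^ (2 * s) :=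
            Real.rpow_le_rpow (bracket_pos _).le (by
              unfold bracket; push_cast; rw [abs_of_nonneg (by positivity)]; linarith) (by linarith)
        _ = 3 ^ (2 * s) * (p : ℝ) ^ (2 * s) := Real.mul_rpow (by norm_num) hp0.le
        _ ≤ 3 ^ (1 : ℝ) * (p : ℝ) ^ (2 * s) := by
            gcongr
            · norm_num
            · linarith
        _ = _ := by rw [Real.rpow_one]
    have c3 : ‖(2 * p : ℂ)⁻¹‖ ≤ (p : ℝ) ^ (-(3 / 4) : ℝ) := by
      rw [norm_inv, norm_mul, Complex.norm_natCast, Complex.norm_ofNat]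
      calc (2 * p : ℝ)⁻¹ ≤ (p : ℝ)⁻¹ := inv_anti₀ hp0 (by linarith)
        _ = (p : ℝ) ^ (-1 : ℝ) := (Real.rpow_neg_one _).symm
        _ ≤ _ := Real.rpow_le_rpow_of_exponent_le hp' (by norm_num)
    have c4 := localMass_nonneg s v p
    have c5 := mass_nonneg s v
    have c6 := hu0 (2 * p)
    rw [norm_mul]
    calc _ ≤ (3 * (p : ℝ) ^ (2 * s) * mass s v) * (p : ℝ) ^ (-(3 / 4) : ℝ) := by
          refine mul_le_mul ((hVle _).trans (mul_le_mul c2 c1 c6 (by positivity))) c3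
            (norm_nonneg _) (by positivity)
      _ = 3 * ((p : ℝ) ^ (2 * s) * (0 + (p : ℝ) ^ (-(3 / 4) : ℝ) * mass s v)) := by ring
      _ ≤ _ := by gcongr; norm_num
  have n0 : 0 ≤ (p : ℝ) ^ (2 * s) * (localMass s v p + (p : ℝ) ^ (-(3 / 4) : ℝ) * mass s v) := by
    have := localMass_nonneg s v p
    have := mass_nonneg s v
    positivity
  rw [total, norm_mul]
  have b3 : ‖((2 * p : ℂ) * Real.pi ^ 2)⁻¹‖ ≤ 1 / 2 * (p : ℝ)⁻¹ := by
    have c1 : (1 : ℝ) ≤ Real.pi ^ 2 := one_le_pow₀ (by linarith [Real.pi_gt_three])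
    rw [norm_inv, norm_mul, norm_mul, norm_pow, Complex.norm_real, Complex.norm_natCast,
      Complex.norm_ofNat, Real.norm_eq_abs, abs_of_pos Real.pi_pos, one_div, ← mul_inv]
    exact inv_anti₀ (by positivity) (le_mul_of_one_le_right (by positivity) c1)
  have b4 := norm_add_le (∑' l : ℤ, V l * ((l : ℂ) - 2 * p)⁻¹) (V (2 * p) * (2 * p : ℂ)⁻¹)
  calc _ ≤ 1 / 2 * (p : ℝ)⁻¹ * (10 * ((p : ℝ) ^ (2 * s) *
      (localMass s v p + (p : ℝ) ^ (-(3 / 4) : ℝ) * mass s v)) + 10 * ((p : ℝ) ^ (2 * s) *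
      (localMass s v p + (p : ℝ) ^ (-(3 / 4) : ℝ) * mass s v))) := by
        refine mul_le_mul b3 (by linarith) (norm_nonneg _) (by positivity)
    _ = _ := by ring

/-! ### The asymptotics of the means -/

theorem wt_self_le {m : ℕ} (hm : 1 ≤ m) (p : ℕ) : wt m p p ≤ (p : ℝ) ^ (2 * m - 1) := by
  have hp : (0 : ℝ) ≤ p := Nat.cast_nonneg p
  have e : wt m p p = ((4 : ℝ) ^ (2 * m))⁻¹ * (2 ^ (2 * m - 1) * (p : ℝ) ^ (2 * m - 1)) := by
    unfold wt sdist
    rw [Int.cast_natCast, abs_of_nonneg hp, sub_self, abs_zero, max_eq_left zero_le_one, one_mul,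
      ← two_mul, mul_pow]
  rw [e, inv_mul_le_iff₀ (by positivity)]
  refine mul_le_mul_of_nonneg_right ?_ (by positivity)
  calc (2 : ℝ) ^ (2 * m - 1) ≤ 4 ^ (2 * m - 1) := by gcongr; norm_num
    _ ≤ 4 ^ (2 * m) := pow_le_pow_right₀ (by norm_num) (by omega)

theorem inv_pow_eq_rpow {m : ℕ} (hm : 1 ≤ m) (p : ℕ) :
    ((p : ℝ) ^ (4 * m - 2))⁻¹ = (p : ℝ) ^ (-(4 * m - 2) : ℝ) := by
  rw [Real.rpow_neg (Nat.cast_nonneg p), ← Real.rpow_natCast, Nat.cast_sub (by omega)]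
  push_cast
  rfl

theorem pow_eq_rpow {m : ℕ} (hm : 1 ≤ m) (p : ℕ) :
    (p : ℝ) ^ (2 * m - 1) = (p : ℝ) ^ (2 * m - 1 : ℝ) := by
  rw [← Real.rpow_natCast, Nat.cast_sub (by omega)]
  push_cast
  rfl

theorem exists_convEntry_decay {m : ℕ} (hm : 1 ≤ m) {s : ℝ} (hs : 0 ≤ s) (hsm : s < m) {A : ℝ}
    (hA : 0 ≤ A) :
    ∃ C : ℝ, 0 ≤ C ∧ ∀ p : ℕ, 1 ≤ p → ∀ v ∈ hSpace (-s), mass s v ≤ A →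
      ∑' q, convEntry m p v q ≤ C * (p : ℝ) ^ (2 * s - (4 * m - 2)) := by
  obtain ⟨C, hC, h⟩ := exists_hs_bound hm hs hsm
  refine ⟨C * (3 * A), by positivity, fun p hp v hv hvA => ?_⟩
  have hp' : (1 : ℝ) ≤ p := by exact_mod_cast hp
  have hp0 : (0 : ℝ) < p := by linarith
  refine ((h p hp v hv).2).trans ?_
  rw [inv_pow_eq_rpow hm, sub_eq_add_neg (2 * s), Real.rpow_add hp0, mul_assoc]
  refine mul_le_mul_of_nonneg_left ?_ hC.le
  have h1 : (1 : ℝ) ≤ (p : ℝ) ^ (2 * s) := Real.one_le_rpow hp' (by linarith)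
  have h2 : (p : ℝ) ^ (-(3 / 4) : ℝ) ≤ 1 := Real.rpow_le_one_of_one_le_of_nonpos hp' (by norm_num)
  have h3 := (localMass_le hv p).trans hvA
  have h4 := mass_nonneg s v
  have h5 : (p : ℝ) ^ (-(3 / 4) : ℝ) * mass s v ≤ A :=
    (mul_le_of_le_one_left h4 h2).trans hvA
  have h6 : mass s v ≤ (p : ℝ) ^ (2 * s) * A := hvA.trans (le_mul_of_one_le_left hA h1)
  calc _ ≤ (p : ℝ) ^ (-(4 * m - 2) : ℝ) * ((p : ℝ) ^ (2 * s) * (A + A) + (p : ℝ) ^ (2 * s) * A) := by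
        gcongr
    _ = _ := by ring

theorem exists_threshold {m : ℕ} (hm : 1 ≤ m) {s : ℝ} (hs : 0 ≤ s) (hsm : s < m) {A : ℝ}
    (hA : 0 ≤ A) :
    ∃ N : ℕ, 1 ≤ N ∧ ∀ p : ℕ, 2 * N ≤ p → ∀ v ∈ hSpace (-s), mass s v ≤ A →
      ∑' q, convEntry m p v q ≤ (1 / 8) ^ 2 := by
  obtain ⟨C, hC, h⟩ := exists_convEntry_decay hm hs hsm hA
  have hm' : (1 : ℝ) ≤ m := by exact_mod_cast hm
  have ht : Filter.Tendsto (fun p : ℕ => C * (p : ℝ) ^ (2 * s - (4 * m - 2))) Filter.atTop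
      (nhds (C * 0)) := by
    have e : 2 * s - (4 * m - 2) = -(4 * m - 2 - 2 * s) := by ring
    rw [e]
    -- The exponent is negative: 4m - 2 - 2s > 2m - 2 ≥ 0.
    exact ((tendsto_rpow_neg_atTop (by linarith)).comp tendsto_natCast_atTop_atTop).const_mul C
  rw [mul_zero] at ht
  obtain ⟨N, hN⟩ := Filter.eventually_atTop.mp
    (ht.eventually_le_const (by norm_num : (0 : ℝ) < (1 / 8) ^ 2))
  exact ⟨N + 1, by omega, fun p hp v hv hvA =>
    (h p (by omega) v hv hvA).trans (hN p (by omega))⟩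

/-- Multiplying the Hilbert–Schmidt bound by ω_p ≤ p^{2m-1} and factoring out p^{2s-m} leaves the
powers p^{1-m}, p^{1-m-3/4} and p^{1-m-2s}. The last one is square summable exactly when 1/2 < m - 1
+ 2s, which dictates the hypothesis and the choice of θ. -/
theorem exists_first_order_bound {m : ℕ} (hm : 1 ≤ m) {s : ℝ} (hs : 0 ≤ s) (hsm : s < m) {A : ℝ}
    (hA : 0 ≤ A) (h2 : 1 / 2 < m - 1 + 2 * s) :
    ∃ θ K : ℝ, 1 / 2 < θ ∧ 0 ≤ K ∧ ∀ (p : ℕ) (hp : 1 ≤ p) (hodd : Odd (p : ℤ))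
      (v : ℤ → ℂ) (_ : v ∈ hPlusZero (-s)) (_ : mass s v ≤ A) (hv : Summable (convEntry m p v))
      (hsmall : ∑' q, convEntry m p v q ≤ (1 / 8) ^ 2),
      ‖(pairRoots hm hp hodd v hv hsmall).sum - 2 * (level m p : ℝ)‖ ≤
        K * ((p : ℝ) ^ (2 * s - m) * (localMass s v p + (p : ℝ) ^ (-θ))) := by
  obtain ⟨C, hC, h⟩ := exists_hs_bound hm hs hsm
  have hm' : (1 : ℝ) ≤ m := by exact_mod_cast hm
  refine ⟨min (3 / 4) (m - 1 + 2 * s), 4 * C * (1 + 2 * A), lt_min (by norm_num) h2, by positivity,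
    fun p hp hodd v hv0 hvA hv hsmall => ?_⟩
  set θ := min (3 / 4) (m - 1 + 2 * s) with hθ
  have hp' : (1 : ℝ) ≤ p := by exact_mod_cast hp
  have hp0 : (0 : ℝ) < p := by linarith
  have hX := localMass_nonneg s v p
  have hMn := mass_nonneg s v
  have hQ := (h p hp v hv0.1.1).2
  have hw := wt_self_le hm p
  have hw0 := (wt_pos m hp p).le
  have key : (p : ℝ) ^ (2 * m - 1 : ℝ) * ((p : ℝ) ^ (-(4 * m - 2) : ℝ) * ((p : ℝ) ^ (2 * s) *
      (localMass s v p + (p : ℝ) ^ (-(3 / 4) : ℝ) * mass s v) + mass s v)) =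
      (p : ℝ) ^ (2 * s - m) * ((p : ℝ) ^ (1 - m : ℝ) * localMass s v p +
        (p : ℝ) ^ (1 - m - 3 / 4 : ℝ) * mass s v + (p : ℝ) ^ (1 - m - 2 * s : ℝ) * mass s v) := by
    have e1 : (p : ℝ) ^ (2 * m - 1 : ℝ) * (p : ℝ) ^ (-(4 * m - 2) : ℝ) * (p : ℝ) ^ (2 * s) =
        (p : ℝ) ^ (2 * s - m) * (p : ℝ) ^ (1 - m : ℝ) := by
      rw [← Real.rpow_add hp0, ← Real.rpow_add hp0, ← Real.rpow_add hp0]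
      congr 1; ring
    have e2 : (p : ℝ) ^ (1 - m - 3 / 4 : ℝ) = (p : ℝ) ^ (1 - m : ℝ) * (p : ℝ) ^ (-(3 / 4) : ℝ) := by
      rw [← Real.rpow_add hp0]
      congr 1
    have e3 : (p : ℝ) ^ (2 * m - 1 : ℝ) * (p : ℝ) ^ (-(4 * m - 2) : ℝ) =
        (p : ℝ) ^ (2 * s - m) * (p : ℝ) ^ (1 - m - 2 * s : ℝ) := by
      rw [← Real.rpow_add hp0, ← Real.rpow_add hp0]
      congr 1; ring
    rw [e2]
    linear_combination (localMass s v p + (p : ℝ) ^ (-(3 / 4) : ℝ) * mass s v) * e1 + mass s v * e3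
  have f1 : (p : ℝ) ^ (1 - m : ℝ) ≤ 1 :=
    Real.rpow_le_one_of_one_le_of_nonpos hp' (by linarith)
  have f2 : (p : ℝ) ^ (1 - m - 3 / 4 : ℝ) ≤ (p : ℝ) ^ (-θ) :=
    Real.rpow_le_rpow_of_exponent_le hp' (by linarith [min_le_left (3 / 4) (m - 1 + 2 * s)])
  have f3 : (p : ℝ) ^ (1 - m - 2 * s : ℝ) ≤ (p : ℝ) ^ (-θ) :=
    Real.rpow_le_rpow_of_exponent_le hp' (by linarith [min_le_right (3 / 4) (m - 1 + 2 * s)])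
  have hth : 0 ≤ (p : ℝ) ^ (-θ) := by positivity
  calc _ ≤ 4 * wt m p p * ∑' q, convEntry m p v q :=
        norm_sum_pairRoots_sub_le hm hp hodd hv hsmall hv0.2
    _ ≤ 4 * (p : ℝ) ^ (2 * m - 1) * (C * (((p : ℝ) ^ (4 * m - 2))⁻¹ * ((p : ℝ) ^ (2 * s) *
          (localMass s v p + (p : ℝ) ^ (-(3 / 4) : ℝ) * mass s v) + mass s v))) := by
        refine mul_le_mul (by linarith) hQ (tsum_nonneg fun q => ?_) (by positivity)
        have := (wt_pos m hp q.1).le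
        have := (wt_pos m hp q.2).le
        unfold convEntry
        positivity
    _ = 4 * C * ((p : ℝ) ^ (2 * s - m) * ((p : ℝ) ^ (1 - m : ℝ) * localMass s v p +
        (p : ℝ) ^ (1 - m - 3 / 4 : ℝ) * mass s v + (p : ℝ) ^ (1 - m - 2 * s : ℝ) * mass s v)) := by
        rw [inv_pow_eq_rpow hm, pow_eq_rpow hm, ← key]
        ring
    _ ≤ 4 * C * ((p : ℝ) ^ (2 * s - m) * (1 * localMass s v p +
        (p : ℝ) ^ (-θ) * A + (p : ℝ) ^ (-θ) * A)) := by gcongr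
    _ ≤ 4 * C * ((p : ℝ) ^ (2 * s - m) * ((1 + 2 * A) * (localMass s v p + (p : ℝ) ^ (-θ)))) := by
        gcongr
        nlinarith [mul_nonneg hA hX]
    _ = _ := by ring

/-- The second order term is bounded by `norm_secondOrder_le`. The third order term is at most a
constant times p · p^{3(s-1)} = p^{2s-1} p^{s-1}, and s - 1 ≤ -3/4. -/
theorem exists_second_order_bound {s : ℝ} (hs : 0 ≤ s) (hs4 : s ≤ 1 / 4) {A : ℝ} (hA : 0 ≤ A) :
    ∃ K : ℝ, 0 ≤ K ∧ ∀ (p : ℕ) (hp : 1 ≤ p) (hodd : Odd (p : ℤ))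
      (v : ℤ → ℂ) (_ : v ∈ hPlusZero (-s)) (_ : mass s v ≤ A) (hv : Summable (convEntry 1 p v))
      (hsmall : ∑' q, convEntry 1 p v q ≤ (1 / 8) ^ 2),
      ‖(pairRoots le_rfl hp hodd v hv hsmall).sum - 2 * (level 1 p : ℝ)‖ ≤
        K * ((p : ℝ) ^ (2 * s - 1) * (localMass s v p + (p : ℝ) ^ (-(3 / 4) : ℝ))) := by
  obtain ⟨C, hC, h⟩ := exists_convEntry_decay (m := 1) le_rfl hs (by push_cast; linarith) hA
  refine ⟨20 * (1 + A) + 10 * √C ^ 3, by positivity,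
    fun p hp hodd v hv0 hvA hv hsmall => ?_⟩
  have hp' : (1 : ℝ) ≤ p := by exact_mod_cast hp
  have hp0 : (0 : ℝ) < p := by linarith
  have hX := localMass_nonneg s v p
  have hth : 0 ≤ (p : ℝ) ^ (-(3 / 4) : ℝ) := by positivity
  have hQ := h p hp v hv0.1.1 hvA
  have b1 := norm_secondOrder_le hs hs4 hp hodd hv0
  have b2 := norm_sum_pairRoots_add_le le_rfl hp hodd hv hsmall hv0.2
  have hpow : (p : ℝ)⁻¹ * (p : ℝ) ^ (2 * s) = (p : ℝ) ^ (2 * s - 1) := by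
    rw [← Real.rpow_neg_one, ← Real.rpow_add hp0]
    congr 1; ring
  have c1 : ‖secondOrder 1 p v‖ ≤ 10 * (1 + A) *
      ((p : ℝ) ^ (2 * s - 1) * (localMass s v p + (p : ℝ) ^ (-(3 / 4) : ℝ))) := by
    refine b1.trans ?_
    rw [← mul_assoc (p : ℝ)⁻¹, hpow]
    calc _ ≤ 10 * ((p : ℝ) ^ (2 * s - 1) * (localMass s v p + (p : ℝ) ^ (-(3 / 4) : ℝ) * A)) := by
          gcongr
      _ ≤ 10 * ((p : ℝ) ^ (2 * s - 1) *
          ((1 + A) * (localMass s v p + (p : ℝ) ^ (-(3 / 4) : ℝ)))) := by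
          gcongr
          nlinarith [mul_nonneg hA hX]
      _ = _ := by ring
  have hsq : √(∑' q, convEntry 1 p v q) ≤ √C * (p : ℝ) ^ (s - 1) := by
    have e : (p : ℝ) ^ (2 * s - (4 * (1 : ℕ) - 2)) = ((p : ℝ) ^ (s - 1)) ^ 2 := by
      rw [← Real.rpow_natCast, ← Real.rpow_mul hp0.le]
      congr 1; push_cast; ring
    refine (Real.sqrt_le_sqrt hQ).trans (le_of_eq ?_)
    rw [e, Real.sqrt_mul hC, Real.sqrt_sq (by positivity)]
  have hw : wt 1 p p ≤ p := by simpa using wt_self_le le_rfl p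
  have c2 : 10 * wt 1 p p * √(∑' q, convEntry 1 p v q) ^ 3 ≤ 10 * √C ^ 3 *
      ((p : ℝ) ^ (2 * s - 1) * (localMass s v p + (p : ℝ) ^ (-(3 / 4) : ℝ))) := by
    have e : (p : ℝ) * ((p : ℝ) ^ (s - 1)) ^ 3 = (p : ℝ) ^ (2 * s - 1) * (p : ℝ) ^ (s - 1) := by
      have : ((p : ℝ) ^ (s - 1)) ^ 3 = (p : ℝ) ^ ((s - 1) * 3) := by
        rw [← Real.rpow_natCast, ← Real.rpow_mul hp0.le]; norm_num
      rw [this, ← Real.rpow_one_add' hp0.le (by linarith), ← Real.rpow_add hp0]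
      congr 1; ring
    calc _ ≤ 10 * (p : ℝ) * (√C * (p : ℝ) ^ (s - 1)) ^ 3 := by
          have := (wt_pos 1 hp p).le
          gcongr
      _ = 10 * √C ^ 3 * ((p : ℝ) ^ (2 * s - 1) * (p : ℝ) ^ (s - 1)) := by
          rw [← e]; ring
      _ ≤ _ := by
          gcongr
          have : (p : ℝ) ^ (s - 1) ≤ (p : ℝ) ^ (-(3 / 4) : ℝ) :=
            Real.rpow_le_rpow_of_exponent_le hp' (by linarith)
          linarith
  have c3 := norm_sub_le ((pairRoots le_rfl hp hodd v hv hsmall).sum - 2 * (level 1 p : ℝ) +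
    2 * secondOrder 1 p v) (2 * secondOrder 1 p v)
  rw [add_sub_cancel_right, norm_mul, Complex.norm_ofNat] at c3
  linarith

theorem exists_sum_pairRoots_bound {m : ℕ} (hm : 1 ≤ m) {s : ℝ} (hs : 0 ≤ s) (hsm : s < m) {A : ℝ}
    (hA : 0 ≤ A) :
    ∃ θ K : ℝ, 1 / 2 < θ ∧ 0 ≤ K ∧ ∀ (p : ℕ) (hp : 1 ≤ p) (hodd : Odd (p : ℤ))
      (v : ℤ → ℂ) (_ : v ∈ hPlusZero (-s)) (_ : mass s v ≤ A) (hv : Summable (convEntry m p v))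
      (hsmall : ∑' q, convEntry m p v q ≤ (1 / 8) ^ 2),
      ‖(pairRoots hm hp hodd v hv hsmall).sum - 2 * (level m p : ℝ)‖ ≤
        K * ((p : ℝ) ^ (2 * s - m) * (localMass s v p + (p : ℝ) ^ (-θ))) := by
  by_cases h : 1 / 2 < m - 1 + 2 * s
  · exact exists_first_order_bound hm hs hsm hA h
  · have hm1 : m = 1 := by
      by_contra h1
      have : (2 : ℝ) ≤ m := by exact_mod_cast (show 2 ≤ m by omega)
      linarith
    subst hm1
    push_cast at h ⊢
    obtain ⟨K, hK, hb⟩ := exists_second_order_bound hs (by linarith) hA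
    exact ⟨3 / 4, K, by norm_num, hK, hb⟩

theorem rpow_le_of_mem {x y t : ℝ} (hy : 0 < y) (h1 : x ≤ 2 * y) (h2 : y ≤ 2 * x) :
    x ^ t ≤ 2 ^ |t| * y ^ t := by
  have hx : 0 < x := by linarith
  rcases le_total 0 t with ht | ht
  · rw [abs_of_nonneg ht, ← Real.mul_rpow (by norm_num) hy.le]
    exact Real.rpow_le_rpow hx.le h1 ht
  · rw [abs_of_nonpos ht]
    calc x ^ t ≤ (y / 2) ^ t := Real.rpow_le_rpow_of_nonpos (by linarith) (by linarith) ht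
      _ = _ := by rw [Real.div_rpow hy.le (by norm_num), Real.rpow_neg (by norm_num)]; ring

/-- Membership in `h^σ` of a sequence that is controlled by the local masses. -/
theorem exists_hNorm_bound {s t σ θ : ℝ} (hσ : σ ≤ t) (hθ : 1 / 2 < θ) {A K : ℝ} :
    ∃ C : ℝ, ∀ v ∈ hSpace (-s), mass s v ≤ A → ∀ r : ℤ → ℂ, (∀ z, z < 1 → r z = 0) →
      (∀ n : ℕ, ‖r (n + 1)‖ ≤ K * (((2 * n + 1 : ℕ) : ℝ) ^ (-t) *
        (localMass s v (2 * n + 1) + ((2 * n + 1 : ℕ) : ℝ) ^ (-θ)))) →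
      r ∈ hSpace σ ∧ hNorm σ r ≤ C := by
  set c : ℝ := 2 * (2 ^ |t| * K) ^ 2 with hc
  set Z : ℝ := ∑' p : ℕ, ((p : ℝ) ^ (-θ)) ^ 2 with hZ
  have sZ : Summable fun p : ℕ => ((p : ℝ) ^ (-θ)) ^ 2 := by
    have h := (Real.summable_nat_rpow (p := -(2 * θ))).mpr (by linarith)
    refine h.congr fun p => ?_
    rw [← Real.rpow_natCast, ← Real.rpow_mul (Nat.cast_nonneg p)]
    congr 1; push_cast; ring
  refine ⟨√(c * (A ^ 2 * ∑' j : ℤ, bracket j ^ (-(3 / 2) : ℝ) + Z)),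
    fun v hv hvA r hr0 hr => ?_⟩
  obtain ⟨sX, bX⟩ := summable_localMass_sq hv
  set F : ℕ → ℝ := fun p => localMass s v p ^ 2 + ((p : ℝ) ^ (-θ)) ^ 2 with hF
  have sF : Summable F := sX.add sZ
  have inj : Function.Injective fun n : ℕ => 2 * n + 1 := fun a b h => by simp only at h; omega
  have injZ : Function.Injective fun n : ℕ => (n : ℤ) + 1 := fun a b h => by simp only at h; omega
  have hle : ∀ n : ℕ, bracket (n + 1) ^ (2 * σ) * ‖r (n + 1)‖ ^ 2 ≤ c * F (2 * n + 1) := by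
    intro n
    set p : ℕ := 2 * n + 1 with hp
    have hpn : (p : ℝ) = 2 * n + 1 := by rw [hp]; push_cast; ring
    have hn : (0 : ℝ) ≤ n := Nat.cast_nonneg n
    have hp0 : (0 : ℝ) < p := by linarith
    have hb : bracket (n + 1) = n + 2 := by
      unfold bracket; push_cast; rw [abs_of_nonneg (by linarith)]; ring
    -- Passing from the index n + 1 to p = 2n + 1: the bracket n + 2 and p agree up to a factor 2.
    have b1 : bracket (n + 1) ^ σ ≤ 2 ^ |t| * (p : ℝ) ^ t :=
      (Real.rpow_le_rpow_of_exponent_le (one_le_bracket _) hσ).trans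
        (rpow_le_of_mem hp0 (by rw [hb]; linarith) (by rw [hb]; linarith))
    have b2 : bracket (n + 1) ^ σ * ‖r (n + 1)‖ ≤
        2 ^ |t| * K * (localMass s v p + (p : ℝ) ^ (-θ)) := by
      calc _ ≤ (2 ^ |t| * (p : ℝ) ^ t) * (K * ((p : ℝ) ^ (-t) *
            (localMass s v p + (p : ℝ) ^ (-θ)))) :=
            mul_le_mul b1 (hr n) (norm_nonneg _) (by positivity)
        _ = ((p : ℝ) ^ t * (p : ℝ) ^ (-t)) *
            (2 ^ |t| * K * (localMass s v p + (p : ℝ) ^ (-θ))) := by ring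
        _ = _ := by rw [← Real.rpow_add hp0, add_neg_cancel, Real.rpow_zero, one_mul]
    have b3 : bracket (n + 1) ^ (2 * σ) * ‖r (n + 1)‖ ^ 2 =
        (bracket (n + 1) ^ σ * ‖r (n + 1)‖) ^ 2 := by
      rw [mul_pow, ← Real.rpow_natCast (bracket (n + 1) ^ σ), ← Real.rpow_mul (bracket_pos _).le]
      congr 2; push_cast; ring
    rw [b3]
    refine (pow_le_pow_left₀ (mul_nonneg (bracket_rpow_nonneg _ _) (norm_nonneg _)) b2 2).trans ?_
    rw [mul_pow, hc, hF]
    nlinarith [mul_nonneg (sq_nonneg (2 ^ |t| * K)) (sq_nonneg (localMass s v p - (p : ℝ) ^ (-θ)))]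
  have sum1 : Summable fun n : ℕ => c * F (2 * n + 1) := (sF.comp_injective inj).mul_left c
  have nonneg : ∀ z : ℤ, 0 ≤ bracket z ^ (2 * σ) * ‖r z‖ ^ 2 := fun z =>
    mul_nonneg (bracket_rpow_nonneg _ _) (sq_nonneg _)
  have sum2 : Summable fun n : ℕ => bracket (n + 1) ^ (2 * σ) * ‖r (n + 1)‖ ^ 2 :=
    Summable.of_nonneg_of_le (fun n => nonneg _) hle sum1
  have supp : ∀ z ∉ Set.range fun n : ℕ => (n : ℤ) + 1, bracket z ^ (2 * σ) * ‖r z‖ ^ 2 = 0 := by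
    intro z hz
    rw [hr0 z, norm_zero]
    · simp
    · by_contra h
      exact hz ⟨(z - 1).toNat, by simp only; omega⟩
  have total : HasSum (fun z : ℤ => bracket z ^ (2 * σ) * ‖r z‖ ^ 2)
      (∑' n : ℕ, bracket (n + 1) ^ (2 * σ) * ‖r (n + 1)‖ ^ 2) :=
    (injZ.hasSum_iff supp).mp sum2.hasSum
  refine ⟨total.summable, ?_⟩
  unfold hNorm
  rw [total.tsum_eq]
  refine Real.sqrt_le_sqrt ((sum2.tsum_le_tsum hle sum1).trans ?_)
  have hc0 : 0 ≤ c := by positivity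
  rw [tsum_mul_left]
  refine mul_le_mul_of_nonneg_left ?_ hc0
  have hF0 : ∀ p, 0 ≤ F p := fun p => by positivity
  refine (tsum_comp_le_tsum_of_inj sF hF0 inj).trans ?_
  rw [hF, sX.tsum_add sZ]
  have hB : 0 ≤ ∑' j : ℤ, bracket j ^ (-(3 / 2) : ℝ) := tsum_nonneg fun j => bracket_rpow_nonneg _ _
  have := pow_le_pow_left₀ (mass_nonneg s v) hvA 2
  have := mul_le_mul_of_nonneg_right this hB
  linarith

theorem mass_le {s R : ℝ} {v : ℤ → ℂ} (h : hNorm (-s) v ≤ R) : mass s v ≤ R ^ 2 :=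
  (Real.sqrt_le_iff.mp h).2


end SemiPeriodic

/-! ### Proof of the theorem -/

open SemiPeriodic

theorem mainTheorem3 (m : ℕ) (hm : 1 ≤ m) (α ε : ℝ) (hα0 : 0 ≤ α) (hα1 : α < 1) (hε : 0 < ε)
    (R : ℝ) :
    ∃ C : ℝ, ∀ (v : ℤ → ℂ) (hv : v ∈ SemiPeriodic.hPlusZero (-(m * α))),
      SemiPeriodic.hNorm (-(m * α)) v ≤ R →
      (∃ lam : ℕ → ℂ, SemiPeriodic.IsEigenvalueSequence
        (SemiPeriodic.operatorT m hm α ⟨hα0, hα1.le⟩ v hv.1) lam) ∧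
      ∀ lam : ℕ → ℂ, SemiPeriodic.IsEigenvalueSequence
        (SemiPeriodic.operatorT m hm α ⟨hα0, hα1.le⟩ v hv.1) lam →
        ∃ r : ℤ → ℂ, r ∈ SemiPeriodic.hSpace (m * (1 - 2 * α - ε)) ∧
          SemiPeriodic.hNorm (m * (1 - 2 * α - ε)) r ≤ C ∧
          ∀ n : ℕ, 1 ≤ n →
            SemiPeriodic.tau lam n =
              (2 * (n : ℂ) - 1) ^ (2 * m) * (Real.pi : ℂ) ^ (2 * m) + r n := by
  have hm' : (1 : ℝ) ≤ m := by exact_mod_cast hm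
  have hs : 0 ≤ m * α := by positivity
  have hsm : m * α < m := by nlinarith
  have hA : 0 ≤ R ^ 2 := sq_nonneg R
  obtain ⟨N, hN, hsmall⟩ := exists_threshold hm hs hsm hA
  obtain ⟨Cs, -, hCs⟩ := exists_hs_bound hm hs hsm
  obtain ⟨θ, K, hθ, hK, hpair⟩ := exists_sum_pairRoots_bound hm hs hsm hA
  set B : ℝ := level m (2 * N : ℕ) + ∑ k ∈ leftSet (2 * N), wt m (2 * N) k with hB
  set g : ℕ → ℝ := fun n =>
    ((2 * n + 1 : ℕ) : ℝ) ^ (2 * (m * α) - m) * ((2 * n + 1 : ℕ) : ℝ) ^ (-θ) with hg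
  have hg0 : ∀ n, 0 < g n := fun n => by positivity
  have hlev : ∀ x : ℝ, 0 ≤ level m x := fun x => by
    unfold level
    have := Real.pi_pos
    have := (even_two_mul m).pow_nonneg x
    positivity
  have hB0 : 0 ≤ B := add_nonneg (hlev _) (Finset.sum_nonneg fun k _ => (wt_pos m (by omega) k).le)
  -- For the finitely many n < N the remainder is only known to be bounded, by B plus the level.
  -- Dividing by the positive number g n makes this fit the same form of estimate; N, B and g depend
  -- only on m, α and R.
  set K' : ℝ := K + ∑ n ∈ Finset.range N, (B + level m ((2 * n + 1 : ℕ) : ℝ)) / g n with hK'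
  have hdiv0 : ∀ n : ℕ, 0 ≤ (B + level m ((2 * n + 1 : ℕ) : ℝ)) / g n := fun n =>
    div_nonneg (add_nonneg hB0 (hlev _)) (hg0 n).le
  have hKK' : K ≤ K' := le_add_of_nonneg_right (Finset.sum_nonneg fun n _ => hdiv0 n)
  -- The estimates give the exponent m(1 - 2α); the stated exponent is smaller.
  have hσ : m * (1 - 2 * α - ε) ≤ m - 2 * (m * α) := by nlinarith
  obtain ⟨C, hC⟩ := exists_hNorm_bound (s := m * α) (A := R ^ 2) (K := K') hσ hθ
  refine ⟨C, fun v hv hvR => ?_⟩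
  have hvA := mass_le hvR
  have hv1 : v ∈ hSpace (-(m * α)) := hv.1.1
  have hsum : ∀ p, 2 * N ≤ p → Summable (convEntry m p v) := fun p hp =>
    (hCs p (by omega) v hv1).1
  obtain ⟨S, hS, hS0, hSi⟩ := exists_spectralBlocks hm ⟨hα0, hα1.le⟩ hv.1 hN hsum
    (fun p hp => hsmall p hp v hv1 hvA)
  refine ⟨?_, fun lam hlam => ?_⟩
  · obtain ⟨lam, h1, h2⟩ := hS.exists_sequence
    exact ⟨lam, h1, h2⟩
  -- The remainder is extended by zero to z < 1. With z = n + 1 the corresponding odd integer is p =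
  -- 2z - 1 = 2n + 1.
  refine ⟨fun z => if 1 ≤ z then tau lam z.toNat - level m (2 * z - 1) else 0, ?_⟩
  refine (fun h : _ ∧ _ => ⟨h.1.1, h.1.2, h.2⟩) ⟨hC v hv1 hvA _ (fun z hz => ?_) fun n => ?_,
    fun n hn => ?_⟩
  · rw [if_neg (by omega)]
  · have e1 : ((n : ℤ) + 1).toNat = n + 1 := by omega
    have e2 : (2 * (((n : ℤ) + 1 : ℤ) : ℝ) - 1) = ((2 * n + 1 : ℕ) : ℝ) := by push_cast; ring
    rw [if_pos (by omega), e1, e2, neg_sub]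
    have hX := localMass_nonneg (m * α) v (2 * n + 1)
    have htau : tau lam (n + 1) = (lam (2 * n + 1) + lam (2 * n + 2)) / 2 := by
      unfold tau
      rw [add_comm (lam (2 * n + 1))]
      rfl
    rw [htau]
    rcases lt_or_ge n N with hnN | hnN
    · have hk : ∀ k, 1 ≤ k → k ≤ 2 * N → ‖lam k‖ ≤ B := fun k h1 h2 => by
        refine hS0 _ ?_
        rw [← (hS.left_indices hlam.count hlam.lex_le).1]
        exact Multiset.mem_map_of_mem lam (Finset.mem_Icc.mpr ⟨h1, h2⟩)
      have n1 : ‖(lam (2 * n + 1) + lam (2 * n + 2)) / 2‖ ≤ B := by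
        rw [norm_div, Complex.norm_ofNat, div_le_iff₀ two_pos]
        have := norm_add_le (lam (2 * n + 1)) (lam (2 * n + 2))
        linarith [hk (2 * n + 1) (by omega) (by omega), hk (2 * n + 2) (by omega) (by omega)]
      have n2 : ‖((level m ((2 * n + 1 : ℕ) : ℝ) : ℝ) : ℂ)‖ = level m ((2 * n + 1 : ℕ) : ℝ) := by
        rw [Complex.norm_real, Real.norm_of_nonneg (hlev _)]
      calc _ ≤ B + level m ((2 * n + 1 : ℕ) : ℝ) := by
            refine (norm_sub_le _ _).trans ?_
            rw [n2]; linarith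
        _ = (B + level m ((2 * n + 1 : ℕ) : ℝ)) / g n * g n := by
            rw [div_mul_cancel₀ _ (hg0 n).ne']
        _ ≤ K' * g n := by
            refine mul_le_mul_of_nonneg_right ?_ (hg0 n).le
            have := Finset.single_le_sum (f := fun n : ℕ =>
              (B + level m ((2 * n + 1 : ℕ) : ℝ)) / g n) (fun n _ => hdiv0 n)
              (Finset.mem_range.mpr hnN)
            linarith
        _ ≤ _ := by
            have : 0 ≤ K' := hK.trans hKK'
            simp only [hg]
            gcongr
            linarith
    -- For n = N + i the two eigenvalues form the pair block at p = 2(N + i) + 1, and the factor 1/2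
    -- of the mean is simply dropped.
    · obtain ⟨i, rfl⟩ := Nat.exists_eq_add_of_le hnN
      have h2 := hpair (2 * (N + i) + 1) (by omega) ⟨(N + i : ℤ), by push_cast; ring⟩ v hv hvA
        (hsum _ (by omega)) (hsmall _ (by omega) v hv1 hvA)
      rw [← hSi i, ← (hS.block_indices hlam.count hlam.lex_le i).2] at h2
      have e3 : ∀ x y : ℂ, x / 2 - y = (x - 2 * y) / 2 := fun x y => by ring
      rw [e3, norm_div, Complex.norm_ofNat]
      refine (half_le_self (norm_nonneg _)).trans (h2.trans ?_)
      gcongr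
  · have e1 : (1 : ℤ) ≤ n := by exact_mod_cast hn
    simp only [e1, if_true, Int.toNat_natCast]
    unfold level
    push_cast
    ring

end
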